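/- **Setting.** Fix $p\in(1,\infty)$. A *dyadic cube* in $\mathbb R^d$ ($d\ge 1$) is a set $2^{-k}([0,1)^d+j)$ with $k\in\mathbb Z$, $j\in\mathbb Z^d$. Let $E$ be a (real) Banach lattice with norm $|\cdot|_E$ and let $\mu$ be a locally finite Borel measure on $\mathbb R^d$. Let $\mathcal D$ be a finite collection of dyadic cubes and let $\lambda_Q:E\to E$, $Q\in\mathcal D$, be positive linear operators (that is, $e\ge 0$ implies $\lambda_Q e\ge 0$). Define $$T_\lambda(f\mu):=\sum_{Q\in\mathcal D}\Big(\lambda_Q\int_Q f\,d\mu\Big)1_Q,\qquad T_{\lambda,R}(f\mu):=\sum_{Q\in\mathcal D,\;Q\subseteq R}\Big(\lambda_Q\int_Q f\,d\mu\Big)1_Q .$$ $L^s_E$ denotes the Lebesgue--Bochner spaces. The *endpoint direct $L^\infty$ testing condition with constant $\mathfrak B\ge 0$* is $$\|T_{\lambda,R}(f\mu)\|_{L^1_E(\mu)}\le \mathfrak B\,\|f\|_{L^\infty_E(R,\mu)}\,\mu(R)\qquad\text{for all }R\in\mathcal D,\ f\in L^\infty_E(R,\mu),$$ and, for $1<t<\infty$,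 the *endpoint direct $L^t$ testing condition with constant $\mathfrak B$* is $$\|T_{\lambda,R}(f\mu)\|_{L^1_E(\mu)}\le \mathfrak B\,\|f\|_{L^t_E(R,\mu)}\,\mu(R)^{1-1/t}\qquad\text{for all }R\in\mathcal D,\ f\in L^t_E(R,\mu).$$ The lattice $E$ has the *(dyadic) Hardy--Littlewood property* (in $\mathbb R^d$) with exponent $r\in(1,\infty)$ and constant $A$ if, for every finite non-empty collection $\mathcal D'$ of dyadic cubes in $\mathbb R^d$ and every $f\in L^r_E(\mathbb R^d,dx)$, $$\Big\|\sup_{Q\in\mathcal D'}\Big(\frac1{|Q|}\int_Q f\,dx\Big)1_Q\Big\|_{L^r_E(dx)}\le A\,\|f\|_{L^r_E(dx)},$$ the supremum being taken pointwise in the lattice order of $E$. The measure $\mu$ is *doubling with constant $C$* if $\mu(B(x,2s))\le C\mu(B(x,s))$ for all $x\in\mathbb R^d$ and $s>0$. **Theorem** ($L^\infty$ testing plus an additional assumption implies boundedness). The operator $T_\lambda(\,\cdot\,\mu):L^p_E(\mu)\to L^p_E(\mu)$ is bounded, with $$\|T_\lambda(f\mu)\|_{L^p_E(\mu)}\le K\,\mathfrak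 B\,\|f\|_{L^p_E(\mu)}\qquad\text{for all } f\in L^p_E(\mu),$$ under any of the following three conditions; in each case the constant $K$ does not depend on $\mathcal D$, $\{\lambda_Q\}$ and $\mathfrak B$. (i) The endpoint direct $L^\infty$ testing condition holds with constant $\mathfrak B$, and $E$ has the Hardy--Littlewood property with some exponent $r\in(1,\infty)$ and constant $A$; here $K$ depends only on $p,d,r,A$. (ii) The endpoint direct $L^\infty$ testing condition holds with constant $\mathfrak B$, and $\mu$ is doubling with constant $C$; here $K$ depends only on $p,d,C$. (iii) The endpoint direct $L^t$ testing condition holds with constant $\mathfrak B$ for some $t\in(p,\infty)$; here $K$ depends only on $p,t$. -/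

import Mathlib

open MeasureTheory
open scoped NNReal ENNReal

universe u

/-- A (standard) dyadic cube in `ℝ^d`, given by its scale `k` and its position `j`:
it stands for the half-open cube `2^{-k} ([0,1)^d + j)`. -/
structure DyadicCube (d : ℕ) where
  scale : ℤ
  pos : Fin d → ℤ

/-- The point set `2^{-k} ([0,1)^d + j)` of a dyadic cube. -/
def DyadicCube.toSet {d : ℕ} (Q : DyadicCube d) : Set (EuclideanSpace ℝ (Fin d)) :=
  {x | ∀ i, (2 : ℝ) ^ (-Q.scale) * (Q.pos i : ℝ) ≤ x i ∧
    x i < (2 : ℝ) ^ (-Q.scale) * ((Q.pos i : ℝ) + 1)}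

section Operators

variable {d : ℕ} {E : Type*} [NormedAddCommGroup E] [NormedSpace ℝ E]

/-- The positive dyadic operator
`T_λ(f μ) = ∑_{Q ∈ 𝒟} (λ_Q ∫_Q f dμ) 1_Q`. -/
noncomputable def dyadicOp (μ : Measure (EuclideanSpace ℝ (Fin d)))
    (D : Finset (DyadicCube d)) (lam : DyadicCube d → E →ₗ[ℝ] E)
    (f : EuclideanSpace ℝ (Fin d) → E) : EuclideanSpace ℝ (Fin d) → E :=
  fun x => ∑ Q ∈ D, Q.toSet.indicator (fun _ => lam Q (∫ y in Q.toSet, f y ∂μ)) x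

open Classical in
/-- The localized operator
`T_{λ,R}(f μ) = ∑_{Q ∈ 𝒟, Q ⊆ R} (λ_Q ∫_Q f dμ) 1_Q`. -/
noncomputable def dyadicOpLoc (μ : Measure (EuclideanSpace ℝ (Fin d)))
    (D : Finset (DyadicCube d)) (lam : DyadicCube d → E →ₗ[ℝ] E) (R : DyadicCube d)
    (f : EuclideanSpace ℝ (Fin d) → E) : EuclideanSpace ℝ (Fin d) → E :=
  dyadicOp μ {Q ∈ D | Q.toSet ⊆ R.toSet} lam f

/-- The endpoint direct `L^∞` testing condition with constant `B`:
`‖T_R(f μ)‖_{L^1_E(μ)} ≤ B ‖f‖_{L^∞_E(R,μ)} μ(R)` for all `R ∈ 𝒟` and `f ∈ L^∞_E(R,μ)`. -/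
def EndpointLinftyTesting (μ : Measure (EuclideanSpace ℝ (Fin d)))
    (D : Finset (DyadicCube d)) (lam : DyadicCube d → E →ₗ[ℝ] E) (B : ℝ≥0) : Prop :=
  ∀ R ∈ D, ∀ f : EuclideanSpace ℝ (Fin d) → E, MemLp f ∞ (μ.restrict R.toSet) →
    eLpNorm (dyadicOpLoc μ D lam R f) 1 μ
      ≤ B * eLpNorm f ∞ (μ.restrict R.toSet) * μ R.toSet

/-- The endpoint direct `L^t` testing condition (`t < ∞`) with constant `B`:
`‖T_R(f μ)‖_{L^1_E(μ)} ≤ B ‖f‖_{L^t_E(R,μ)} μ(R)^{1-1/t}` for all `R ∈ 𝒟` and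
`f ∈ L^t_E(R,μ)`. -/
def EndpointLtTesting (μ : Measure (EuclideanSpace ℝ (Fin d)))
    (D : Finset (DyadicCube d)) (lam : DyadicCube d → E →ₗ[ℝ] E) (t : ℝ) (B : ℝ≥0) : Prop :=
  ∀ R ∈ D, ∀ f : EuclideanSpace ℝ (Fin d) → E,
    MemLp f (ENNReal.ofReal t) (μ.restrict R.toSet) →
    eLpNorm (dyadicOpLoc μ D lam R f) 1 μ
      ≤ B * eLpNorm f (ENNReal.ofReal t) (μ.restrict R.toSet) * μ R.toSet ^ (1 - 1 / t)

/-- `T_λ(· μ)` maps `L^p_E(μ)` into itself with operator norm at most `N`. -/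
def DyadicOpBounded (μ : Measure (EuclideanSpace ℝ (Fin d)))
    (D : Finset (DyadicCube d)) (lam : DyadicCube d → E →ₗ[ℝ] E) (p : ℝ) (N : ℝ≥0) : Prop :=
  ∀ f : EuclideanSpace ℝ (Fin d) → E, MemLp f (ENNReal.ofReal p) μ →
    MemLp (dyadicOp μ D lam f) (ENNReal.ofReal p) μ ∧
    eLpNorm (dyadicOp μ D lam f) (ENNReal.ofReal p) μ
      ≤ N * eLpNorm f (ENNReal.ofReal p) μ

/-- The operators `λ_Q`, `Q ∈ 𝒟`, are positive. -/
def PositiveCoefficients [Lattice E] (D : Finset (DyadicCube d))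
    (lam : DyadicCube d → E →ₗ[ℝ] E) : Prop :=
  ∀ Q ∈ D, ∀ e : E, 0 ≤ e → 0 ≤ lam Q e

/-- The dyadic lattice maximal function (for Lebesgue measure)
`sup_{Q ∈ 𝒟} ⟨f⟩_Q 1_Q`, the supremum being the pointwise one in the lattice `E`. -/
noncomputable def latticeMaximal [Lattice E] (D : Finset (DyadicCube d)) (hD : D.Nonempty)
    (f : EuclideanSpace ℝ (Fin d) → E) : EuclideanSpace ℝ (Fin d) → E :=
  fun x => D.sup' hD fun Q => Q.toSet.indicator (fun _ => ⨍ y in Q.toSet, f y) x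

end Operators

/-- The dyadic maximal operators of all finite collections `𝒟` of dyadic cubes in `ℝ^d` are
bounded on `L^r_E(ℝ^d, dx)` with norm at most `A`. -/
def HardyLittlewoodBound (d : ℕ) (E : Type*) [NormedAddCommGroup E] [NormedSpace ℝ E] [Lattice E]
    (r : ℝ) (A : ℝ≥0) : Prop :=
  ∀ (D : Finset (DyadicCube d)) (hD : D.Nonempty) (f : EuclideanSpace ℝ (Fin d) → E),
    MemLp f (ENNReal.ofReal r) volume →
    eLpNorm (latticeMaximal D hD f) (ENNReal.ofReal r) volume
      ≤ A * eLpNorm f (ENNReal.ofReal r) volume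

/-- `μ` is doubling with constant `C`: `μ(B(x,2s)) ≤ C μ(B(x,s))` for every ball. -/
def IsDoublingWith {d : ℕ} (μ : Measure (EuclideanSpace ℝ (Fin d))) (C : ℝ≥0) : Prop :=
  ∀ (x : EuclideanSpace ℝ (Fin d)) (s : ℝ), 0 < s →
    μ (Metric.ball x (2 * s)) ≤ C * μ (Metric.ball x s)

/-!
Finitely many dyadic cubes form a laminar family (`IsLaminar`): any two are nested or disjoint. On
such a family a step function `∑ c_Q 1_Q` is bounded in `L^p(μ)` by means of a stopping time.
Suppose that below every cube `F` the cubes of an upward closed subfamily, which misses cubes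
covering at most half of `F`, contribute at most `κ ⟨‖f‖⟩_F` pointwise. Removing these subfamilies
one after the other and charging the contribution of `F` to the uncovered half of `F` bounds the
pairing of the step function with `g` by `2 κ ∫ M(‖f‖) M(g)`
(`IsLaminar.lintegral_enorm_stepSum_mul_le`). With `g = ‖∑ c_Q 1_Q‖^(p-1)` and the maximal
inequality, which holds for every measure, this is the `L^p` bound.

For the positive operator, with `f ≥ 0`, it is enough to find below every `F` a nonnegative `h`
whose averages dominate those of `f` over an upward closed subfamily missing little of `F`, and for
which the testing condition bounds the localized operator in `L^1` by a multiple of `∫_F ‖f‖`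
(`HasDominatingFunction`). Positivity passes the `L^1` bound from `h` to `f`, and stopping once
more, where the partial sums grow too large, makes it pointwise (`IsLaminar.eLpNorm_stepSum_le`).
The subfamily consists of light cubes, those reached before the averages of `‖f‖` exceed
`8 ⟨‖f‖⟩_F`. The three conditions provide three functions `h`.

* `L^t` testing: the mass of `f` on the part of each light cube not covered by smaller light cubes
  is spread evenly over the cube. The moved masses form a Carleson sequence, so all moments of the
  spread function are controlled (`IsLaminar.lintegral_spread_pow_le`). Its `L^t` norm is at
  most that of a constant comparable to `⟨‖f‖⟩_F`.
* Doubling: `f` is averaged over the uncovered part of each light cube, in the family of all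
  subcubes of `F` down to the finest scale involved. An uncovered part is empty, a cube of the
  finest scale, or contains a child, so by doubling `h` is bounded by a multiple of `⟨‖f‖⟩_F`
  (`IsLaminar.hasDominatingFunction_of_comparable`).
* The Hardy--Littlewood property: `h` is the lattice maximal function of `f` for `μ` over the light
  cubes, stopped before its norm exceeds a multiple of `⟨‖f‖⟩_F`. The weak type estimate for the
  discarded cubes is Chebyshev's inequality for the maximal function of the evenly spread function
  in `L^r(μ)` (`IsLaminar.hasDominatingFunction_of_latMax`).

The last case requires the lattice maximal inequality for `μ` instead of Lebesgue measure. Step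
functions on a cube are encoded by trees with equal branching (`AvgTree`), for which the property of
`E` gives the inequality (`HardyLittlewoodBound.treeMaximalBound`). The associated Bellman function
is midpoint concave, since two trees can be concatenated, and bounded below on segments, hence
concave. Concavity allows children of arbitrary relative measure, which transfers the inequality to
every measure and every laminar family (`IsLaminar.eLpNorm_latMax_le`).
-/

/-! ### Laminar families of sets -/

section Laminar

open scoped Classical

variable {X : Type*} {D : Finset (Set X)}

/-- The members of the family `D` contained in `F`. -/
noncomputable def below (D : Finset (Set X)) (F : Set X) : Finset (Set X) :=
  {Q ∈ D | Q ⊆ F}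

/-- The step function `∑_{Q ∈ D} c_Q 1_Q`. -/
noncomputable def stepSum {M : Type*} [AddCommMonoid M] (D : Finset (Set X)) (c : Set X → M)
    (x : X) : M :=
  ∑ Q ∈ D, Q.indicator (fun _ => c Q) x

/-- The union of the members of `D`. -/
def unionOf (D : Finset (Set X)) : Set X := ⋃ Q ∈ D, Q

lemma mem_below {F Q : Set X} : Q ∈ below D F ↔ Q ∈ D ∧ Q ⊆ F := by
  simp [below]

lemma below_subset {F : Set X} : below D F ⊆ D := Finset.filter_subset _ _

lemma mem_unionOf {x : X} : x ∈ unionOf D ↔ ∃ Q ∈ D, x ∈ Q := by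
  simp [unionOf]

lemma stepSum_eq_sum_filter {M : Type*} [AddCommMonoid M] (c : Set X → M) (x : X) :
    stepSum D c x = ∑ Q ∈ D with x ∈ Q, c Q := by
  simp [stepSum, Set.indicator_apply, Finset.sum_filter]

lemma stepSum_of_notMem {M : Type*} [AddCommMonoid M] {c : Set X → M} {x : X}
    (hx : x ∉ unionOf D) : stepSum D c x = 0 := by
  refine Finset.sum_eq_zero fun Q hQ => Set.indicator_of_notMem (fun h => hx ?_) _
  exact mem_unionOf.2 ⟨Q, hQ, h⟩

/-- The maximal members of a finite family. -/
noncomputable def maxMembers (D : Finset (Set X)) : Finset (Set X) :=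
  {Q ∈ D | ∀ R ∈ D, Q ⊆ R → R = Q}

lemma exists_maxMembers {Q : Set X} (hQ : Q ∈ D) : ∃ R ∈ maxMembers D, Q ⊆ R := by
  obtain ⟨R, hQR, hR⟩ := D.exists_le_maximal hQ
  refine ⟨R, Finset.mem_filter.2 ⟨hR.1, fun S hS h => ?_⟩, hQR⟩
  exact Set.Subset.antisymm (hR.2 hS h) h

lemma maxMembers_subset : maxMembers D ⊆ D := Finset.filter_subset _ _

lemma unionOf_maxMembers : unionOf (maxMembers D) = unionOf D := by
  ext x
  simp only [mem_unionOf]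
  constructor
  · rintro ⟨Q, hQ, hx⟩
    exact ⟨Q, maxMembers_subset hQ, hx⟩
  · rintro ⟨Q, hQ, hx⟩
    obtain ⟨R, hR, h⟩ := exists_maxMembers hQ
    exact ⟨R, hR, h hx⟩

variable [MeasurableSpace X] {μ : Measure X}

/-- A finite family of nonempty measurable sets of finite measure, any two of which are nested or
disjoint. The stopping time arguments use dyadic cubes only through this property. -/
structure IsLaminar (μ : Measure X) (D : Finset (Set X)) : Prop where
  nonempty : ∀ Q ∈ D, Q.Nonempty
  measurableSet : ∀ Q ∈ D, MeasurableSet Q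
  measure_ne_top : ∀ Q ∈ D, μ Q ≠ ∞
  nested : ∀ Q ∈ D, ∀ R ∈ D, Q ⊆ R ∨ R ⊆ Q ∨ Disjoint Q R

/-- The average of `u` over `Q`; by the conventions of `ℝ≥0∞` it is `0` if `μ Q = 0`. -/
noncomputable def lavg (μ : Measure X) (u : X → ℝ≥0∞) (Q : Set X) : ℝ≥0∞ :=
  (∫⁻ x in Q, u x ∂μ) / μ Q

/-- The maximal function `sup_{Q ∈ D} ⟨u⟩_Q 1_Q`. -/
noncomputable def maxFun (μ : Measure X) (D : Finset (Set X)) (u : X → ℝ≥0∞) (x : X) : ℝ≥0∞ :=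
  D.sup fun Q => Q.indicator (fun _ => lavg μ u Q) x

lemma IsLaminar.subset (hD : IsLaminar μ D) {S : Finset (Set X)} (hS : S ⊆ D) : IsLaminar μ S :=
  ⟨fun Q hQ => hD.1 Q (hS hQ), fun Q hQ => hD.2 Q (hS hQ), fun Q hQ => hD.3 Q (hS hQ),
    fun Q hQ R hR => hD.4 Q (hS hQ) R (hS hR)⟩

lemma IsLaminar.nested_of_mem (hD : IsLaminar μ D) {Q R : Set X} (hQ : Q ∈ D) (hR : R ∈ D)
    {x : X} (hxQ : x ∈ Q) (hxR : x ∈ R) : Q ⊆ R ∨ R ⊆ Q := by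
  rcases hD.nested Q hQ R hR with h | h | h
  · exact Or.inl h
  · exact Or.inr h
  · exact absurd hxR (Set.disjoint_left.1 h hxQ)

lemma IsLaminar.measurableSet_unionOf (hD : IsLaminar μ D) : MeasurableSet (unionOf D) :=
  Finset.measurableSet_biUnion _ hD.measurableSet

lemma IsLaminar.measure_unionOf_ne_top (hD : IsLaminar μ D) : μ (unionOf D) ≠ ∞ :=
  ((measure_biUnion_finset_le D id).trans_lt
    (ENNReal.sum_lt_top.2 fun Q hQ => (hD.measure_ne_top Q hQ).lt_top)).ne

/-- The simple function sending `x` to the set of members of `D` that contain it. Every function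
built pointwise from the family `D` factors through it, which settles all measurability and
boundedness questions. -/
noncomputable def IsLaminar.members (hD : IsLaminar μ D) : SimpleFunc X (Finset (Set X)) where
  toFun x := {Q ∈ D | x ∈ Q}
  measurableSet_fiber' s := by
    have : (fun x => ({Q ∈ D | x ∈ Q} : Finset (Set X))) ⁻¹' {s}
        = {x | ∀ Q ∈ s, Q ∈ D} ∩ ⋂ Q ∈ D, if Q ∈ s then Q else Qᶜ := by
      ext x
      simp only [Set.mem_preimage, Set.mem_singleton_iff, Finset.ext_iff, Finset.mem_filter,
        Set.mem_inter_iff, Set.mem_ofPred_eq, Set.mem_iInter]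
      constructor
      · intro h
        refine ⟨fun Q hQ => ((h Q).2 hQ).1, fun Q hQ => ?_⟩
        split_ifs with hs
        · exact ((h Q).2 hs).2
        · exact fun hx => hs ((h Q).1 ⟨hQ, hx⟩)
      · rintro ⟨h1, h2⟩ Q
        constructor
        · rintro ⟨hQ, hx⟩
          by_contra hs
          have := h2 Q hQ
          rw [if_neg hs] at this
          exact this hx
        · intro hs
          have := h2 Q (h1 Q hs)
          rw [if_pos hs] at this
          exact ⟨h1 Q hs, this⟩
    rw [this]
    refine MeasurableSet.inter (MeasurableSet.const _) ?_
    refine Finset.measurableSet_biInter _ fun Q hQ => ?_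
    split_ifs
    · exact hD.measurableSet Q hQ
    · exact (hD.measurableSet Q hQ).compl
  finite_range' := by
    refine (D.powerset.finite_toSet).subset ?_
    rintro _ ⟨x, rfl⟩
    exact Finset.mem_coe.2 (Finset.mem_powerset.2 (Finset.filter_subset _ _))

lemma IsLaminar.members_apply (hD : IsLaminar μ D) (x : X) :
    hD.members x = {Q ∈ D | x ∈ Q} := rfl

/-- A function of the members of `D` containing `x` is a simple function. -/
lemma IsLaminar.exists_simpleFunc (hD : IsLaminar μ D) {β : Type*} (G : Finset (Set X) → β) :
    ∃ s : SimpleFunc X β, ∀ x, s x = G {Q ∈ D | x ∈ Q} :=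
  ⟨hD.members.map G, fun x => by simp [hD.members_apply]⟩

lemma IsLaminar.exists_simpleFunc_stepSum (hD : IsLaminar μ D) {M : Type*} [AddCommMonoid M]
    (c : Set X → M) : ∃ s : SimpleFunc X M, ⇑s = stepSum D c := by
  obtain ⟨s, hs⟩ := hD.exists_simpleFunc fun T => ∑ Q ∈ T, c Q
  exact ⟨s, funext fun x => by rw [hs, stepSum_eq_sum_filter]⟩

lemma IsLaminar.exists_simpleFunc_maxFun (hD : IsLaminar μ D) (u : X → ℝ≥0∞) :
    ∃ s : SimpleFunc X ℝ≥0∞, ⇑s = maxFun μ D u := by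
  obtain ⟨s, hs⟩ := hD.exists_simpleFunc fun T => T.sup (lavg μ u)
  refine ⟨s, funext fun x => ?_⟩
  rw [hs]
  refine le_antisymm ?_ ?_
  · refine Finset.sup_le fun Q hQ => ?_
    rw [Finset.mem_filter] at hQ
    refine le_trans ?_ (Finset.le_sup hQ.1)
    simp [hQ.2]
  · refine Finset.sup_le fun Q hQ => ?_
    by_cases hx : x ∈ Q
    · simp only [hx, Set.indicator_of_mem]
      exact Finset.le_sup (f := lavg μ u) (Finset.mem_filter.2 ⟨hQ, hx⟩)
    · simp [hx]

lemma lavg_le_maxFun (u : X → ℝ≥0∞) {Q : Set X} (hQ : Q ∈ D) {x : X} (hx : x ∈ Q) :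
    lavg μ u Q ≤ maxFun μ D u x := by
  refine le_trans ?_ (Finset.le_sup hQ)
  simp [hx]

lemma lavg_mul (u : X → ℝ≥0∞) {Q : Set X} (hQ : μ Q ≠ ∞) :
    lavg μ u Q * μ Q = ∫⁻ x in Q, u x ∂μ := by
  by_cases h0 : μ Q = 0
  · rw [h0, mul_zero, Measure.restrict_eq_zero.2 h0, lintegral_zero_measure]
  · exact ENNReal.div_mul_cancel h0 hQ

lemma mul_measure_le_of_le_lavg {u : X → ℝ≥0∞} {Q : Set X} {l : ℝ≥0∞} (h : l ≤ lavg μ u Q)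
    (hQ : μ Q ≠ ∞) : l * μ Q ≤ ∫⁻ x in Q, u x ∂μ := by
  rw [← lavg_mul u hQ]
  gcongr

lemma IsLaminar.pairwiseDisjoint_maxMembers (hD : IsLaminar μ D) :
    Set.PairwiseDisjoint (↑(maxMembers D)) (id : Set X → Set X) := by
  intro Q hQ R hR hne
  have hQ' := Finset.mem_filter.1 (Finset.mem_coe.1 hQ)
  have hR' := Finset.mem_filter.1 (Finset.mem_coe.1 hR)
  rcases hD.nested Q hQ'.1 R hR'.1 with h | h | h
  · exact absurd (hQ'.2 R hR'.1 h).symm hne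
  · exact absurd (hR'.2 Q hQ'.1 h) hne
  · exact h

/-- A bound over each member of a laminar family passes to the union, since the union is the
disjoint union of the maximal members. -/
lemma IsLaminar.mul_measure_unionOf_le (hD : IsLaminar μ D) {u : X → ℝ≥0∞} {l : ℝ≥0∞}
    (h : ∀ Q ∈ D, l * μ Q ≤ ∫⁻ x in Q, u x ∂μ) :
    l * μ (unionOf D) ≤ ∫⁻ x in unionOf D, u x ∂μ := by
  have hm : ∀ Q ∈ maxMembers D, MeasurableSet (id Q) :=
    fun Q hQ => hD.measurableSet Q (maxMembers_subset hQ)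
  have e : unionOf D = ⋃ Q ∈ maxMembers D, id Q := by rw [← unionOf_maxMembers]; rfl
  rw [e, measure_biUnion_finset hD.pairwiseDisjoint_maxMembers hm,
    lintegral_biUnion_finset hD.pairwiseDisjoint_maxMembers hm, Finset.mul_sum]
  exact Finset.sum_le_sum fun Q hQ => h Q (maxMembers_subset hQ)

end Laminar

/-! ### Sparse domination -/

section Sparse

open scoped Classical

variable {X : Type*} [MeasurableSpace X] {μ : Measure X} {D : Finset (Set X)}
  {E : Type*} [NormedAddCommGroup E]

lemma measure_le_two_mul_measure_diff {F U : Set X} (hU : MeasurableSet U) (hF : μ F ≠ ∞)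
    (h : 2 * μ U ≤ μ F) : μ F ≤ 2 * μ (F \ U) := by
  have h1 : μ F ≤ μ U + μ (F \ U) := by
    rw [← measure_inter_add_sdiff F hU]
    gcongr
    exact Set.inter_subset_right
  have hUt : μ U ≠ ∞ := fun h' => hF (top_le_iff.1 (by simpa [h'] using h))
  have h2 : 2 * μ U + μ F ≤ 2 * μ U + 2 * μ (F \ U) := by
    calc 2 * μ U + μ F ≤ μ F + μ F := by gcongr
      _ = 2 * μ F := (two_mul _).symm
      _ ≤ 2 * (μ U + μ (F \ U)) := by gcongr
      _ = _ := mul_add _ _ _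
  exact (ENNReal.add_le_add_iff_left (ENNReal.mul_ne_top (by simp) hUt)).1 h2

/-- Sparse domination in bilinear form. If below each `F ∈ D` an upward closed subfamily `T`, whose
missing cubes cover at most half of `F`, contributes at most `κ ⟨u⟩_F`, then the whole step
function paired with `g` is controlled by the product of the maximal functions of `u` and `g`. The
proof removes such subfamilies below maximal cubes one after the other; the contribution of `F` is
charged to the part of `F` not covered by the remaining cubes. -/
theorem IsLaminar.lintegral_enorm_stepSum_mul_le (hD : IsLaminar μ D) (c : Set X → E)
    {u g : X → ℝ≥0∞} (hg : Measurable g) (κ : ℝ≥0∞)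
    (H : ∀ F ∈ D, μ F ≠ 0 → ∃ T ⊆ below D F, (∀ Q ∈ T, ∀ R ∈ D, Q ⊆ R → R ⊆ F → R ∈ T) ∧
      2 * μ (unionOf (below D F \ T)) ≤ μ F ∧ ∀ x, ‖stepSum T c x‖ₑ ≤ κ * lavg μ u F) :
    ∫⁻ x, ‖stepSum D c x‖ₑ * g x ∂μ
      ≤ 2 * κ * ∫⁻ x in unionOf D, maxFun μ D u x * maxFun μ D g x ∂μ := by
  suffices key : ∀ n, ∀ G ⊆ D, (∀ Q ∈ G, ∀ R ∈ D, R ⊆ Q → R ∈ G) → G.card = n →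
      ∫⁻ x, ‖stepSum G c x‖ₑ * g x ∂μ
        ≤ 2 * κ * ∫⁻ x in unionOf G, maxFun μ D u x * maxFun μ D g x ∂μ from
    key _ D subset_rfl (fun _ _ R hR _ => hR) rfl
  intro n
  induction n using Nat.strong_induction_on with
  | _ n ih =>
  intro G hGD hdown hn
  rcases G.eq_empty_or_nonempty with rfl | ⟨Q₀, hQ₀⟩
  · simp [stepSum]
  obtain ⟨F, hF, -⟩ := exists_maxMembers hQ₀
  obtain ⟨hFG, hFmax⟩ := Finset.mem_filter.1 hF
  have hFD := hGD hFG
  have hbelow : below D F ⊆ G := fun Q hQ =>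
    hdown F hFG Q (mem_below.1 hQ).1 (mem_below.1 hQ).2
  have hFt := hD.measure_ne_top F hFD
  have hFm := hD.measurableSet F hFD
  -- The subfamily to be removed, together with the bound for its contribution.
  obtain ⟨T, hTF, hup, hFT, hT⟩ : ∃ T ⊆ below D F, (∀ Q ∈ T, ∀ R ∈ D, Q ⊆ R → R ⊆ F → R ∈ T) ∧
      F ∈ T ∧ ∫⁻ x, ‖stepSum T c x‖ₑ * g x ∂μ
        ≤ 2 * κ * ∫⁻ x in F \ unionOf (below D F \ T),
            maxFun μ D u x * maxFun μ D g x ∂μ := by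
    by_cases h0 : μ F = 0
    -- A null cube is removed with everything below it: this costs nothing.
    · refine ⟨below D F, subset_rfl, fun Q _ R hR _ hRF => mem_below.2 ⟨hR, hRF⟩,
        mem_below.2 ⟨hFD, subset_rfl⟩, ?_⟩
      have : ∀ x, ‖stepSum (below D F) c x‖ₑ * g x
          = F.indicator (fun x => ‖stepSum (below D F) c x‖ₑ * g x) x := by
        intro x
        by_cases hx : x ∈ F
        · simp [hx]
        · rw [stepSum_of_notMem]
          · simp [hx]
          · rw [mem_unionOf]
            rintro ⟨Q, hQ, hxQ⟩
            exact hx ((mem_below.1 hQ).2 hxQ)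
      rw [lintegral_congr this, lintegral_indicator hFm, Measure.restrict_eq_zero.2 h0,
        lintegral_zero_measure]
      exact zero_le
    obtain ⟨T, hTF, hup, hmeas, hbd⟩ := H F hFD h0
    refine ⟨T, hTF, hup, ?_, ?_⟩
    -- If `F` itself were missing, the missing cubes would cover all of `F`.
    · by_contra hFT
      have h1 : μ F ≤ μ (unionOf (below D F \ T)) := measure_mono fun x hx =>
        mem_unionOf.2 ⟨F, Finset.mem_sdiff.2 ⟨mem_below.2 ⟨hFD, subset_rfl⟩, hFT⟩, hx⟩
      have h2 : 2 * μ F ≤ 1 * μ F := by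
        rw [one_mul]
        exact le_trans (by gcongr) hmeas
      exact absurd ((ENNReal.mul_le_mul_iff_left h0 hFt).1 h2) (by simp)
    · have hU : MeasurableSet (unionOf (below D F \ T)) :=
        (hD.subset (Finset.sdiff_subset.trans (hbelow.trans hGD))).measurableSet_unionOf
      have hb : ∀ x, ‖stepSum T c x‖ₑ * g x
          ≤ F.indicator (fun x => κ * lavg μ u F * g x) x := by
        intro x
        by_cases hx : x ∈ F
        · simp only [hx, Set.indicator_of_mem]
          gcongr
          exact hbd x
        · rw [stepSum_of_notMem]
          · simp
          · rw [mem_unionOf]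
            rintro ⟨Q, hQ, hxQ⟩
            exact hx ((mem_below.1 (hTF hQ)).2 hxQ)
      calc ∫⁻ x, ‖stepSum T c x‖ₑ * g x ∂μ
          ≤ ∫⁻ x, F.indicator (fun x => κ * lavg μ u F * g x) x ∂μ := lintegral_mono hb
        _ = κ * lavg μ u F * ∫⁻ x in F, g x ∂μ := by
            rw [lintegral_indicator hFm, lintegral_const_mul _ hg]
        _ = κ * (lavg μ u F * lavg μ g F) * μ F := by rw [← lavg_mul g hFt]; ring
        _ ≤ κ * (lavg μ u F * lavg μ g F) * (2 * μ (F \ unionOf (below D F \ T))) := by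
            gcongr
            exact measure_le_two_mul_measure_diff hU hFt hmeas
        _ = 2 * κ * ∫⁻ x in F \ unionOf (below D F \ T), lavg μ u F * lavg μ g F ∂μ := by
            rw [setLIntegral_const]; ring
        _ ≤ _ := by
            gcongr 2 * κ * ?_
            refine setLIntegral_mono' (hFm.diff hU) fun x hx => ?_
            gcongr
            · exact lavg_le_maxFun u hFD hx.1
            · exact lavg_le_maxFun g hFD hx.1
  have hTG : T ⊆ G := hTF.trans hbelow
  set U := unionOf (below D F \ T)
  have hUm : MeasurableSet U :=
    (hD.subset (Finset.sdiff_subset.trans (hbelow.trans hGD))).measurableSet_unionOf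
  have hsplit : ∀ x, stepSum G c x = stepSum T c x + stepSum (G \ T) c x := fun x => by
    rw [stepSum, stepSum, stepSum, add_comm, Finset.sum_sdiff hTG]
  have hdown' : ∀ Q ∈ G \ T, ∀ R ∈ D, R ⊆ Q → R ∈ G \ T := by
    intro Q hQ R hR hRQ
    obtain ⟨hQG, hQT⟩ := Finset.mem_sdiff.1 hQ
    refine Finset.mem_sdiff.2 ⟨hdown Q hQG R hR hRQ, fun hRT => hQT ?_⟩
    refine hup R hRT Q (hGD hQG) hRQ ?_
    obtain ⟨x, hx⟩ := hD.nonempty R hR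
    rcases hD.nested_of_mem (hGD hQG) hFD (hRQ hx) ((mem_below.1 (hTF hRT)).2 hx) with h | h
    · exact h
    · exact (hFmax Q hQG h).subset
  have hlt : (G \ T).card < n := by
    rw [← hn]
    exact Finset.card_lt_card (Finset.sdiff_ssubset hTG ⟨F, hFT⟩)
  have hrest := ih _ hlt (G \ T) (Finset.sdiff_subset.trans hGD) hdown' rfl
  have hdisj : Disjoint (F \ U) (unionOf (G \ T)) := by
    rw [Set.disjoint_left]
    rintro x ⟨hxF, hxU⟩ hx
    obtain ⟨Q, hQ, hxQ⟩ := mem_unionOf.1 hx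
    obtain ⟨hQG, hQT⟩ := Finset.mem_sdiff.1 hQ
    have hQF : Q ⊆ F := by
      rcases hD.nested_of_mem (hGD hQG) hFD hxQ hxF with h | h
      · exact h
      · exact (hFmax Q hQG h).subset
    exact hxU (mem_unionOf.2 ⟨Q, Finset.mem_sdiff.2 ⟨mem_below.2 ⟨hGD hQG, hQF⟩, hQT⟩, hxQ⟩)
  have hm' : MeasurableSet (unionOf (G \ T)) :=
    (hD.subset (Finset.sdiff_subset.trans hGD)).measurableSet_unionOf
  obtain ⟨s, hs⟩ := (hD.subset (hTG.trans hGD)).exists_simpleFunc_stepSum c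
  have hmT : Measurable fun x => ‖stepSum T c x‖ₑ * g x := by
    refine Measurable.mul ?_ hg
    rw [← hs]
    exact (s.map fun e : E => ‖e‖ₑ).measurable
  calc ∫⁻ x, ‖stepSum G c x‖ₑ * g x ∂μ
      ≤ ∫⁻ x, (‖stepSum T c x‖ₑ * g x + ‖stepSum (G \ T) c x‖ₑ * g x) ∂μ := by
        refine lintegral_mono fun x => ?_
        rw [hsplit, ← add_mul]
        gcongr
        exact enorm_add_le _ _
    _ = ∫⁻ x, ‖stepSum T c x‖ₑ * g x ∂μ + ∫⁻ x, ‖stepSum (G \ T) c x‖ₑ * g x ∂μ :=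
        lintegral_add_left hmT _
    _ ≤ _ := add_le_add hT hrest
    _ = 2 * κ * ∫⁻ x in (F \ U) ∪ unionOf (G \ T), maxFun μ D u x * maxFun μ D g x ∂μ := by
        rw [← mul_add, lintegral_union hm' hdisj]
    _ ≤ _ := by
        gcongr 2 * κ * ?_
        refine lintegral_mono_set ?_
        rintro x (⟨hx, -⟩ | hx)
        · exact mem_unionOf.2 ⟨F, hFG, hx⟩
        · obtain ⟨Q, hQ, hxQ⟩ := mem_unionOf.1 hx
          exact mem_unionOf.2 ⟨Q, Finset.sdiff_subset hQ, hxQ⟩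

/-- A stopping condition on the partial sums upgrades an `L¹` bound for the contribution of an
upward closed family to a pointwise bound, at the price of discarding a little more measure. -/
theorem IsLaminar.exists_pointwise_of_lintegral [Lattice E] [HasSolidNorm E] [IsOrderedAddMonoid E]
    (hD : IsLaminar μ D) {c : Set X → E} (hc : ∀ Q ∈ D, 0 ≤ c Q) {u : X → ℝ≥0∞} {b : ℝ≥0}
    {F : Set X} (hF : F ∈ D) (hu0 : ∫⁻ x in F, u x ∂μ ≠ 0) (hut : ∫⁻ x in F, u x ∂μ ≠ ∞)
    (H : ∃ T ⊆ below D F, (∀ Q ∈ T, ∀ R ∈ D, Q ⊆ R → R ⊆ F → R ∈ T) ∧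
      4 * μ (unionOf (below D F \ T)) ≤ μ F ∧
      ∫⁻ x, ‖stepSum T c x‖ₑ ∂μ ≤ b * ∫⁻ x in F, u x ∂μ) :
    ∃ T ⊆ below D F, (∀ Q ∈ T, ∀ R ∈ D, Q ⊆ R → R ⊆ F → R ∈ T) ∧
      2 * μ (unionOf (below D F \ T)) ≤ μ F ∧
      ∀ x, ‖stepSum T c x‖ₑ ≤ 4 * b * lavg μ u F := by
  obtain ⟨T, hTF, hup, hmeas, hint⟩ := H
  have hTD : T ⊆ D := hTF.trans (Finset.filter_subset _ _)
  have hFt := hD.measure_ne_top F hF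
  have hF0 : μ F ≠ 0 := fun h => hu0 (by rw [Measure.restrict_eq_zero.2 h, lintegral_zero_measure])
  have hl0 : lavg μ u F ≠ 0 := (ENNReal.div_pos hu0 hFt).ne'
  have hlt : lavg μ u F ≠ ∞ := (ENNReal.div_lt_top hut hF0).ne
  -- The sum of the coefficients on the cubes between `Q` and `F`.
  let a : Set X → E := fun Q => ∑ R ∈ T with Q ⊆ R, c R
  have hmono : ∀ {S S' : Finset (Set X)}, S ⊆ S' → S' ⊆ T →
      ‖∑ R ∈ S, c R‖ₑ ≤ ‖∑ R ∈ S', c R‖ₑ := by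
    intro S S' h h'
    have h0 : 0 ≤ ∑ R ∈ S, c R := Finset.sum_nonneg fun R hR => hc R (hTD (h' (h hR)))
    have h1 : ∑ R ∈ S, c R ≤ ∑ R ∈ S', c R :=
      Finset.sum_le_sum_of_subset_of_nonneg h fun R hR _ => hc R (hTD (h' hR))
    rw [enorm_le_iff_norm_le]
    refine norm_le_norm_of_abs_le_abs ?_
    rwa [abs_of_nonneg h0, abs_of_nonneg (h0.trans h1)]
  let S := T.filter fun Q => ‖a Q‖ₑ ≤ 4 * b * lavg μ u F
  let V := T.filter fun Q => ¬ ‖a Q‖ₑ ≤ 4 * b * lavg μ u F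
  refine ⟨S, (Finset.filter_subset _ _).trans hTF, ?_, ?_, ?_⟩
  · intro Q hQ R hR hQR hRF
    obtain ⟨hQT, hQa⟩ := Finset.mem_filter.1 hQ
    refine Finset.mem_filter.2 ⟨hup Q hQT R hR hQR hRF, le_trans (hmono ?_ ?_) hQa⟩
    · exact fun P hP => Finset.mem_filter.2
        ⟨(Finset.mem_filter.1 hP).1, hQR.trans (Finset.mem_filter.1 hP).2⟩
    · exact Finset.filter_subset _ _
  · -- On the newly discarded cubes the norm of the step function exceeds `4 b ⟨u⟩_F`.
    have hlarge : ∀ x ∈ unionOf V, 4 * b * lavg μ u F < ‖stepSum T c x‖ₑ := by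
      intro x hx
      obtain ⟨Q, hQ, hxQ⟩ := mem_unionOf.1 hx
      obtain ⟨hQT, hQa⟩ := Finset.mem_filter.1 hQ
      refine (not_le.1 hQa).trans_le ?_
      rw [stepSum_eq_sum_filter]
      refine hmono ?_ (Finset.filter_subset _ _)
      exact fun P hP => Finset.mem_filter.2
        ⟨(Finset.mem_filter.1 hP).1, (Finset.mem_filter.1 hP).2 hxQ⟩
    obtain ⟨s, hs⟩ := (hD.subset hTD).exists_simpleFunc_stepSum c
    have hmT : Measurable fun x => ‖stepSum T c x‖ₑ := by
      rw [← hs]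
      exact (s.map fun e : E => ‖e‖ₑ).measurable
    have hV : 4 * μ (unionOf V) ≤ μ F := by
      by_cases hb : b = 0
      · have h0 : ∫⁻ x, ‖stepSum T c x‖ₑ ∂μ = 0 := by simpa [hb] using hint
        have hz := (lintegral_eq_zero_iff hmT).1 h0
        have : μ (unionOf V) = 0 := by
          refine measure_mono_null (fun x hx => ?_) (ae_iff.1 hz)
          have := hlarge x hx
          simp only [hb, ENNReal.coe_zero, mul_zero, zero_mul] at this
          exact this.ne'
        simp [this]
      · have h1 : 4 * b * lavg μ u F * μ (unionOf V) ≤ b * ∫⁻ x in F, u x ∂μ := by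
          refine le_trans ?_ hint
          refine le_trans ?_ (mul_meas_ge_le_lintegral hmT (4 * b * lavg μ u F))
          gcongr
          exact fun x hx => (hlarge x hx).le
        rw [← lavg_mul u hFt] at h1
        have hbl : (b : ℝ≥0∞) * lavg μ u F ≠ 0 := mul_ne_zero (by simpa using hb) hl0
        have hbt : (b : ℝ≥0∞) * lavg μ u F ≠ ∞ := ENNReal.mul_ne_top (by simp) hlt
        refine (ENNReal.mul_le_mul_iff_right hbl hbt).1 ?_
        calc (b : ℝ≥0∞) * lavg μ u F * (4 * μ (unionOf V))
            = 4 * b * lavg μ u F * μ (unionOf V) := by ring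
          _ ≤ _ := h1
          _ = _ := by ring
    have hsub : unionOf (below D F \ S) ⊆ unionOf (below D F \ T) ∪ unionOf V := by
      intro x hx
      obtain ⟨Q, hQ, hxQ⟩ := mem_unionOf.1 hx
      obtain ⟨hQb, hQS⟩ := Finset.mem_sdiff.1 hQ
      by_cases hQT : Q ∈ T
      · refine Or.inr (mem_unionOf.2 ⟨Q, Finset.mem_filter.2 ⟨hQT, fun h => hQS ?_⟩, hxQ⟩)
        exact Finset.mem_filter.2 ⟨hQT, h⟩
      · exact Or.inl (mem_unionOf.2 ⟨Q, Finset.mem_sdiff.2 ⟨hQb, hQT⟩, hxQ⟩)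
    have h4 : 2 * (2 * μ (unionOf (below D F \ S))) ≤ 2 * μ F := by
      calc 2 * (2 * μ (unionOf (below D F \ S)))
          ≤ 2 * (2 * (μ (unionOf (below D F \ T)) + μ (unionOf V))) := by
            gcongr
            exact (measure_mono hsub).trans (measure_union_le _ _)
        _ = 4 * μ (unionOf (below D F \ T)) + 4 * μ (unionOf V) := by ring
        _ ≤ μ F + μ F := add_le_add hmeas hV
        _ = 2 * μ F := (two_mul _).symm
    exact (ENNReal.mul_le_mul_iff_right (by simp) (by simp)).1 h4
  · intro x
    rw [stepSum_eq_sum_filter]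
    rcases (S.filter fun Q => x ∈ Q).eq_empty_or_nonempty with h | h
    · simp [h]
    -- Only the cubes containing the smallest member of `S` around `x` contribute at `x`.
    obtain ⟨Q, hQ⟩ := (S.filter fun Q => x ∈ Q).exists_minimal h
    obtain ⟨hQS, hxQ⟩ := Finset.mem_filter.1 hQ.1
    refine le_trans (hmono ?_ (Finset.filter_subset _ _)) (Finset.mem_filter.1 hQS).2
    intro R hR
    obtain ⟨hRS, hxR⟩ := Finset.mem_filter.1 hR
    have hRT := (Finset.mem_filter.1 hRS).1
    refine Finset.mem_filter.2 ⟨hRT, ?_⟩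
    rcases hD.nested_of_mem (hTD (Finset.mem_filter.1 hQS).1) (hTD hRT) hxQ hxR with h | h
    · exact h
    · exact hQ.2 hR h

end Sparse

/-! ### The maximal inequality and `L^p` bounds -/

section LpBound

open scoped Classical

variable {X : Type*} [MeasurableSpace X] {μ : Measure X} {D : Finset (Set X)}
  {E : Type*} [NormedAddCommGroup E]

/-- Finiteness of `W` is what allows the division by `W ^ (1 / q)`. -/
lemma ENNReal.rpow_one_div_le_of_le_mul_rpow {p q : ℝ} (hpq : p.HolderConjugate q) {W C : ℝ≥0∞}
    (hW : W ≠ ∞) (h : W ≤ C * W ^ (1 / q)) : W ^ (1 / p) ≤ C := by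
  by_cases h0 : W = 0
  · rw [h0, ENNReal.zero_rpow_of_pos (one_div_pos.2 hpq.pos)]
    exact zero_le
  have hne : W ^ (1 / q) ≠ 0 := by
    simp [ENNReal.rpow_eq_zero_iff, h0, hW]
  have hnt : W ^ (1 / q) ≠ ∞ := ENNReal.rpow_ne_top_of_nonneg (one_div_nonneg.2 hpq.symm.nonneg) hW
  refine (ENNReal.mul_le_mul_iff_left hne hnt).1 ?_
  rwa [← ENNReal.rpow_add _ _ h0 hW, one_div p, one_div q, hpq.inv_add_inv_eq_one,
    ENNReal.rpow_one, ← one_div]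

/-- The weak type estimate for the maximal function. -/
lemma IsLaminar.mul_measure_lt_maxFun_le (hD : IsLaminar μ D) (u : X → ℝ≥0∞) (l : ℝ≥0∞) :
    l * μ {x | l < maxFun μ D u x} ≤ ∫⁻ x in {x | l < maxFun μ D u x}, u x ∂μ := by
  have : {x | l < maxFun μ D u x} = unionOf {Q ∈ D | l < lavg μ u Q} := by
    ext x
    simp only [Set.mem_ofPred_eq, maxFun, Finset.lt_sup_iff, mem_unionOf, Finset.mem_filter]
    constructor
    · rintro ⟨Q, hQ, h⟩
      by_cases hx : x ∈ Q
      · exact ⟨Q, ⟨hQ, by simpa [hx] using h⟩, hx⟩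
      · simp [hx] at h
    · rintro ⟨Q, ⟨hQ, h⟩, hx⟩
      exact ⟨Q, hQ, by simpa [hx] using h⟩
  rw [this]
  refine (hD.subset (Finset.filter_subset _ _)).mul_measure_unionOf_le fun Q hQ => ?_
  obtain ⟨hQ, h⟩ := Finset.mem_filter.1 hQ
  exact mul_measure_le_of_le_lavg h.le (hD.measure_ne_top Q hQ)

/-- The maximal inequality in `L^q` for a laminar family, with Doob's constant. -/
theorem IsLaminar.lintegral_maxFun_rpow_le (hD : IsLaminar μ D) {q q' : ℝ}
    (hq : q.HolderConjugate q') {u : X → ℝ≥0∞} (hu : AEMeasurable u μ)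
    (hfin : ∀ Q ∈ D, ∫⁻ x in Q, u x ∂μ ≠ ∞) :
    (∫⁻ x, maxFun μ D u x ^ q ∂μ) ^ (1 / q)
      ≤ ENNReal.ofReal q' * (∫⁻ x, u x ^ q ∂μ) ^ (1 / q) := by
  obtain ⟨s, hs⟩ := hD.exists_simpleFunc_maxFun u
  have hmeas : Measurable (maxFun μ D u) := hs ▸ s.measurable
  have hqpos : 0 < q - 1 := sub_pos.2 hq.lt
  have htop : ∀ x, maxFun μ D u x ≠ ∞ := by
    intro x
    refine ((Finset.sup_lt_iff (by simp)).2 fun Q hQ => ?_).ne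
    by_cases hx : x ∈ Q
    · simp only [hx, Set.indicator_of_mem]
      by_cases h0 : μ Q = 0
      · rw [lavg, Measure.restrict_eq_zero.2 h0]; simp
      · exact ENNReal.div_lt_top (hfin Q hQ) h0
    · simp [hx]
  set m : X → ℝ := fun x => (maxFun μ D u x).toReal
  have hm0 : ∀ x, 0 ≤ m x := fun x => ENNReal.toReal_nonneg
  have hmm : Measurable m := hmeas.ennreal_toReal
  have hrpow : ∀ (a : ℝ), 0 ≤ a → ∀ x, ENNReal.ofReal (m x ^ a) = maxFun μ D u x ^ a := by
    intro a ha x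
    rw [← ENNReal.ofReal_rpow_of_nonneg (hm0 x) ha, ENNReal.ofReal_toReal (htop x)]
  have hlevel : ∀ t : ℝ, 0 < t → {x | t < m x} = {x | ENNReal.ofReal t < maxFun μ D u x} := by
    intro t ht
    ext x
    exact (ENNReal.ofReal_lt_iff_lt_toReal ht.le (htop x)).symm
  set W := ∫⁻ x, maxFun μ D u x ^ q ∂μ
  -- The weak type estimate, integrated against `q t^(q-1) dt`; the integral over `t` is evaluated
  -- by the layer cake formula for the measure `u μ`.
  have h1 : W ≤ ENNReal.ofReal q' * ∫⁻ x, (u * fun x => maxFun μ D u x ^ (q - 1)) x ∂μ := by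
    have e1 : W = ENNReal.ofReal q * ∫⁻ t in Set.Ioi (0 : ℝ),
        μ {x | t < m x} * ENNReal.ofReal (t ^ (q - 1)) := by
      rw [← lintegral_rpow_eq_lintegral_meas_lt_mul μ (Filter.Eventually.of_forall hm0)
        hmm.aemeasurable hq.pos]
      exact lintegral_congr fun x => (hrpow q hq.nonneg x).symm
    have e2 : ∫⁻ x, (u * fun x => maxFun μ D u x ^ (q - 1)) x ∂μ = ENNReal.ofReal (q - 1) *
        ∫⁻ t in Set.Ioi (0 : ℝ), μ.withDensity u {x | t < m x} *
          ENNReal.ofReal (t ^ (q - 1 - 1)) := by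
      rw [← lintegral_rpow_eq_lintegral_meas_lt_mul _ (Filter.Eventually.of_forall hm0)
        hmm.aemeasurable hqpos,
        ← lintegral_withDensity_eq_lintegral_mul₀ hu (hmeas.pow_const _).aemeasurable]
      exact lintegral_congr fun x => (hrpow _ hqpos.le x).symm
    have e3 : ENNReal.ofReal q = ENNReal.ofReal q' * ENNReal.ofReal (q - 1) := by
      rw [← ENNReal.ofReal_mul hq.symm.nonneg, mul_comm, hq.sub_one_mul_conj]
    rw [e1, e2, ← mul_assoc, ← e3]
    gcongr 1
    refine setLIntegral_mono' measurableSet_Ioi fun t ht => ?_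
    have ht : 0 < t := ht
    have hw : ENNReal.ofReal t * μ {x | t < m x} ≤ μ.withDensity u {x | t < m x} := by
      rw [withDensity_apply _ (measurableSet_lt measurable_const hmm), hlevel t ht]
      exact hD.mul_measure_lt_maxFun_le u _
    calc μ {x | t < m x} * ENNReal.ofReal (t ^ (q - 1))
        = ENNReal.ofReal t * μ {x | t < m x} * ENNReal.ofReal (t ^ (q - 1 - 1)) := by
          rw [mul_right_comm, mul_comm _ (μ _), ← ENNReal.ofReal_mul ht.le]
          congr 2
          rw [← Real.rpow_one_add' ht.le (by linarith)]
          congr 1; ring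
      _ ≤ _ := by gcongr
  -- The maximal function takes finitely many finite values and vanishes off a set of finite
  -- measure.
  have hW : W ≠ ∞ := by
    have e : ∀ x, maxFun μ D u x ^ q = (s.map fun y => y ^ q) x := fun x => by simp [hs]
    have hz : ∀ x ∉ unionOf D, maxFun μ D u x ^ q = 0 := by
      intro x hx
      have : maxFun μ D u x = 0 := by
        refine (Finset.sup_eq_bot_iff _ _).2 fun Q hQ => ?_
        exact Set.indicator_of_notMem (fun h => hx (mem_unionOf.2 ⟨Q, hQ, h⟩)) _
      rw [this, ENNReal.zero_rpow_of_pos hq.pos]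
    have e' : W = ∫⁻ x in unionOf D, (s.map fun y => y ^ q) x ∂μ := by
      rw [← lintegral_indicator hD.measurableSet_unionOf]
      refine lintegral_congr fun x => ?_
      by_cases hx : x ∈ unionOf D
      · rw [Set.indicator_of_mem hx, e]
      · rw [Set.indicator_of_notMem hx, hz x hx]
    obtain ⟨C, hC⟩ : ∃ C : ℝ≥0∞, C ≠ ∞ ∧ ∀ x, maxFun μ D u x ^ q ≤ C := by
      refine ⟨s.range.sup fun y => y ^ q, ?_, fun x => ?_⟩
      · refine ((Finset.sup_lt_iff (by simp)).2 fun y hy => ?_).ne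
        obtain ⟨x, rfl⟩ := SimpleFunc.mem_range.1 hy
        rw [hs]
        exact ENNReal.rpow_lt_top_of_nonneg hq.nonneg (htop x)
      · rw [← hs]
        exact Finset.le_sup (f := fun y : ℝ≥0∞ => y ^ q) (SimpleFunc.mem_range_self s x)
    rw [e']
    refine (lt_of_le_of_lt (b := C * μ (unionOf D)) ?_ ?_).ne
    · rw [← setLIntegral_const]
      exact lintegral_mono fun x => (e x) ▸ hC.2 x
    · exact ENNReal.mul_lt_top hC.1.lt_top hD.measure_unionOf_ne_top.lt_top
  have h2 := ENNReal.lintegral_mul_le_Lp_mul_Lq μ hq hu (hmeas.pow_const (q - 1)).aemeasurable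
  have e4 : ∫⁻ x, (maxFun μ D u x ^ (q - 1)) ^ q' ∂μ = W := by
    refine lintegral_congr fun x => ?_
    rw [← ENNReal.rpow_mul, hq.sub_one_mul_conj]
  rw [e4] at h2
  refine ENNReal.rpow_one_div_le_of_le_mul_rpow hq hW (h1.trans ?_)
  rw [mul_assoc]
  gcongr

/-- The `L^p` bound that follows from the sparse domination hypothesis, tested against
`g = ‖∑ c_Q 1_Q‖^(p-1)`. -/
theorem IsLaminar.lintegral_enorm_stepSum_rpow_le (hD : IsLaminar μ D) {p p' : ℝ}
    (hp : p.HolderConjugate p') (c : Set X → E) {u : X → ℝ≥0∞} (hu : AEMeasurable u μ)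
    (hfin : ∀ Q ∈ D, ∫⁻ x in Q, u x ∂μ ≠ ∞) (κ : ℝ≥0∞)
    (H : ∀ F ∈ D, μ F ≠ 0 → ∃ T ⊆ below D F, (∀ Q ∈ T, ∀ R ∈ D, Q ⊆ R → R ⊆ F → R ∈ T) ∧
      2 * μ (unionOf (below D F \ T)) ≤ μ F ∧ ∀ x, ‖stepSum T c x‖ₑ ≤ κ * lavg μ u F) :
    (∫⁻ x, ‖stepSum D c x‖ₑ ^ p ∂μ) ^ (1 / p)
      ≤ 2 * κ * ENNReal.ofReal p' * ENNReal.ofReal p * (∫⁻ x, u x ^ p ∂μ) ^ (1 / p) := by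
  have hp1 : 0 < p - 1 := sub_pos.2 hp.lt
  obtain ⟨s, hs⟩ := hD.exists_simpleFunc_stepSum c
  have hm : Measurable fun x => ‖stepSum D c x‖ₑ := by
    rw [← hs]; exact (s.map fun e : E => ‖e‖ₑ).measurable
  have hbound : ∃ C : ℝ≥0∞, C ≠ ∞ ∧ ∀ x, ‖stepSum D c x‖ₑ ≤ C := by
    refine ⟨∑ Q ∈ D, ‖c Q‖ₑ, (ENNReal.sum_lt_top.2 fun Q _ => by simp).ne, fun x => ?_⟩
    refine (enorm_sum_le _ _).trans (Finset.sum_le_sum fun Q _ => ?_)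
    by_cases hx : x ∈ Q <;> simp [hx]
  obtain ⟨C, hC, hCx⟩ := hbound
  set g : X → ℝ≥0∞ := fun x => ‖stepSum D c x‖ₑ ^ (p - 1)
  have hg : Measurable g := hm.pow_const _
  have hgfin : ∀ Q ∈ D, ∫⁻ x in Q, g x ∂μ ≠ ∞ := by
    intro Q hQ
    refine (lt_of_le_of_lt (b := C ^ (p - 1) * μ Q) ?_ ?_).ne
    · rw [← setLIntegral_const]
      exact lintegral_mono fun x => ENNReal.rpow_le_rpow (hCx x) hp1.le
    · exact ENNReal.mul_lt_top (ENNReal.rpow_lt_top_of_nonneg hp1.le hC)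
        (hD.measure_ne_top Q hQ).lt_top
  set W := ∫⁻ x, ‖stepSum D c x‖ₑ ^ p ∂μ
  have hWe : W = ∫⁻ x, ‖stepSum D c x‖ₑ * g x ∂μ := by
    refine lintegral_congr fun x => ?_
    conv_rhs => rw [← ENNReal.rpow_one ‖stepSum D c x‖ₑ]
    rw [show g x = ‖stepSum D c x‖ₑ ^ (p - 1) from rfl,
      ← ENNReal.rpow_add_of_nonneg _ _ zero_le_one hp1.le]
    congr 1; ring
  have hW : W ≠ ∞ := by
    have : W ≤ ∫⁻ x in unionOf D, C ^ p ∂μ := by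
      rw [← lintegral_indicator hD.measurableSet_unionOf]
      refine lintegral_mono fun x => ?_
      by_cases hx : x ∈ unionOf D
      · rw [Set.indicator_of_mem hx]
        exact ENNReal.rpow_le_rpow (hCx x) hp.nonneg
      · simp [stepSum_of_notMem hx, hp.pos]
    rw [setLIntegral_const] at this
    exact (this.trans_lt (ENNReal.mul_lt_top (ENNReal.rpow_lt_top_of_nonneg hp.nonneg hC)
      hD.measure_unionOf_ne_top.lt_top)).ne
  obtain ⟨su, hsu⟩ := hD.exists_simpleFunc_maxFun u
  obtain ⟨sg, hsg⟩ := hD.exists_simpleFunc_maxFun g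
  have hge : ∫⁻ x, g x ^ p' ∂μ = W := by
    refine lintegral_congr fun x => ?_
    rw [show g x = ‖stepSum D c x‖ₑ ^ (p - 1) from rfl, ← ENNReal.rpow_mul, hp.sub_one_mul_conj]
  refine ENNReal.rpow_one_div_le_of_le_mul_rpow hp hW ?_
  calc W = ∫⁻ x, ‖stepSum D c x‖ₑ * g x ∂μ := hWe
    _ ≤ 2 * κ * ∫⁻ x in unionOf D, maxFun μ D u x * maxFun μ D g x ∂μ :=
        hD.lintegral_enorm_stepSum_mul_le c hg κ H
    _ ≤ 2 * κ * ∫⁻ x, (maxFun μ D u * maxFun μ D g) x ∂μ := by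
        gcongr 2 * κ * ?_
        exact setLIntegral_le_lintegral _ _
    _ ≤ 2 * κ * ((∫⁻ x, maxFun μ D u x ^ p ∂μ) ^ (1 / p) *
          (∫⁻ x, maxFun μ D g x ^ p' ∂μ) ^ (1 / p')) := by
        gcongr 2 * κ * ?_
        exact ENNReal.lintegral_mul_le_Lp_mul_Lq μ hp (hsu ▸ su.measurable).aemeasurable
          (hsg ▸ sg.measurable).aemeasurable
    _ ≤ 2 * κ * ((ENNReal.ofReal p' * (∫⁻ x, u x ^ p ∂μ) ^ (1 / p)) *
          (ENNReal.ofReal p * (∫⁻ x, g x ^ p' ∂μ) ^ (1 / p'))) := by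
        gcongr 2 * κ * (?_ * ?_)
        · exact hD.lintegral_maxFun_rpow_le hp hu hfin
        · exact hD.lintegral_maxFun_rpow_le hp.symm hg.aemeasurable hgfin
    _ = _ := by rw [hge]; ring

end LpBound

/-! ### Light cubes, spreading of mass and Carleson sums -/

section Stopping

open scoped Classical

variable {X : Type*} {D T : Finset (Set X)}

/-- The part of `Q` not covered by the strictly smaller members of `T`. -/
def ownPart (T : Finset (Set X)) (Q : Set X) : Set X := Q \ unionOf {R ∈ T | R ⊂ Q}

lemma ownPart_subset {Q : Set X} : ownPart T Q ⊆ Q := Set.sdiff_subset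

lemma biUnion_ownPart {R : Set X} (hR : R ∈ T) :
    ⋃ Q ∈ below T R, ownPart T Q = R := by
  ext x
  simp only [Set.mem_iUnion]
  constructor
  · rintro ⟨Q, hQ, hx⟩
    exact (mem_below.1 hQ).2 (ownPart_subset hx)
  · intro hx
    obtain ⟨Q, hQ⟩ := ((below T R).filter fun Q => x ∈ Q).exists_minimal
      ⟨R, Finset.mem_filter.2 ⟨mem_below.2 ⟨hR, subset_rfl⟩, hx⟩⟩
    obtain ⟨hQR, hxQ⟩ := Finset.mem_filter.1 hQ.1
    refine ⟨Q, hQR, hxQ, fun hx' => ?_⟩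
    obtain ⟨S, hS, hxS⟩ := mem_unionOf.1 hx'
    obtain ⟨hST, hSQ⟩ := Finset.mem_filter.1 hS
    refine hSQ.2 (hQ.2 (Finset.mem_filter.2 ⟨mem_below.2 ⟨hST, ?_⟩, hxS⟩) hSQ.1)
    exact hSQ.1.trans (mem_below.1 hQR).2

/-- In a chain of sets the power of a sum is dominated by the sum of the increments. -/
lemma sum_pow_succ_le_of_isChain {β : Set X → ℝ≥0∞} (n : ℕ) (S : Finset (Set X))
    (hS : ∀ Q ∈ S, ∀ R ∈ S, Q ⊆ R ∨ R ⊆ Q) :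
    (∑ Q ∈ S, β Q) ^ (n + 1)
      ≤ (n + 1) * ∑ Q ∈ S, β Q * (∑ R ∈ S with R ⊆ Q, β R) ^ n := by
  have hpow : ∀ (s b : ℝ≥0∞) (n : ℕ), (s + b) ^ (n + 1)
      ≤ s ^ (n + 1) + (n + 1) * (b * (s + b) ^ n) := by
    intro s b n
    induction n with
    | zero => simp
    | succ n ih =>
      calc (s + b) ^ (n + 1 + 1) = s * (s + b) ^ (n + 1) + b * (s + b) ^ (n + 1) := by ring
        _ ≤ s * (s ^ (n + 1) + (n + 1) * (b * (s + b) ^ n)) + b * (s + b) ^ (n + 1) := by gcongr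
        _ = s ^ (n + 1 + 1) + (n + 1) * (b * (s * (s + b) ^ n)) + b * (s + b) ^ (n + 1) := by ring
        _ ≤ s ^ (n + 1 + 1) + (n + 1) * (b * ((s + b) * (s + b) ^ n))
              + b * (s + b) ^ (n + 1) := by
            gcongr
            exact le_self_add
        _ = _ := by push_cast; ring
  induction hk : S.card generalizing S with
  | zero => simp [Finset.card_eq_zero.1 hk]
  | succ k ih =>
    obtain ⟨M, hM⟩ := S.exists_maximal (Finset.card_pos.1 (by omega))
    have htop : ∀ Q ∈ S, Q ⊆ M := fun Q hQ => by
      rcases hS Q hQ M hM.1 with h | h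
      · exact h
      · exact hM.2 hQ h
    have hih := ih (S.erase M) (fun Q hQ R hR => hS Q (Finset.mem_of_mem_erase hQ) R
      (Finset.mem_of_mem_erase hR)) (by rw [Finset.card_erase_of_mem hM.1, hk]; rfl)
    have hsum : ∑ R ∈ S with R ⊆ M, β R = ∑ Q ∈ S.erase M, β Q + β M := by
      rw [Finset.filter_true_of_mem htop, Finset.sum_erase_add _ _ hM.1]
    rw [← Finset.sum_erase_add S _ hM.1, ← Finset.sum_erase_add S _ hM.1, hsum, mul_add]
    refine (hpow _ _ _).trans ?_
    gcongr
    refine hih.trans ?_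
    gcongr
    exact Finset.erase_subset _ _

variable [MeasurableSpace X] {μ : Measure X}

/-- The cubes below `F` reached before the averages of `u` exceed `8 ⟨u⟩_F`. -/
noncomputable def lightBelow (μ : Measure X) (D : Finset (Set X)) (u : X → ℝ≥0∞) (F : Set X) :
    Finset (Set X) :=
  {Q ∈ below D F | ∀ R ∈ D, Q ⊆ R → R ⊆ F → lavg μ u R ≤ 8 * lavg μ u F}

lemma lightBelow_subset_below {u : X → ℝ≥0∞} {F : Set X} : lightBelow μ D u F ⊆ below D F :=
  Finset.filter_subset _ _

lemma self_mem_lightBelow {u : X → ℝ≥0∞} {F : Set X} (hF : F ∈ D) : F ∈ lightBelow μ D u F := by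
  refine Finset.mem_filter.2 ⟨mem_below.2 ⟨hF, subset_rfl⟩, fun R _ h1 h2 => ?_⟩
  rw [Set.Subset.antisymm h2 h1]
  exact le_mul_of_one_le_left' (by norm_num)

lemma lightBelow_upward {u : X → ℝ≥0∞} {F Q R : Set X} (hQ : Q ∈ lightBelow μ D u F) (hR : R ∈ D)
    (hQR : Q ⊆ R) (hRF : R ⊆ F) : R ∈ lightBelow μ D u F :=
  Finset.mem_filter.2 ⟨mem_below.2 ⟨hR, hRF⟩, fun S hS h1 h2 =>
    (Finset.mem_filter.1 hQ).2 S hS (hQR.trans h1) h2⟩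

lemma lavg_le_of_mem_lightBelow {u : X → ℝ≥0∞} {F Q : Set X} (hQ : Q ∈ lightBelow μ D u F) :
    lavg μ u Q ≤ 8 * lavg μ u F :=
  (Finset.mem_filter.1 hQ).2 Q (mem_below.1 (Finset.mem_filter.1 hQ).1).1 subset_rfl
    (mem_below.1 (Finset.mem_filter.1 hQ).1).2

/-- The weak type estimate for the discarded cubes. -/
lemma IsLaminar.measure_unionOf_sdiff_lightBelow_le (hD : IsLaminar μ D) {u : X → ℝ≥0∞}
    {F : Set X} (hF : F ∈ D) (hu0 : ∫⁻ x in F, u x ∂μ ≠ 0) (hut : ∫⁻ x in F, u x ∂μ ≠ ∞) :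
    8 * μ (unionOf (below D F \ lightBelow μ D u F)) ≤ μ F := by
  have hFt := hD.measure_ne_top F hF
  have hF0 : μ F ≠ 0 := fun h => hu0 (by rw [Measure.restrict_eq_zero.2 h, lintegral_zero_measure])
  have hl0 : lavg μ u F ≠ 0 := (ENNReal.div_pos hu0 hFt).ne'
  have hlt : lavg μ u F ≠ ∞ := (ENNReal.div_lt_top hut hF0).ne
  set S : Finset (Set X) := {R ∈ below D F | 8 * lavg μ u F < lavg μ u R}
  have hSD : S ⊆ D := (Finset.filter_subset _ _).trans below_subset
  have hsub : unionOf (below D F \ lightBelow μ D u F) ⊆ unionOf S := by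
    intro x hx
    obtain ⟨Q, hQ, hxQ⟩ := mem_unionOf.1 hx
    obtain ⟨hQb, hQl⟩ := Finset.mem_sdiff.1 hQ
    have : ¬ ∀ R ∈ D, Q ⊆ R → R ⊆ F → lavg μ u R ≤ 8 * lavg μ u F :=
      fun h => hQl (Finset.mem_filter.2 ⟨hQb, h⟩)
    push Not at this
    obtain ⟨R, hR, hQR, hRF, h⟩ := this
    exact mem_unionOf.2 ⟨R, Finset.mem_filter.2 ⟨mem_below.2 ⟨hR, hRF⟩, h⟩, hQR hxQ⟩
  have h1 : 8 * lavg μ u F * μ (unionOf S) ≤ lavg μ u F * μ F := by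
    rw [lavg_mul u hFt]
    refine ((hD.subset hSD).mul_measure_unionOf_le fun Q hQ => ?_).trans (lintegral_mono_set ?_)
    · exact mul_measure_le_of_le_lavg (Finset.mem_filter.1 hQ).2.le (hD.measure_ne_top Q (hSD hQ))
    · intro x hx
      obtain ⟨Q, hQ, hxQ⟩ := mem_unionOf.1 hx
      exact (mem_below.1 (Finset.mem_filter.1 hQ).1).2 hxQ
  refine (ENNReal.mul_le_mul_iff_right hl0 hlt).1 ?_
  calc lavg μ u F * (8 * μ (unionOf (below D F \ lightBelow μ D u F)))
      ≤ lavg μ u F * (8 * μ (unionOf S)) := by gcongr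
    _ = 8 * lavg μ u F * μ (unionOf S) := by ring
    _ ≤ _ := h1

lemma IsLaminar.measurableSet_ownPart (hT : IsLaminar μ T) {Q : Set X} (hQ : Q ∈ T) :
    MeasurableSet (ownPart T Q) :=
  (hT.measurableSet Q hQ).diff (hT.subset (Finset.filter_subset _ _)).measurableSet_unionOf

lemma IsLaminar.pairwiseDisjoint_ownPart (hT : IsLaminar μ T) :
    Set.PairwiseDisjoint (↑T : Set (Set X)) (ownPart T) := by
  intro Q hQ R hR hne
  refine Set.disjoint_left.2 ?_
  rintro x ⟨hxQ, hQ'⟩ ⟨hxR, hR'⟩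
  rcases hT.nested_of_mem hQ hR hxQ hxR with h | h
  · exact hR' (mem_unionOf.2 ⟨Q, Finset.mem_filter.2 ⟨hQ, h.ssubset_of_ne hne⟩, hxQ⟩)
  · exact hQ' (mem_unionOf.2 ⟨R, Finset.mem_filter.2 ⟨hR, h.ssubset_of_ne hne.symm⟩, hxR⟩)

lemma IsLaminar.sum_lintegral_ownPart (hT : IsLaminar μ T) {R : Set X} (hR : R ∈ T)
    (u : X → ℝ≥0∞) :
    ∑ Q ∈ below T R, ∫⁻ x in ownPart T Q, u x ∂μ = ∫⁻ x in R, u x ∂μ := by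
  rw [← lintegral_biUnion_finset (hT.pairwiseDisjoint_ownPart.subset
    (Finset.coe_subset.2 below_subset)) fun Q hQ => hT.measurableSet_ownPart (below_subset hQ),
    biUnion_ownPart hR]

lemma IsLaminar.sum_integral_ownPart {E : Type*} [NormedAddCommGroup E] [NormedSpace ℝ E]
    (hT : IsLaminar μ T) {R : Set X} (hR : R ∈ T) {f : X → E} (hf : IntegrableOn f R μ) :
    ∑ Q ∈ below T R, ∫ x in ownPart T Q, f x ∂μ = ∫ x in R, f x ∂μ := by
  rw [← integral_biUnion_finset _ (fun Q hQ => hT.measurableSet_ownPart (below_subset hQ))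
    (hT.pairwiseDisjoint_ownPart.subset (Finset.coe_subset.2 below_subset))
    (fun Q hQ => hf.mono_set (ownPart_subset.trans (mem_below.1 hQ).2)),
    biUnion_ownPart hR]

section Spread

variable {E : Type*} [NormedAddCommGroup E] [NormedSpace ℝ E]

/-- The step function obtained from `f` by spreading its mass on the part of `Q ∈ T` not covered by
smaller members of `T` evenly over `W Q`, which will be `Q` or the uncovered part itself. -/
noncomputable def spread (μ : Measure X) (T : Finset (Set X)) (W : Set X → Set X) (f : X → E)
    (x : X) : E :=
  ∑ Q ∈ T, (W Q).indicator (fun _ => (μ.real (W Q))⁻¹ • ∫ y in ownPart T Q, f y ∂μ) x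

variable {W : Set X → Set X} {f : X → E}

lemma stronglyMeasurable_spread (hW : ∀ Q ∈ T, MeasurableSet (W Q)) :
    StronglyMeasurable (spread μ T W f) :=
  Finset.stronglyMeasurable_fun_sum _ fun Q hQ => stronglyMeasurable_const.indicator (hW Q hQ)

variable [Lattice E] [HasSolidNorm E] [IsOrderedAddMonoid E] [IsOrderedModule ℝ E]

lemma spread_nonneg (hf : 0 ≤ f) (x : X) : 0 ≤ spread μ T W f x := by
  refine Finset.sum_nonneg fun Q _ => Set.indicator_nonneg (fun _ _ => ?_) _
  exact smul_nonneg (inv_nonneg.2 measureReal_nonneg) (integral_nonneg hf)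

variable [CompleteSpace E]

/-- Spreading inside `Q` moves mass only within the members of `T` containing `Q`, so it does not
decrease the integral of a nonnegative function over any member of `T`. -/
lemma IsLaminar.integral_le_integral_spread (hT : IsLaminar μ T)
    (hW : ∀ Q ∈ T, MeasurableSet (W Q)) (hWQ : ∀ Q ∈ T, W Q ⊆ Q)
    (hoW : ∀ Q ∈ T, ownPart T Q ⊆ W Q) (hf : 0 ≤ f) {R : Set X} (hR : R ∈ T)
    (hfi : IntegrableOn f R μ) :
    ∫ x in R, f x ∂μ ≤ ∫ x in R, spread μ T W f x ∂μ := by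
  have hint : ∀ Q ∈ T, Integrable ((W Q).indicator
      (fun _ => (μ.real (W Q))⁻¹ • ∫ y in ownPart T Q, f y ∂μ)) (μ.restrict R) := by
    intro Q hQ
    refine (integrable_indicator_iff (hW Q hQ)).2 (integrableOn_const ?_)
    refine ((Measure.restrict_apply_le _ _).trans_lt ?_).ne
    exact (measure_mono (hWQ Q hQ)).trans_lt (hT.measure_ne_top Q hQ).lt_top
  have h0 : ∀ Q, 0 ≤ (μ.real (W Q))⁻¹ • ∫ y in ownPart T Q, f y ∂μ := fun Q =>
    smul_nonneg (inv_nonneg.2 measureReal_nonneg) (integral_nonneg hf)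
  unfold spread
  rw [integral_finsetSum _ hint, ← hT.sum_integral_ownPart hR hfi]
  refine le_trans (Finset.sum_le_sum fun Q hQ => ?_)
    (Finset.sum_le_sum_of_subset_of_nonneg below_subset fun Q _ _ =>
      integral_nonneg fun x => Set.indicator_nonneg (fun _ _ => h0 Q) x)
  obtain ⟨hQT, hQR⟩ := mem_below.1 hQ
  rw [setIntegral_indicator (hW Q hQT), Set.inter_eq_right.2 ((hWQ Q hQT).trans hQR),
    setIntegral_const, smul_smul]
  have hWt : μ (W Q) ≠ ∞ :=
    ((measure_mono (hWQ Q hQT)).trans_lt (hT.measure_ne_top Q hQT).lt_top).ne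
  by_cases hz : μ (W Q) = 0
  · have : μ (ownPart T Q) = 0 := measure_mono_null (hoW Q hQT) hz
    simp [Measure.restrict_eq_zero.2 this]
  · rw [mul_inv_cancel₀ ((measureReal_ne_zero_iff hWt).2 hz), one_smul]

end Spread

/-- Exponential integrability of Carleson sums, in terms of moments: the bound for the power `n + 1`
at a point reduces, by summation along the chain of members containing it, to the bound for the
power `n` over smaller members. -/
lemma IsLaminar.lintegral_stepSum_pow_le (hT : IsLaminar μ T) {β : Set X → ℝ≥0∞} {C : ℝ≥0∞}
    (hβ : ∀ R ∈ T, ∑ Q ∈ below T R, β Q * μ Q ≤ C * μ R) (n : ℕ) :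
    ∀ R ∈ T, ∫⁻ x in R, stepSum (below T R) β x ^ n ∂μ ≤ n.factorial * C ^ n * μ R := by
  induction n with
  | zero => intro R _; simp
  | succ n ih =>
    intro R hR
    have hmeas : ∀ Q ∈ T, Measurable fun x => β Q * stepSum (below T Q) β x ^ n := by
      intro Q hQ
      obtain ⟨s, hs⟩ := (hT.subset (below_subset (F := Q))).exists_simpleFunc_stepSum β
      rw [← hs]
      exact (s.measurable.pow_const n).const_mul _
    have hpt : ∀ x, stepSum (below T R) β x ^ (n + 1) ≤ (n + 1) * ∑ Q ∈ below T R,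
        Q.indicator (fun x => β Q * stepSum (below T Q) β x ^ n) x := by
      intro x
      rw [stepSum_eq_sum_filter]
      refine (sum_pow_succ_le_of_isChain n _ ?_).trans ?_
      · intro Q hQ S hS
        obtain ⟨hQ, hxQ⟩ := Finset.mem_filter.1 hQ
        obtain ⟨hS, hxS⟩ := Finset.mem_filter.1 hS
        exact hT.nested_of_mem (below_subset hQ) (below_subset hS) hxQ hxS
      · rw [Finset.sum_filter]
        gcongr with Q hQ
        by_cases hx : x ∈ Q
        · simp only [hx, if_true, Set.indicator_of_mem, stepSum_eq_sum_filter]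
          gcongr 1
          gcongr ?_ ^ n
          refine Finset.sum_le_sum_of_subset fun S hS => ?_
          simp only [Finset.mem_filter, mem_below] at hS ⊢
          exact ⟨⟨hS.1.1.1, hS.2⟩, hS.1.2⟩
        · simp [hx]
    calc ∫⁻ x in R, stepSum (below T R) β x ^ (n + 1) ∂μ
        ≤ ∫⁻ x, (n + 1) * ∑ Q ∈ below T R,
            Q.indicator (fun x => β Q * stepSum (below T Q) β x ^ n) x ∂μ :=
          (lintegral_mono hpt).trans (setLIntegral_le_lintegral _ _)
      _ = (n + 1) * ∑ Q ∈ below T R, ∫⁻ x in Q, β Q * stepSum (below T Q) β x ^ n ∂μ := by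
          rw [lintegral_const_mul' _ _ (by simp), lintegral_finsetSum' _ fun Q hQ =>
            ((hmeas Q (below_subset hQ)).indicator
              (hT.measurableSet Q (below_subset hQ))).aemeasurable]
          congr 1
          exact Finset.sum_congr rfl fun Q hQ =>
            lintegral_indicator (hT.measurableSet Q (below_subset hQ)) _
      _ ≤ (n + 1) * ∑ Q ∈ below T R, n.factorial * C ^ n * (β Q * μ Q) := by
          gcongr with Q hQ
          obtain ⟨s, hs⟩ := (hT.subset (below_subset (F := Q))).exists_simpleFunc_stepSum β
          rw [lintegral_const_mul _ (by rw [← hs]; exact s.measurable.pow_const n)]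
          calc β Q * ∫⁻ x in Q, stepSum (below T Q) β x ^ n ∂μ
              ≤ β Q * (n.factorial * C ^ n * μ Q) := by gcongr; exact ih Q (below_subset hQ)
            _ = _ := by ring
      _ ≤ (n + 1) * (n.factorial * C ^ n * (C * μ R)) := by
          rw [← Finset.mul_sum]
          gcongr
          exact hβ R hR
      _ = _ := by rw [Nat.factorial_succ]; push_cast; ring

/-- The even spreading of `f` over the light cubes below `F` has all its moments controlled by the
average of `‖f‖` over `F`: the masses moved form a Carleson sequence. -/
theorem IsLaminar.lintegral_spread_pow_le {E : Type*} [NormedAddCommGroup E] [NormedSpace ℝ E]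
    (hD : IsLaminar μ D) (f : X → E) {F : Set X} (hF : F ∈ D) (n : ℕ) :
    ∫⁻ x in F, ‖spread μ (lightBelow μ D (fun x => ‖f x‖ₑ) F) id f x‖ₑ ^ n ∂μ
      ≤ n.factorial * (8 * lavg μ (fun x => ‖f x‖ₑ) F) ^ n * μ F := by
  set u : X → ℝ≥0∞ := fun x => ‖f x‖ₑ
  set T := lightBelow μ D u F
  have hTD : T ⊆ D := lightBelow_subset_below.trans below_subset
  have hT : IsLaminar μ T := hD.subset hTD
  let β : Set X → ℝ≥0∞ := fun Q => (∫⁻ x in ownPart T Q, u x ∂μ) / μ Q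
  have hβ : ∀ R ∈ T, ∑ Q ∈ below T R, β Q * μ Q ≤ 8 * lavg μ u F * μ R := by
    intro R hR
    calc ∑ Q ∈ below T R, β Q * μ Q ≤ ∑ Q ∈ below T R, ∫⁻ x in ownPart T Q, u x ∂μ :=
          Finset.sum_le_sum fun Q _ => by
            rw [mul_comm]; exact ENNReal.mul_div_le
      _ = lavg μ u R * μ R := by
          rw [hT.sum_lintegral_ownPart hR, lavg_mul u (hT.measure_ne_top R hR)]
      _ ≤ _ := by gcongr; exact lavg_le_of_mem_lightBelow hR
  have hbT : below T F = T := Finset.filter_true_of_mem fun Q hQ =>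
    (mem_below.1 (lightBelow_subset_below hQ)).2
  have h := hT.lintegral_stepSum_pow_le hβ n F (self_mem_lightBelow hF)
  rw [hbT] at h
  refine le_trans (lintegral_mono fun x => ?_) h
  gcongr
  refine (enorm_sum_le _ _).trans (Finset.sum_le_sum fun Q hQ => ?_)
  by_cases hx : x ∈ Q
  · simp only [id, hx, Set.indicator_of_mem]
    rw [enorm_smul]
    by_cases h0 : μ Q = 0
    · simp [Measure.real, h0]
    · rw [show β Q = (∫⁻ x in ownPart T Q, u x ∂μ) / μ Q from rfl, mul_comm, ENNReal.div_eq_inv_mul,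
        mul_comm]
      gcongr
      · have hpos : 0 < μ.real Q := ENNReal.toReal_pos h0 (hT.measure_ne_top Q hQ)
        rw [Real.enorm_eq_ofReal (inv_nonneg.2 measureReal_nonneg),
          ENNReal.ofReal_inv_of_pos hpos, ofReal_measureReal (hT.measure_ne_top Q hQ)]
      · exact enorm_integral_le_lintegral_enorm _
  · simp [hx]

end Stopping

/-! ### Dominating functions for positive operators -/

section Testing

open scoped Classical

variable {X : Type*} [MeasurableSpace X] {μ : Measure X} {D : Finset (Set X)}
  {E : Type*} [NormedAddCommGroup E] [NormedSpace ℝ E]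

lemma LinearMap.mono_of_nonneg {E : Type*} [AddCommGroup E] [Module ℝ E] [PartialOrder E]
    [IsOrderedAddMonoid E] {L : E →ₗ[ℝ] E} (hL : ∀ e, 0 ≤ e → 0 ≤ L e) {a b : E}
    (h : a ≤ b) : L a ≤ L b := by
  have := hL (b - a) (sub_nonneg.2 h)
  rwa [map_sub, sub_nonneg] at this

lemma enorm_le_enorm_of_nonneg_of_le {E : Type*} [NormedAddCommGroup E] [Lattice E]
    [HasSolidNorm E] [IsOrderedAddMonoid E] {a b : E} (ha : 0 ≤ a) (h : a ≤ b) : ‖a‖ₑ ≤ ‖b‖ₑ := by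
  rw [enorm_le_iff_norm_le]
  refine norm_le_norm_of_abs_le_abs ?_
  rwa [abs_of_nonneg ha, abs_of_nonneg (ha.trans h)]

/-- The coefficients `λ_Q ∫_Q f dμ` of the positive operator, for operators `λ_Q` indexed by the
point sets. -/
noncomputable def coeff (μ : Measure X) (lam : Set X → E →ₗ[ℝ] E) (f : X → E)
    (Q : Set X) : E :=
  lam Q (∫ y in Q, f y ∂μ)

lemma lavg_ne_top {u : X → ℝ≥0∞} {F : Set X} (hu0 : ∫⁻ x in F, u x ∂μ ≠ 0)
    (hut : ∫⁻ x in F, u x ∂μ ≠ ∞) : lavg μ u F ≠ ∞ := by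
  have hF0 : μ F ≠ 0 := fun h => hu0 (by rw [Measure.restrict_eq_zero.2 h, lintegral_zero_measure])
  exact (ENNReal.div_lt_top hut hF0).ne

/-- The `L^t` norm of the evenly spread function, from its moment of integer order `⌈t⌉` by Hölder's
inequality. -/
lemma IsLaminar.eLpNorm_spread_le (hD : IsLaminar μ D) (f : X → E) {F : Set X} (hF : F ∈ D)
    {t : ℝ} (ht : 1 < t) :
    eLpNorm (spread μ (lightBelow μ D (fun x => ‖f x‖ₑ) F) id f) (ENNReal.ofReal t) (μ.restrict F)
      ≤ ⌈t⌉₊.factorial * (8 * lavg μ (fun x => ‖f x‖ₑ) F) * μ F ^ (1 / t) := by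
  set n := ⌈t⌉₊
  set l := lavg μ (fun x => ‖f x‖ₑ) F
  have ht0 : 0 < t := by linarith
  have hn : t ≤ n := Nat.le_ceil t
  have hn0 : n ≠ 0 := (Nat.ceil_pos.2 ht0).ne'
  have hT : IsLaminar μ (lightBelow μ D (fun x => ‖f x‖ₑ) F) :=
    hD.subset (lightBelow_subset_below.trans below_subset)
  have hmeas := stronglyMeasurable_spread (μ := μ) (f := f) (W := id) hT.measurableSet
  refine (eLpNorm_le_eLpNorm_mul_rpow_measure_univ (q := n) ?_ hmeas.aestronglyMeasurable).trans ?_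
  · rw [← ENNReal.ofReal_natCast]
    exact ENNReal.ofReal_le_ofReal hn
  have h1 : eLpNorm (spread μ (lightBelow μ D (fun x => ‖f x‖ₑ) F) id f) n (μ.restrict F)
      ≤ n.factorial * (8 * l) * μ F ^ (1 / (n : ℝ)) := by
    rw [eLpNorm_eq_lintegral_rpow_enorm_toReal (by exact_mod_cast hn0) (by simp)]
    simp only [ENNReal.toReal_natCast, ENNReal.rpow_natCast]
    have hn' : (0 : ℝ) ≤ 1 / n := by positivity
    refine (ENNReal.rpow_le_rpow (hD.lintegral_spread_pow_le f hF n) hn').trans ?_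
    rw [ENNReal.mul_rpow_of_nonneg _ _ hn', ENNReal.mul_rpow_of_nonneg _ _ hn',
      ← ENNReal.rpow_natCast, ← ENNReal.rpow_mul, mul_one_div_cancel (by exact_mod_cast hn0),
      ENNReal.rpow_one]
    gcongr
    conv_rhs => rw [← ENNReal.rpow_one (n.factorial : ℝ≥0∞)]
    refine ENNReal.rpow_le_rpow_of_exponent_le ?_ ?_
    · exact_mod_cast Nat.factorial_pos n
    · rw [div_le_one (by positivity)]
      exact_mod_cast Nat.one_le_iff_ne_zero.2 hn0
  rw [Measure.restrict_apply_univ, ENNReal.toReal_ofReal ht0.le, ENNReal.toReal_natCast]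
  refine (mul_le_mul_left h1 _).trans ?_
  rw [mul_assoc]
  gcongr
  rw [← ENNReal.rpow_add_of_nonneg _ _ (by positivity)]
  · exact le_of_eq (by congr 1; ring)
  · rw [sub_nonneg]
    exact one_div_le_one_div_of_le ht0 hn

variable [Lattice E]

/-- Domination of the light part of the operator below `F`: there is an upward closed family of
cubes below `F`, missing little measure, on which the averages of `f` are dominated by those of a
nonnegative function `h` for which the localized operator has an `L¹` bound by `b ∫_F ‖f‖`. -/
def HasDominatingFunction (μ : Measure X) (D : Finset (Set X)) (lam : Set X → E →ₗ[ℝ] E)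
    (f : X → E) (b : ℝ≥0) (F : Set X) : Prop :=
  ∃ T ⊆ below D F, (∀ Q ∈ T, ∀ R ∈ D, Q ⊆ R → R ⊆ F → R ∈ T) ∧
    4 * μ (unionOf (below D F \ T)) ≤ μ F ∧
    ∃ h : X → E, 0 ≤ h ∧ (∀ Q ∈ T, ∫ x in Q, f x ∂μ ≤ ∫ x in Q, h x ∂μ) ∧
      eLpNorm (stepSum (below D F) (coeff μ lam h)) 1 μ ≤ b * ∫⁻ x in F, ‖f x‖ₑ ∂μ

variable [HasSolidNorm E] [IsOrderedAddMonoid E] [IsOrderedModule ℝ E]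

/-- The common mechanism of all three cases: if below every cube the light part of the operator is
dominated as in `HasDominatingFunction`, then the operator is bounded in `L^p`. -/
theorem IsLaminar.eLpNorm_stepSum_le (hD : IsLaminar μ D) {p p' : ℝ} (hp : p.HolderConjugate p')
    {lam : Set X → E →ₗ[ℝ] E} (hlam : ∀ Q ∈ D, ∀ e, 0 ≤ e → 0 ≤ lam Q e) {f : X → E}
    (hfm : AEStronglyMeasurable f μ) (hf0 : 0 ≤ f) (hfi : ∀ Q ∈ D, IntegrableOn f Q μ) {b : ℝ≥0}
    (H : ∀ F ∈ D, ∫⁻ x in F, ‖f x‖ₑ ∂μ ≠ 0 → HasDominatingFunction μ D lam f b F) :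
    eLpNorm (stepSum D (coeff μ lam f)) (ENNReal.ofReal p) μ
      ≤ 8 * b * ENNReal.ofReal p' * ENNReal.ofReal p * eLpNorm f (ENNReal.ofReal p) μ := by
  have hp0 : ENNReal.ofReal p ≠ 0 := (ENNReal.ofReal_pos.2 hp.pos).ne'
  have hc : ∀ Q ∈ D, 0 ≤ coeff μ lam f Q := fun Q hQ => hlam Q hQ _ (integral_nonneg hf0)
  rw [eLpNorm_eq_lintegral_rpow_enorm_toReal hp0 ENNReal.ofReal_ne_top,
    eLpNorm_eq_lintegral_rpow_enorm_toReal hp0 ENNReal.ofReal_ne_top,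
    ENNReal.toReal_ofReal hp.nonneg]
  have hfin : ∀ Q ∈ D, ∫⁻ x in Q, ‖f x‖ₑ ∂μ ≠ ∞ := fun Q hQ => (hfi Q hQ).2.ne
  refine (hD.lintegral_enorm_stepSum_rpow_le hp (coeff μ lam f) hfm.enorm hfin (4 * b)
    fun F hF _ => ?_).trans (le_of_eq (by ring))
  by_cases hu0 : ∫⁻ x in F, ‖f x‖ₑ ∂μ = 0
  -- If `f` vanishes on `F`, so do all coefficients below `F`.
  · refine ⟨below D F, subset_rfl, fun Q _ R hR _ hRF => mem_below.2 ⟨hR, hRF⟩,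
      by simp [unionOf], fun x => ?_⟩
    have : stepSum (below D F) (coeff μ lam f) x = 0 := by
      refine Finset.sum_eq_zero fun Q hQ => ?_
      have h0 : ∫ y in Q, f y ∂μ = 0 := by
        rw [← enorm_eq_zero]
        refine le_antisymm ?_ zero_le
        calc _ ≤ ∫⁻ x in Q, ‖f x‖ₑ ∂μ := enorm_integral_le_lintegral_enorm _
          _ ≤ ∫⁻ x in F, ‖f x‖ₑ ∂μ := lintegral_mono_set (mem_below.1 hQ).2
          _ = 0 := hu0
      simp [coeff, h0]
    simp [this]
  refine hD.exists_pointwise_of_lintegral hc hF hu0 (hfin F hF) ?_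
  obtain ⟨T, hTF, hup, hmeas, h, hh0, hle, hint⟩ := H F hF hu0
  rw [eLpNorm_one_eq_lintegral_enorm] at hint
  refine ⟨T, hTF, hup, hmeas, (lintegral_mono fun x => ?_).trans hint⟩
  refine enorm_le_enorm_of_nonneg_of_le ?_ ?_
  · exact Finset.sum_nonneg fun Q hQ =>
      Set.indicator_nonneg (fun _ _ => hc Q (below_subset (hTF hQ))) _
  · refine (Finset.sum_le_sum fun Q hQ => ?_).trans
      (Finset.sum_le_sum_of_subset_of_nonneg hTF fun Q hQ _ => ?_)
    · refine Set.indicator_le_indicator ?_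
      exact LinearMap.mono_of_nonneg (hlam Q (below_subset (hTF hQ))) (hle Q hQ)
    · exact Set.indicator_nonneg
        (fun _ _ => hlam Q (below_subset hQ) _ (integral_nonneg hh0)) _

variable [CompleteSpace E]

/-- Under `L^t` testing the evenly spread function dominates. -/
theorem IsLaminar.hasDominatingFunction_of_Lt (hD : IsLaminar μ D) {lam : Set X → E →ₗ[ℝ] E}
    {f : X → E} (hf0 : 0 ≤ f) (hfi : ∀ Q ∈ D, IntegrableOn f Q μ) {t : ℝ} (ht : 1 < t) {B : ℝ≥0}
    {F : Set X} (hF : F ∈ D) (hu0 : ∫⁻ x in F, ‖f x‖ₑ ∂μ ≠ 0)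
    (htest : ∀ h : X → E, MemLp h (ENNReal.ofReal t) (μ.restrict F) →
      eLpNorm (stepSum (below D F) (coeff μ lam h)) 1 μ
        ≤ B * eLpNorm h (ENNReal.ofReal t) (μ.restrict F) * μ F ^ (1 - 1 / t)) :
    HasDominatingFunction μ D lam f (8 * ⌈t⌉₊.factorial * B) F := by
  set u : X → ℝ≥0∞ := fun x => ‖f x‖ₑ
  have hut : ∫⁻ x in F, u x ∂μ ≠ ∞ := (hfi F hF).2.ne
  have hFt := hD.measure_ne_top F hF
  have hTD : lightBelow μ D u F ⊆ D := lightBelow_subset_below.trans below_subset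
  have hT : IsLaminar μ (lightBelow μ D u F) := hD.subset hTD
  have ht0 : 0 < t := by linarith
  have h8 := hD.measure_unionOf_sdiff_lightBelow_le hF hu0 hut
  have hnorm := hD.eLpNorm_spread_le f hF ht
  refine ⟨lightBelow μ D u F, lightBelow_subset_below, fun Q hQ R hR => lightBelow_upward hQ hR,
    le_trans (by gcongr; norm_num) h8, spread μ (lightBelow μ D u F) id f, spread_nonneg hf0,
    fun Q hQ => hT.integral_le_integral_spread hT.measurableSet (fun _ _ => subset_rfl)
      (fun _ _ => ownPart_subset) hf0 hQ (hfi Q (hTD hQ)), ?_⟩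
  refine (htest _ ⟨(stronglyMeasurable_spread (W := id)
    hT.measurableSet).aestronglyMeasurable, ?_⟩).trans ?_
  · refine hnorm.trans_lt (ENNReal.mul_lt_top (ENNReal.mul_lt_top (by simp) ?_) ?_)
    · exact ENNReal.mul_lt_top (by simp) (lavg_ne_top hu0 hut).lt_top
    · exact ENNReal.rpow_lt_top_of_nonneg (by positivity) hFt
  · calc _ ≤ B * (⌈t⌉₊.factorial * (8 * lavg μ u F) * μ F ^ (1 / t)) * μ F ^ (1 - 1 / t) := by
          gcongr
      _ = 8 * ⌈t⌉₊.factorial * B * (lavg μ u F * (μ F ^ (1 / t) * μ F ^ (1 - 1 / t))) := by ring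
      _ = _ := by
          rw [← ENNReal.rpow_add_of_nonneg _ _ (by positivity)
            (sub_nonneg.2 ((div_le_one ht0).2 ht.le)), add_sub_cancel, ENNReal.rpow_one,
            lavg_mul u hFt]
          push_cast
          rfl

/-- Under `L^∞` testing, suppose that the cubes below `F` belong to a larger family `D'` in which
each cube is either minimal or is partitioned by cubes of comparable measure. Then replacing `f`
on the uncovered part of each light cube by its average gives a bounded dominating function. -/
theorem IsLaminar.hasDominatingFunction_of_comparable (hD : IsLaminar μ D)
    {lam : Set X → E →ₗ[ℝ] E} {f : X → E} (hf0 : 0 ≤ f) {D' : Finset (Set X)}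
    (hD' : IsLaminar μ D') (hfi : ∀ Q ∈ D', IntegrableOn f Q μ) {B C : ℝ≥0} (hC : 1 ≤ C)
    {F : Set X} (hF : F ∈ D) (hu0 : ∫⁻ x in F, ‖f x‖ₑ ∂μ ≠ 0) (hsub : below D F ⊆ D')
    (hcomp : ∀ Q ∈ D', (∀ R ∈ D', ¬ R ⊂ Q) ∨ ∀ x ∈ Q, ∃ P ∈ D', x ∈ P ∧ P ⊂ Q ∧
      μ Q ≤ C * μ P ∧ ∀ R ∈ D', R ⊂ Q → ¬ Disjoint R P → R ⊆ P)
    (htest : ∀ h : X → E, MemLp h ∞ (μ.restrict F) →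
      eLpNorm (stepSum (below D F) (coeff μ lam h)) 1 μ
        ≤ B * eLpNorm h ∞ (μ.restrict F) * μ F) :
    HasDominatingFunction μ D lam f (8 * C * B) F := by
  set u : X → ℝ≥0∞ := fun x => ‖f x‖ₑ
  have hFD' : F ∈ D' := hsub (mem_below.2 ⟨hF, subset_rfl⟩)
  have hut : ∫⁻ x in F, u x ∂μ ≠ ∞ := (hfi F hFD').2.ne
  have hFt := hD.measure_ne_top F hF
  -- The light cubes are taken in the larger family, so that uncovered parts are large.
  set T := lightBelow μ D' u F
  have hTD : T ⊆ D' := lightBelow_subset_below.trans below_subset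
  have hT : IsLaminar μ T := hD'.subset hTD
  have h8 := hD'.measure_unionOf_sdiff_lightBelow_le hFD' hu0 hut
  have hown : ∀ Q ∈ T, ∀ x ∈ ownPart T Q, μ Q ≤ C * μ (ownPart T Q) := by
    intro Q hQ x hx
    rcases hcomp Q (hTD hQ) with hmin | hch
    · have : ownPart T Q = Q := by
        refine Set.Subset.antisymm ownPart_subset fun y hy => ⟨hy, fun hy' => ?_⟩
        obtain ⟨R, hR, -⟩ := mem_unionOf.1 hy'
        obtain ⟨hRT, hRQ⟩ := Finset.mem_filter.1 hR
        exact hmin R (hTD hRT) hRQ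
      rw [this]
      exact le_mul_of_one_le_left' (by exact_mod_cast hC)
    · -- The child of `Q` around a point of the uncovered part is uncovered altogether.
      obtain ⟨P, hP, hxP, hPQ, hμ, hmax⟩ := hch x hx.1
      refine hμ.trans ?_
      gcongr
      have hQF : Q ⊆ F := (mem_below.1 (lightBelow_subset_below hQ)).2
      have hPT : P ∉ T := fun h =>
        hx.2 (mem_unionOf.2 ⟨P, Finset.mem_filter.2 ⟨h, hPQ⟩, hxP⟩)
      intro y hy
      refine ⟨hPQ.1 hy, fun hy' => hPT ?_⟩
      obtain ⟨R, hR, hyR⟩ := mem_unionOf.1 hy'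
      obtain ⟨hRT, hRQ⟩ := Finset.mem_filter.1 hR
      refine lightBelow_upward hRT hP (hmax R (hTD hRT) hRQ ?_) (hPQ.1.trans hQF)
      exact fun hd => Set.disjoint_left.1 hd hyR hy
  have hbound : ∀ x, ‖spread μ T (ownPart T) f x‖ₑ ≤ 8 * C * lavg μ u F := by
    intro x
    by_cases hx : ∃ Q ∈ T, x ∈ ownPart T Q
    · obtain ⟨Q, hQ, hxQ⟩ := hx
      have hs : spread μ T (ownPart T) f x
          = (μ.real (ownPart T Q))⁻¹ • ∫ y in ownPart T Q, f y ∂μ := by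
        rw [spread, Finset.sum_eq_single_of_mem Q hQ, Set.indicator_of_mem hxQ]
        intro R hR hne
        refine Set.indicator_of_notMem (fun hxR => ?_) _
        exact Set.disjoint_left.1 (hT.pairwiseDisjoint_ownPart hR hQ hne) hxR hxQ
      have hot : μ (ownPart T Q) ≠ ∞ :=
        ((measure_mono ownPart_subset).trans_lt (hT.measure_ne_top Q hQ).lt_top).ne
      rw [hs, enorm_smul]
      by_cases h0 : μ (ownPart T Q) = 0
      · simp [Measure.real, h0]
      have hpos : 0 < μ.real (ownPart T Q) := ENNReal.toReal_pos h0 hot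
      rw [Real.enorm_eq_ofReal (inv_nonneg.2 measureReal_nonneg),
        ENNReal.ofReal_inv_of_pos hpos, ofReal_measureReal hot, mul_comm, ← div_eq_mul_inv]
      refine ENNReal.div_le_of_le_mul ?_
      calc ‖∫ y in ownPart T Q, f y ∂μ‖ₑ ≤ ∫⁻ y in ownPart T Q, u y ∂μ :=
            enorm_integral_le_lintegral_enorm _
        _ ≤ ∫⁻ y in Q, u y ∂μ := lintegral_mono_set ownPart_subset
        _ = lavg μ u Q * μ Q := (lavg_mul u (hT.measure_ne_top Q hQ)).symm
        _ ≤ 8 * lavg μ u F * (C * μ (ownPart T Q)) :=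
            mul_le_mul' (lavg_le_of_mem_lightBelow hQ) (hown Q hQ x hxQ)
        _ = _ := by ring
    · have : spread μ T (ownPart T) f x = 0 := by
        refine Finset.sum_eq_zero fun Q hQ => Set.indicator_of_notMem (fun h => hx ⟨Q, hQ, h⟩) _
      simp [this]
  have hnorm : eLpNorm (spread μ T (ownPart T) f) ∞ (μ.restrict F) ≤ 8 * C * lavg μ u F := by
    rw [eLpNorm_exponent_top]
    exact eLpNormEssSup_le_of_ae_enorm_bound (Filter.Eventually.of_forall hbound)
  refine ⟨(below D F).filter (· ∈ T), Finset.filter_subset _ _, ?_, ?_,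
    spread μ T (ownPart T) f, spread_nonneg hf0, fun Q hQ => ?_, ?_⟩
  · intro Q hQ R hR hQR hRF
    have hRb : R ∈ below D F := mem_below.2 ⟨hR, hRF⟩
    exact Finset.mem_filter.2 ⟨hRb, lightBelow_upward (Finset.mem_filter.1 hQ).2 (hsub hRb) hQR hRF⟩
  · refine le_trans ?_ h8
    gcongr
    · norm_num
    · intro x hx
      obtain ⟨Q, hQ, hxQ⟩ := mem_unionOf.1 hx
      obtain ⟨hQb, hQT⟩ := Finset.mem_sdiff.1 hQ
      refine mem_unionOf.2 ⟨Q, Finset.mem_sdiff.2 ⟨mem_below.2 ⟨hsub hQb, (mem_below.1 hQb).2⟩,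
        fun h => hQT (Finset.mem_filter.2 ⟨hQb, h⟩)⟩, hxQ⟩
  · exact hT.integral_le_integral_spread (fun Q hQ => hT.measurableSet_ownPart hQ)
      (fun _ _ => ownPart_subset) (fun _ _ => subset_rfl) hf0 (Finset.mem_filter.1 hQ).2
      (hfi Q (hTD (Finset.mem_filter.1 hQ).2))
  · refine (htest _ ⟨(stronglyMeasurable_spread
      fun Q hQ => hT.measurableSet_ownPart hQ).aestronglyMeasurable, ?_⟩).trans ?_
    · exact hnorm.trans_lt
        (ENNReal.mul_lt_top (by finiteness) (lavg_ne_top hu0 hut).lt_top)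
    · calc _ ≤ B * (8 * C * lavg μ u F) * μ F := by gcongr
        _ = 8 * C * B * (lavg μ u F * μ F) := by ring
        _ = _ := by
          rw [lavg_mul u hFt]
          push_cast
          rfl

end Testing

/-! ### The lattice maximal function as a dominating function -/

section LatticeMaximal

open scoped Classical

variable {X E : Type*} [Lattice E]

/-- The lattice supremum of `e` and of the values `a Q`, `Q ∈ S`. -/
noncomputable def supFrom (e : E) (S : Finset (Set X)) (a : Set X → E) : E :=
  S.fold (· ⊔ ·) e a

lemma le_supFrom_self (e : E) (S : Finset (Set X)) (a : Set X → E) : e ≤ supFrom e S a := by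
  induction S using Finset.induction_on with
  | empty => simp [supFrom]
  | insert Q S hQ ih =>
    rw [supFrom, Finset.fold_insert hQ]
    exact ih.trans le_sup_right

lemma le_supFrom {e : E} {S : Finset (Set X)} {a : Set X → E} {Q : Set X} (hQ : Q ∈ S) :
    a Q ≤ supFrom e S a := by
  rw [← Finset.insert_erase hQ, supFrom, Finset.fold_insert (Finset.notMem_erase _ _)]
  exact le_sup_left

lemma supFrom_le {e z : E} {S : Finset (Set X)} {a : Set X → E} (he : e ≤ z)
    (ha : ∀ Q ∈ S, a Q ≤ z) : supFrom e S a ≤ z := by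
  induction S using Finset.induction_on with
  | empty => simpa [supFrom] using he
  | insert Q S hQ ih =>
    rw [supFrom, Finset.fold_insert hQ]
    exact sup_le (ha Q (Finset.mem_insert_self _ _))
      (ih fun R hR => ha R (Finset.mem_insert_of_mem hR))

lemma supFrom_mono {e : E} {S S' : Finset (Set X)} {a a' : Set X → E} (hS : S ⊆ S')
    (ha : ∀ Q ∈ S, a Q ≤ a' Q) : supFrom e S a ≤ supFrom e S' a' :=
  supFrom_le (le_supFrom_self _ _ _) fun Q hQ => (ha Q hQ).trans (le_supFrom (hS hQ))

variable [MeasurableSpace X] [NormedAddCommGroup E] [NormedSpace ℝ E]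

/-- The lattice maximal function `sup_{Q ∈ T} ⟨f⟩_Q 1_Q` of a nonnegative function with respect
to `μ`. -/
noncomputable def latMax (μ : Measure X) (T : Finset (Set X)) (f : X → E) (x : X) : E :=
  supFrom 0 {Q ∈ T | x ∈ Q} fun Q => ⨍ y in Q, f y ∂μ

variable {μ : Measure X} {D : Finset (Set X)} [IsOrderedModule ℝ E]

lemma setAverage_le_of_setIntegral_le {f g : X → E} {Q : Set X}
    (h : ∫ y in Q, f y ∂μ ≤ ∫ y in Q, g y ∂μ) : ⨍ y in Q, f y ∂μ ≤ ⨍ y in Q, g y ∂μ := by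
  rw [setAverage_eq, setAverage_eq]
  exact smul_le_smul_of_nonneg_left h (inv_nonneg.2 measureReal_nonneg)

variable [HasSolidNorm E] [IsOrderedAddMonoid E]

lemma setAverage_nonneg {f : X → E} (hf : 0 ≤ f) (Q : Set X) : 0 ≤ ⨍ y in Q, f y ∂μ := by
  rw [setAverage_eq]
  exact smul_nonneg (inv_nonneg.2 measureReal_nonneg) (integral_nonneg hf)

variable [CompleteSpace E]

/-- Under `L^∞` testing, suppose that the lattice maximal operators of subfamilies of `D` are
bounded on `L^r(μ)`. Then the lattice maximal function of `f` over the cubes on which it stays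
below a multiple of `⟨‖f‖⟩_F` is a bounded dominating function. The weak type `(1,1)` estimate that
controls the discarded cubes follows from the `L^r` bound applied to the evenly spread function. -/
theorem IsLaminar.hasDominatingFunction_of_latMax (hD : IsLaminar μ D)
    {lam : Set X → E →ₗ[ℝ] E} {f : X → E} (hf0 : 0 ≤ f) (hfi : ∀ Q ∈ D, IntegrableOn f Q μ)
    {B A : ℝ≥0} {r : ℝ} (hr : 1 < r) {F : Set X} (hF : F ∈ D) (hu0 : ∫⁻ x in F, ‖f x‖ₑ ∂μ ≠ 0)
    (hmax : ∀ T ⊆ D, F ∈ T → (∀ Q ∈ T, Q ⊆ F) → ∀ h : X → E, 0 ≤ h →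
      MemLp h (ENNReal.ofReal r) (μ.restrict F) →
      eLpNorm (latMax μ T h) (ENNReal.ofReal r) (μ.restrict F)
        ≤ A * eLpNorm h (ENNReal.ofReal r) (μ.restrict F))
    (htest : ∀ h : X → E, MemLp h ∞ (μ.restrict F) →
      eLpNorm (stepSum (below D F) (coeff μ lam h)) 1 μ
        ≤ B * eLpNorm h ∞ (μ.restrict F) * μ F) :
    HasDominatingFunction μ D lam f (64 * (A + 1) * ⌈r⌉₊.factorial * B) F := by
  set u : X → ℝ≥0∞ := fun x => ‖f x‖ₑ
  have hut : ∫⁻ x in F, u x ∂μ ≠ ∞ := (hfi F hF).2.ne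
  have hFt := hD.measure_ne_top F hF
  have hF0 : μ F ≠ 0 := fun h => hu0 (by rw [Measure.restrict_eq_zero.2 h, lintegral_zero_measure])
  have hr0 : 0 < r := by linarith
  set l := lavg μ u F
  have hlt : l ≠ ∞ := lavg_ne_top hu0 hut
  have hl0 : l ≠ 0 := (ENNReal.div_pos hu0 hFt).ne'
  set T₀ := lightBelow μ D u F
  have hT₀D : T₀ ⊆ D := lightBelow_subset_below.trans below_subset
  have hT₀ : IsLaminar μ T₀ := hD.subset hT₀D
  have hFT₀ : F ∈ T₀ := self_mem_lightBelow hF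
  have h8 := hD.measure_unionOf_sdiff_lightBelow_le hF hu0 hut
  set g := spread μ T₀ id f
  have hg0 : 0 ≤ g := spread_nonneg hf0
  have hgnorm : eLpNorm g (ENNReal.ofReal r) (μ.restrict F)
      ≤ ⌈r⌉₊.factorial * (8 * l) * μ F ^ (1 / r) := hD.eLpNorm_spread_le f hF hr
  have hgmem : MemLp g (ENNReal.ofReal r) (μ.restrict F) := by
    refine ⟨(stronglyMeasurable_spread (W := id) hT₀.measurableSet).aestronglyMeasurable, ?_⟩
    refine hgnorm.trans_lt (ENNReal.mul_lt_top (ENNReal.mul_lt_top (by simp) ?_) ?_)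
    · exact ENNReal.mul_lt_top (by simp) hlt.lt_top
    · exact ENNReal.rpow_lt_top_of_nonneg (by positivity) hFt
  set N : ℝ≥0∞ := (A + 1) * (⌈r⌉₊.factorial * (8 * l))
  set L : ℝ≥0∞ := 8 * N
  have hN0 : N ≠ 0 := by
    refine mul_ne_zero (by simp) (mul_ne_zero ?_ (mul_ne_zero (by simp) hl0))
    exact_mod_cast (Nat.factorial_pos _).ne'
  have hNt : N ≠ ∞ := by finiteness
  have hLt : L ≠ ∞ := by finiteness
  let a : Set X → E := fun Q => ⨍ y in Q, f y ∂μ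
  have hmono : ∀ {S S' : Finset (Set X)}, S ⊆ S' → ‖supFrom 0 S a‖ₑ ≤ ‖supFrom 0 S' a‖ₑ :=
    fun h => enorm_le_enorm_of_nonneg_of_le (le_supFrom_self _ _ _)
      (supFrom_mono h fun _ _ => le_rfl)
  -- The light cubes at which the supremum of the averages over the cubes between them and `F` is
  -- still of norm at most `L`, and the remaining ones.
  set T := T₀.filter fun Q => ‖supFrom 0 {R ∈ T₀ | Q ⊆ R} a‖ₑ ≤ L
  set V := T₀.filter fun Q => ¬ ‖supFrom 0 {R ∈ T₀ | Q ⊆ R} a‖ₑ ≤ L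
  have hTT₀ : T ⊆ T₀ := Finset.filter_subset _ _
  have hTD : T ⊆ D := hTT₀.trans hT₀D
  have hbound : ∀ x, ‖latMax μ T f x‖ₑ ≤ L := by
    intro x
    -- The supremum at `x` runs over cubes containing the smallest member of `T` around `x`.
    rw [latMax]
    rcases (T.filter fun Q => x ∈ Q).eq_empty_or_nonempty with h | h
    · simp [h, supFrom]
    obtain ⟨Q, hQ⟩ := (T.filter fun Q => x ∈ Q).exists_minimal h
    obtain ⟨hQT, hxQ⟩ := Finset.mem_filter.1 hQ.1
    refine le_trans (hmono ?_) (Finset.mem_filter.1 hQT).2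
    intro R hR
    obtain ⟨hRT, hxR⟩ := Finset.mem_filter.1 hR
    refine Finset.mem_filter.2 ⟨hTT₀ hRT, ?_⟩
    rcases hD.nested_of_mem (hTD hQT) (hTD hRT) hxQ hxR with h | h
    · exact h
    · exact hQ.2 hR h
  obtain ⟨s, hs⟩ := (hD.subset hTD).exists_simpleFunc fun S => supFrom 0 S a
  have hs' : latMax μ T f = s := funext fun x => (hs x).symm
  have hmeasT : StronglyMeasurable (latMax μ T f) := hs' ▸ s.stronglyMeasurable
  have hnorm : eLpNorm (latMax μ T f) ∞ (μ.restrict F) ≤ L := by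
    rw [eLpNorm_exponent_top]
    exact eLpNormEssSup_le_of_ae_enorm_bound (Filter.Eventually.of_forall hbound)
  refine ⟨T, hTT₀.trans lightBelow_subset_below, ?_, ?_, latMax μ T f,
    fun x => le_supFrom_self _ _ _, fun Q hQ => ?_, ?_⟩
  · intro Q hQ R hR hQR hRF
    obtain ⟨hQT, hQa⟩ := Finset.mem_filter.1 hQ
    refine Finset.mem_filter.2 ⟨lightBelow_upward hQT hR hQR hRF, le_trans (hmono ?_) hQa⟩
    exact fun P hP => Finset.mem_filter.2
      ⟨(Finset.mem_filter.1 hP).1, hQR.trans (Finset.mem_filter.1 hP).2⟩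
  · have hV : 8 * μ (unionOf V) ≤ μ F := by
      have hVD : V ⊆ D := (Finset.filter_subset _ _).trans hT₀D
      have hVF : unionOf V ⊆ F := by
        intro x hx
        obtain ⟨Q, hQ, hxQ⟩ := mem_unionOf.1 hx
        exact (mem_below.1 (lightBelow_subset_below (Finset.mem_filter.1 hQ).1)).2 hxQ
      -- The averages of `g` over light cubes dominate those of `f`; hence Chebyshev's inequality
      -- for the maximal function of `g` applies.
      have hlarge : ∀ x ∈ unionOf V, L ≤ ‖latMax μ T₀ g x‖ₑ := by
        intro x hx
        obtain ⟨Q, hQ, hxQ⟩ := mem_unionOf.1 hx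
        obtain ⟨hQT, hQa⟩ := Finset.mem_filter.1 hQ
        refine (not_le.1 hQa).le.trans ?_
        refine enorm_le_enorm_of_nonneg_of_le (le_supFrom_self _ _ _) (supFrom_mono ?_ ?_)
        · exact fun P hP => Finset.mem_filter.2
            ⟨(Finset.mem_filter.1 hP).1, (Finset.mem_filter.1 hP).2 hxQ⟩
        · intro P hP
          refine setAverage_le_of_setIntegral_le ?_
          have hPT := (Finset.mem_filter.1 hP).1
          exact hT₀.integral_le_integral_spread hT₀.measurableSet (fun _ _ => subset_rfl)
            (fun _ _ => ownPart_subset) hf0 hPT (hfi P (hT₀D hPT))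
      obtain ⟨s₀, hs₀⟩ := hT₀.exists_simpleFunc fun S => supFrom 0 S fun Q => ⨍ y in Q, g y ∂μ
      have hs₀' : latMax μ T₀ g = s₀ := funext fun x => (hs₀ x).symm
      have hm₀ : AEStronglyMeasurable (latMax μ T₀ g) (μ.restrict F) :=
        hs₀' ▸ s₀.stronglyMeasurable.aestronglyMeasurable
      have hcheb := mul_meas_ge_le_pow_eLpNorm' (μ.restrict F) (p := ENNReal.ofReal r)
        (ENNReal.ofReal_pos.2 hr0).ne' ENNReal.ofReal_ne_top hm₀ L
      rw [ENNReal.toReal_ofReal hr0.le] at hcheb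
      have h1 : L ^ r * μ (unionOf V) ≤ (N * μ F ^ (1 / r)) ^ r := by
        have hVr : μ (unionOf V) ≤ μ.restrict F {x | L ≤ ‖latMax μ T₀ g x‖ₑ} := by
          rw [← Set.inter_eq_left.2 hVF,
            ← Measure.restrict_apply (hD.subset hVD).measurableSet_unionOf]
          exact measure_mono hlarge
        calc L ^ r * μ (unionOf V)
            ≤ L ^ r * μ.restrict F {x | L ≤ ‖latMax μ T₀ g x‖ₑ} := by
              gcongr
          _ ≤ _ := hcheb
          _ ≤ (N * μ F ^ (1 / r)) ^ r := by
              gcongr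
              refine (hmax T₀ hT₀D hFT₀ (fun Q hQ =>
                (mem_below.1 (lightBelow_subset_below hQ)).2) g hg0 hgmem).trans ?_
              rw [mul_assoc]
              gcongr
              exact le_self_add
      have e1 : (N * μ F ^ (1 / r)) ^ r = N ^ r * μ F := by
        rw [ENNReal.mul_rpow_of_nonneg _ _ hr0.le, ← ENNReal.rpow_mul,
          one_div_mul_cancel hr0.ne', ENNReal.rpow_one]
      have e2 : L ^ r = N ^ r * 8 ^ r := by
        rw [ENNReal.mul_rpow_of_nonneg _ _ hr0.le, mul_comm]
      rw [e1, e2, mul_assoc] at h1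
      have h2 := (ENNReal.mul_le_mul_iff_right
        (by simp [ENNReal.rpow_eq_zero_iff, hN0, hNt])
        (ENNReal.rpow_ne_top_of_nonneg hr0.le hNt)).1 h1
      refine le_trans ?_ h2
      gcongr
      conv_lhs => rw [← ENNReal.rpow_one (8 : ℝ≥0∞)]
      exact ENNReal.rpow_le_rpow_of_exponent_le (by norm_num) hr.le
    have hsub : unionOf (below D F \ T) ⊆ unionOf (below D F \ T₀) ∪ unionOf V := by
      intro x hx
      obtain ⟨Q, hQ, hxQ⟩ := mem_unionOf.1 hx
      obtain ⟨hQb, hQT⟩ := Finset.mem_sdiff.1 hQ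
      by_cases hQT₀ : Q ∈ T₀
      · exact Or.inr (mem_unionOf.2 ⟨Q, Finset.mem_filter.2
          ⟨hQT₀, fun h => hQT (Finset.mem_filter.2 ⟨hQT₀, h⟩)⟩, hxQ⟩)
      · exact Or.inl (mem_unionOf.2 ⟨Q, Finset.mem_sdiff.2 ⟨hQb, hQT₀⟩, hxQ⟩)
    have h4 : 2 * (4 * μ (unionOf (below D F \ T))) ≤ 2 * μ F := by
      calc 2 * (4 * μ (unionOf (below D F \ T)))
          ≤ 2 * (4 * (μ (unionOf (below D F \ T₀)) + μ (unionOf V))) := by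
            gcongr
            exact (measure_mono hsub).trans (measure_union_le _ _)
        _ = 8 * μ (unionOf (below D F \ T₀)) + 8 * μ (unionOf V) := by ring
        _ ≤ μ F + μ F := add_le_add h8 hV
        _ = 2 * μ F := (two_mul _).symm
    exact (ENNReal.mul_le_mul_iff_right (by simp) (by simp)).1 h4
  · -- On `Q` the maximal function is at least the average of `f` over `Q`.
    have hQt := hD.measure_ne_top Q (hTD hQ)
    have e : ∫ x in Q, f x ∂μ = ∫ _ in Q, a Q ∂μ := by
      rw [setIntegral_const]
      exact (measure_smul_setAverage f hQt).symm
    rw [e]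
    refine setIntegral_mono_on (integrableOn_const hQt) ?_ (hD.measurableSet Q (hTD hQ)) ?_
    · refine Measure.integrableOn_of_bounded (M := L.toReal) hQt
        hmeasT.aestronglyMeasurable (Filter.Eventually.of_forall fun x => ?_)
      rw [← toReal_enorm]
      exact ENNReal.toReal_mono hLt (hbound x)
    · exact fun x hx => le_supFrom (a := a) (Finset.mem_filter.2 ⟨hQ, hx⟩)
  · refine (htest _ ⟨hmeasT.aestronglyMeasurable, hnorm.trans_lt hLt.lt_top⟩).trans ?_
    calc _ ≤ B * L * μ F := by gcongr
      _ = 64 * (A + 1) * ⌈r⌉₊.factorial * B * (l * μ F) := by simp only [L, N]; ring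
      _ = _ := by
        rw [lavg_mul u hFt]
        push_cast
        rfl

end LatticeMaximal

/-! ### Trees of averages and the Bellman function -/

section Bellman

lemma norm_le_norm_of_nonneg_of_le {E : Type*} [NormedAddCommGroup E] [Lattice E]
    [HasSolidNorm E] [IsOrderedAddMonoid E] {a b : E} (ha : 0 ≤ a) (h : a ≤ b) : ‖a‖ ≤ ‖b‖ := by
  refine norm_le_norm_of_abs_le_abs ?_
  rwa [abs_of_nonneg ha, abs_of_nonneg (ha.trans h)]

/-- A finite tree with branching over `ι` and values at the leaves; it encodes a step function on a
cube, the branches of a node being the values on the dyadic children. -/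
inductive AvgTree (ι E : Type*) where
  | leaf (v : E) : AvgTree ι E
  | node (c : ι → AvgTree ι E) : AvgTree ι E

namespace AvgTree

variable {ι : Type*} [Fintype ι] {E : Type*} [NormedAddCommGroup E] [NormedSpace ℝ E] [Lattice E]

/-- The average of the encoded step function. -/
noncomputable def mean : AvgTree ι E → E
  | leaf v => v
  | node c => (Fintype.card ι : ℝ)⁻¹ • ∑ b, (c b).mean

/-- The average of the `r`-th power of the norm of the encoded step function. -/
noncomputable def moment (r : ℝ) : AvgTree ι E → ℝ
  | leaf v => ‖v‖ ^ r
  | node c => (Fintype.card ι : ℝ)⁻¹ * ∑ b, (c b).moment r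

/-- The average of the `r`-th power of the norm of the lattice maximal function of the encoded step
function, where the supremum is started at `e`. -/
noncomputable def maxMoment (r : ℝ) : AvgTree ι E → E → ℝ
  | leaf v, e => ‖e ⊔ v‖ ^ r
  | node c, e => (Fintype.card ι : ℝ)⁻¹ *
      ∑ b, (c b).maxMoment r (e ⊔ (Fintype.card ι : ℝ)⁻¹ • ∑ b', (c b').mean)

/-- The encoded step function is nonnegative. -/
def Nonneg : AvgTree ι E → Prop
  | leaf v => 0 ≤ v
  | node c => ∀ b, (c b).Nonneg

lemma maxMoment_node (r : ℝ) (c : ι → AvgTree ι E) (e : E) :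
    (node c).maxMoment r e
      = (Fintype.card ι : ℝ)⁻¹ * ∑ b, (c b).maxMoment r (e ⊔ (node c).mean) := by
  rw [maxMoment, mean]

lemma moment_nonneg {E : Type*} [NormedAddCommGroup E] (r : ℝ) (t : AvgTree ι E) :
    0 ≤ t.moment r := by
  induction t with
  | leaf v => exact Real.rpow_nonneg (norm_nonneg _) _
  | node c ih => exact mul_nonneg (by positivity) (Finset.sum_nonneg fun b _ => ih b)

lemma maxMoment_sup_mean (r : ℝ) (t : AvgTree ι E) (e : E) :
    t.maxMoment r (e ⊔ t.mean) = t.maxMoment r e := by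
  cases t with
  | leaf v => simp [maxMoment, mean]
  | node c => simp only [maxMoment_node, sup_assoc, sup_idem]

variable [HasSolidNorm E] [IsOrderedAddMonoid E]

lemma maxMoment_mono {r : ℝ} (hr : 0 ≤ r) (t : AvgTree ι E) {e e' : E} (he : 0 ≤ e) (h : e ≤ e') :
    t.maxMoment r e ≤ t.maxMoment r e' := by
  induction t generalizing e e' with
  | leaf v =>
    exact Real.rpow_le_rpow (norm_nonneg _) (norm_le_norm_of_nonneg_of_le
      (he.trans le_sup_left) (sup_le_sup_right h _)) hr
  | node c ih =>
    rw [maxMoment_node, maxMoment_node]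
    gcongr with b
    exact ih b (he.trans le_sup_left) (sup_le_sup_right h _)

lemma maxMoment_sup_le {r : ℝ} (hr : 0 ≤ r) [Nonempty ι] (t : AvgTree ι E) {e e' : E} (he : 0 ≤ e)
    (he' : 0 ≤ e') :
    t.maxMoment r (e ⊔ e') ≤ 2 ^ r * (‖e‖ ^ r + t.maxMoment r e') := by
  induction t generalizing e' with
  | leaf v =>
    have h1 : ‖e ⊔ e' ⊔ v‖ ≤ ‖e‖ + ‖e' ⊔ v‖ := by
      refine (norm_le_norm_of_nonneg_of_le (b := e + (e' ⊔ v)) ?_ ?_).trans (norm_add_le _ _)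
      · exact he.trans (le_sup_left.trans le_sup_left)
      · rw [sup_assoc]
        exact sup_le (le_add_of_nonneg_right (he'.trans le_sup_left)) (le_add_of_nonneg_left he)
    have h2 : ‖e‖ + ‖e' ⊔ v‖ ≤ 2 * max ‖e‖ ‖e' ⊔ v‖ := by
      rw [two_mul]
      exact add_le_add (le_max_left _ _) (le_max_right _ _)
    calc ‖e ⊔ e' ⊔ v‖ ^ r ≤ (2 * max ‖e‖ ‖e' ⊔ v‖) ^ r :=
          Real.rpow_le_rpow (norm_nonneg _) (h1.trans h2) hr
      _ = 2 ^ r * max ‖e‖ ‖e' ⊔ v‖ ^ r := Real.mul_rpow (by norm_num) (by positivity)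
      _ ≤ 2 ^ r * (‖e‖ ^ r + ‖e' ⊔ v‖ ^ r) := by
          gcongr
          rcases max_choice ‖e‖ ‖e' ⊔ v‖ with h | h <;> rw [h]
          · exact le_add_of_nonneg_right (by positivity)
          · exact le_add_of_nonneg_left (by positivity)
  | node c ih =>
    rw [maxMoment_node, maxMoment_node]
    have hcard : (0 : ℝ) < Fintype.card ι := by exact_mod_cast Fintype.card_pos
    calc (Fintype.card ι : ℝ)⁻¹ * ∑ b, (c b).maxMoment r (e ⊔ e' ⊔ (node c).mean)
        ≤ (Fintype.card ι : ℝ)⁻¹ *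
            ∑ b, 2 ^ r * (‖e‖ ^ r + (c b).maxMoment r (e' ⊔ (node c).mean)) := by
          gcongr with b
          rw [sup_assoc]
          exact ih b (he'.trans le_sup_left)
      _ = _ := by
          rw [← Finset.mul_sum, Finset.sum_add_distrib]
          simp only [Finset.sum_const, Finset.card_univ, nsmul_eq_mul]
          field_simp

end AvgTree

open AvgTree

variable {ι : Type*} [Fintype ι] {E : Type*} [NormedAddCommGroup E] [NormedSpace ℝ E] [Lattice E]

/-- The Bellman function of the lattice maximal inequality: the supremum of
`⟨‖e ⊔ M v‖^r⟩ - κ ⟨‖v‖^r⟩` over nonnegative step functions `v` of average `x`. The real supremum is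
meaningful because the set is bounded above once `κ` is `2 ^ r` times the constant of the maximal
inequality, see `TreeMaximalBound.bddAbove`. -/
noncomputable def bellman (ι : Type*) [Fintype ι] (r κ : ℝ) (x e : E) : ℝ :=
  sSup {y | ∃ t : AvgTree ι E, t.Nonneg ∧ t.mean = x ∧ y = t.maxMoment r e - κ * t.moment r}

/-- The maximal inequality for step functions encoded by trees. -/
def TreeMaximalBound (ι E : Type*) [Fintype ι] [NormedAddCommGroup E] [NormedSpace ℝ E] [Lattice E]
    (r κ : ℝ) : Prop :=
  ∀ t : AvgTree ι E, t.Nonneg → t.maxMoment r 0 ≤ κ * t.moment r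

/-- The average of the whole step function takes part in the maximal function already. -/
lemma bellman_sup_self (r κ : ℝ) (x e : E) : bellman ι r κ x (e ⊔ x) = bellman ι r κ x e := by
  unfold bellman
  congr 1
  ext y
  constructor <;>
  · rintro ⟨t, ht, rfl, rfl⟩
    exact ⟨t, ht, rfl, by rw [maxMoment_sup_mean]⟩

lemma bellman_le {r κ' C : ℝ} {x e : E} (hx : 0 ≤ x)
    (H : ∀ t : AvgTree ι E, t.Nonneg → t.mean = x → t.maxMoment r e - κ' * t.moment r ≤ C) :
    bellman ι r κ' x e ≤ C := by
  refine csSup_le ⟨_, leaf x, hx, rfl, rfl⟩ ?_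
  rintro y ⟨t, ht, htx, rfl⟩
  exact H t ht htx

lemma TreeMaximalBound.bellman_zero_le {r κ : ℝ} (h : TreeMaximalBound ι E r κ) (hr : 0 ≤ r)
    (hκ : 0 ≤ κ) {x : E} (hx : 0 ≤ x) : bellman ι r (2 ^ r * κ) x 0 ≤ 0 := by
  refine bellman_le hx fun t ht _ => ?_
  have h1 : κ * t.moment r ≤ 2 ^ r * κ * t.moment r := by
    have := Real.one_le_rpow (x := 2) (by norm_num) hr
    have h2 := t.moment_nonneg r
    nlinarith [mul_nonneg hκ h2]
  linarith [h t ht]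

variable [HasSolidNorm E] [IsOrderedAddMonoid E] [Nonempty ι] {r κ : ℝ}

/-- The factor `2 ^ r` pays for splitting off the starting value `e`. -/
lemma TreeMaximalBound.bddAbove (h : TreeMaximalBound ι E r κ) (hr : 0 ≤ r) (x : E) {e : E}
    (he : 0 ≤ e) : BddAbove {y | ∃ t : AvgTree ι E, t.Nonneg ∧ t.mean = x ∧
      y = t.maxMoment r e - 2 ^ r * κ * t.moment r} := by
  refine ⟨2 ^ r * ‖e‖ ^ r, ?_⟩
  rintro y ⟨t, ht, -, rfl⟩
  have h1 := t.maxMoment_sup_le hr he le_rfl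
  rw [sup_eq_left.2 he] at h1
  have h2 := h t ht
  have h3 : (2 : ℝ) ^ r * t.maxMoment r 0 ≤ 2 ^ r * (κ * t.moment r) := by gcongr
  linarith [h1, h3]

lemma TreeMaximalBound.le_bellman (h : TreeMaximalBound ι E r κ) (hr : 0 ≤ r) {e : E} (he : 0 ≤ e)
    {t : AvgTree ι E} (ht : t.Nonneg) :
    t.maxMoment r e - 2 ^ r * κ * t.moment r ≤ bellman ι r (2 ^ r * κ) t.mean e :=
  le_csSup (h.bddAbove hr _ he) ⟨t, ht, rfl, rfl⟩

/-- Constant step functions bound the Bellman function from below. -/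
lemma TreeMaximalBound.leaf_le_bellman (h : TreeMaximalBound ι E r κ) (hr : 0 ≤ r) {x e : E}
    (hx : 0 ≤ x) (he : 0 ≤ e) :
    ‖e ⊔ x‖ ^ r - 2 ^ r * κ * ‖x‖ ^ r ≤ bellman ι r (2 ^ r * κ) x e :=
  h.le_bellman hr he (t := leaf x) hx

/-- Averages over `ι` of functions of a balanced `Bool`-valued function. -/
lemma card_inv_smul_sum_comp {ι : Type*} [Fintype ι] [Nonempty ι] {M : Type*} [AddCommGroup M]
    [Module ℝ M] {σ : ι → Bool} {φ : ι ≃ ι}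
    (hσ : ∀ b, σ (φ b) = !σ b) (g : Bool → M) :
    (Fintype.card ι : ℝ)⁻¹ • ∑ b, g (σ b) = (2 : ℝ)⁻¹ • (g true + g false) := by
  have h1 : ∑ b, g (!σ b) = ∑ b, g (σ b) := by
    rw [← Equiv.sum_comp φ]
    simp [hσ]
  have h2 : ∑ b, g (σ b) + ∑ b, g (!σ b) = (Fintype.card ι : ℝ) • (g true + g false) := by
    rw [← Finset.sum_add_distrib, Finset.sum_congr rfl (g := fun _ => g true + g false)]
    · simp [Finset.sum_const, Nat.cast_smul_eq_nsmul]
    · intro b _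
      cases σ b <;> simp [add_comm]
  have hcard : (Fintype.card ι : ℝ) ≠ 0 := by exact_mod_cast Fintype.card_ne_zero
  have h3 : (2 : ℝ) • ∑ b, g (σ b) = (Fintype.card ι : ℝ) • (g true + g false) := by
    rw [two_smul, ← h2, h1]
  have h4 : ∑ b, g (σ b) = (2 : ℝ)⁻¹ • (Fintype.card ι : ℝ) • (g true + g false) := by
    rw [← h3, smul_smul]; norm_num
  rw [h4, smul_comm, smul_smul (Fintype.card ι : ℝ)⁻¹, inv_mul_cancel₀ hcard, one_smul]

/-- Concatenating two trees under a common node, one on each half of the branches, shows midpoint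
concavity. -/
lemma TreeMaximalBound.bellman_midpoint (h : TreeMaximalBound ι E r κ) (hr : 0 ≤ r)
    {σ : ι → Bool} {φ : ι ≃ ι} (hσ : ∀ b, σ (φ b) = !σ b) {x y e : E} (hx : 0 ≤ x) (hy : 0 ≤ y)
    (he : 0 ≤ e) :
    (bellman ι r (2 ^ r * κ) x e + bellman ι r (2 ^ r * κ) y e) / 2
      ≤ bellman ι r (2 ^ r * κ) ((2 : ℝ)⁻¹ • (x + y)) e := by
  set V := bellman ι r (2 ^ r * κ) ((2 : ℝ)⁻¹ • (x + y)) e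
  have key : ∀ t s : AvgTree ι E, t.Nonneg → s.Nonneg → t.mean = x → s.mean = y →
      (t.maxMoment r e - 2 ^ r * κ * t.moment r)
        + (s.maxMoment r e - 2 ^ r * κ * s.moment r) ≤ 2 * V := by
    rintro t s ht hs rfl rfl
    let pick : Bool → AvgTree ι E := fun b => if b then t else s
    let q : AvgTree ι E := node fun b => pick (σ b)
    have hq : q.Nonneg := fun b => by
      simp only [pick]
      split_ifs <;> assumption
    have hmean : q.mean = (2 : ℝ)⁻¹ • (t.mean + s.mean) := by
      simp only [q, mean]
      rw [card_inv_smul_sum_comp hσ fun b => (pick b).mean]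
      simp [pick]
    have hmom : q.moment r = 2⁻¹ * (t.moment r + s.moment r) := by
      have := card_inv_smul_sum_comp hσ fun b => (pick b).moment r
      simp only [smul_eq_mul] at this
      simp only [q, moment]
      rw [this]
      simp [pick]
    have hmax : q.maxMoment r e
        = 2⁻¹ * (t.maxMoment r (e ⊔ q.mean) + s.maxMoment r (e ⊔ q.mean)) := by
      have := card_inv_smul_sum_comp hσ fun b => (pick b).maxMoment r (e ⊔ q.mean)
      simp only [smul_eq_mul] at this
      rw [show q.maxMoment r e = _ from maxMoment_node r _ e, this]
      simp [pick]
    have h1 := h.le_bellman hr he hq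
    rw [hmean] at h1
    have h2 := t.maxMoment_mono hr he (le_sup_left : e ≤ e ⊔ q.mean)
    have h3 := s.maxMoment_mono hr he (le_sup_left : e ≤ e ⊔ q.mean)
    rw [hmom, hmax] at h1
    change _ ≤ V at h1
    linarith
  have h1 : ∀ s : AvgTree ι E, s.Nonneg → s.mean = y →
      bellman ι r (2 ^ r * κ) x e ≤ 2 * V - (s.maxMoment r e - 2 ^ r * κ * s.moment r) :=
    fun s hs hsy => bellman_le hx fun t ht htx => by linarith [key t s ht hs htx hsy]
  have h2 : bellman ι r (2 ^ r * κ) y e ≤ 2 * V - bellman ι r (2 ^ r * κ) x e :=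
    bellman_le hy fun s hs hsy => by linarith [h1 s hs hsy]
  linarith

/-- A midpoint concave function on `[0,1]` that is bounded below lies above its chord: the infimum
`m` of the difference satisfies `m ≥ m / 2`. -/
lemma chord_le_of_midpoint {φ : ℝ → ℝ}
    (hmid : ∀ s ∈ Set.Icc (0 : ℝ) 1, ∀ t ∈ Set.Icc (0 : ℝ) 1, (φ s + φ t) / 2 ≤ φ ((s + t) / 2))
    {m : ℝ} (hm : ∀ s ∈ Set.Icc (0 : ℝ) 1, m ≤ φ s) {s : ℝ} (hs : s ∈ Set.Icc (0 : ℝ) 1) :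
    (1 - s) * φ 0 + s * φ 1 ≤ φ s := by
  set ψ : ℝ → ℝ := fun s => φ s - ((1 - s) * φ 0 + s * φ 1)
  have hψ0 : ψ 0 = 0 := by simp [ψ]
  have hψ1 : ψ 1 = 0 := by simp [ψ]
  have hψmid : ∀ s ∈ Set.Icc (0 : ℝ) 1, ∀ t ∈ Set.Icc (0 : ℝ) 1,
      (ψ s + ψ t) / 2 ≤ ψ ((s + t) / 2) := by
    intro s hs t ht
    have := hmid s hs t ht
    simp only [ψ]
    linarith
  have hbdd : BddBelow (ψ '' Set.Icc 0 1) := by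
    refine ⟨m - (|φ 0| + |φ 1|), ?_⟩
    rintro _ ⟨s, hs, rfl⟩
    have h1 := hm s hs
    have h2 : (1 - s) * φ 0 ≤ |φ 0| := by
      nlinarith [le_abs_self (φ 0), abs_nonneg (φ 0), hs.1, hs.2]
    have h3 : s * φ 1 ≤ |φ 1| := by
      nlinarith [le_abs_self (φ 1), abs_nonneg (φ 1), hs.1, hs.2]
    simp only [ψ]
    linarith
  set I := sInf (ψ '' Set.Icc 0 1)
  have hI : ∀ s ∈ Set.Icc (0 : ℝ) 1, I ≤ ψ s := fun s hs => csInf_le hbdd ⟨s, hs, rfl⟩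
  have hhalf : I / 2 ≤ I := by
    refine le_csInf ⟨_, 0, by simp, rfl⟩ ?_
    rintro _ ⟨s, hs, rfl⟩
    rcases le_total s (1 / 2) with h | h
    · have h2 : 2 * s ∈ Set.Icc (0 : ℝ) 1 := ⟨by linarith [hs.1], by linarith⟩
      have := hψmid 0 (by simp) _ h2
      rw [hψ0, show (0 + 2 * s) / 2 = s by ring] at this
      linarith [hI _ h2]
    · have h2 : 2 * s - 1 ∈ Set.Icc (0 : ℝ) 1 := ⟨by linarith, by linarith [hs.2]⟩
      have := hψmid 1 (by simp) _ h2
      rw [hψ1, show (1 + (2 * s - 1)) / 2 = s by ring] at this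
      linarith [hI _ h2]
  have := hI s hs
  simp only [ψ] at this
  linarith

variable [IsOrderedModule ℝ E]

/-- Midpoint concavity and the lower bound by constant step functions, which is uniform on segments,
give concavity; no continuity is needed. -/
lemma TreeMaximalBound.concaveOn_bellman (h : TreeMaximalBound ι E r κ) (hr : 0 ≤ r)
    (hκ : 0 ≤ κ) {σ : ι → Bool} {φ : ι ≃ ι} (hσ : ∀ b, σ (φ b) = !σ b) {e : E} (he : 0 ≤ e) :
    ConcaveOn ℝ (Set.Ici (0 : E)) fun x => bellman ι r (2 ^ r * κ) x e := by
  refine ⟨convex_Ici 0, fun x hx y hy a b ha hb hab => ?_⟩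
  have hx : 0 ≤ x := hx
  have hy : 0 ≤ y := hy
  let z : ℝ → E := fun s => (1 - s) • x + s • y
  have hz : ∀ s ∈ Set.Icc (0 : ℝ) 1, 0 ≤ z s := fun s hs =>
    add_nonneg (smul_nonneg (by linarith [hs.2]) hx) (smul_nonneg hs.1 hy)
  have hmid : ∀ s ∈ Set.Icc (0 : ℝ) 1, ∀ t ∈ Set.Icc (0 : ℝ) 1,
      (bellman ι r (2 ^ r * κ) (z s) e + bellman ι r (2 ^ r * κ) (z t) e) / 2
        ≤ bellman ι r (2 ^ r * κ) (z ((s + t) / 2)) e := by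
    intro s hs t ht
    have e1 : z ((s + t) / 2) = (2 : ℝ)⁻¹ • (z s + z t) := by
      simp only [z]
      module
    rw [e1]
    exact h.bellman_midpoint hr hσ (hz s hs) (hz t ht) he
  have hlow : ∀ s ∈ Set.Icc (0 : ℝ) 1,
      -(2 ^ r * κ * (‖x‖ + ‖y‖) ^ r) ≤ bellman ι r (2 ^ r * κ) (z s) e := by
    intro s hs
    refine le_trans ?_ (h.leaf_le_bellman hr (hz s hs) he)
    have h1 : ‖z s‖ ≤ ‖x‖ + ‖y‖ := by
      refine (norm_add_le _ _).trans ?_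
      rw [norm_smul, norm_smul, Real.norm_of_nonneg hs.1,
        Real.norm_of_nonneg (by linarith [hs.2] : 0 ≤ 1 - s)]
      nlinarith [norm_nonneg x, norm_nonneg y, hs.1, hs.2]
    have h2 : ‖z s‖ ^ r ≤ (‖x‖ + ‖y‖) ^ r := Real.rpow_le_rpow (norm_nonneg _) h1 hr
    have h3 : 2 ^ r * κ * ‖z s‖ ^ r ≤ 2 ^ r * κ * (‖x‖ + ‖y‖) ^ r := by gcongr
    have h4 : 0 ≤ ‖e ⊔ z s‖ ^ r := by positivity
    linarith
  have := chord_le_of_midpoint hmid hlow (s := b) ⟨hb, by linarith⟩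
  have ea : 1 - b = a := by linarith
  simp only [z, ea, sub_zero, one_smul, zero_smul, add_zero, sub_self, zero_add] at this
  simpa [smul_eq_mul] using this

end Bellman

/-! ### Transference of the lattice maximal inequality -/

section Transference

open scoped Classical

variable {X : Type*} [MeasurableSpace X] {μ : Measure X} {D : Finset (Set X)}
  {E : Type*} [NormedAddCommGroup E] [NormedSpace ℝ E] [Lattice E]
  [HasSolidNorm E] [IsOrderedAddMonoid E] [IsOrderedModule ℝ E]
  {ι : Type*} [Fintype ι] [Nonempty ι] {r κ : ℝ}

/-- Concavity of the Bellman function gives the Bellman inequality for arbitrary weights. -/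
lemma TreeMaximalBound.sum_bellman_le (h : TreeMaximalBound ι E r κ) (hr : 0 ≤ r) (hκ : 0 ≤ κ)
    {σ : ι → Bool} {φ : ι ≃ ι} (hσ : ∀ b, σ (φ b) = !σ b) {α : Type*} (s : Finset α) {w : α → ℝ}
    {y : α → E} (hw : ∀ i ∈ s, 0 ≤ w i) (hw1 : ∑ i ∈ s, w i = 1) (hy : ∀ i ∈ s, 0 ≤ y i) {x e : E}
    (he : 0 ≤ e) (hx : ∑ i ∈ s, w i • y i = x) :
    ∑ i ∈ s, w i * bellman ι r (2 ^ r * κ) (y i) (e ⊔ x) ≤ bellman ι r (2 ^ r * κ) x e := by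
  rw [← bellman_sup_self _ _ x e]
  have := (h.concaveOn_bellman hr hκ hσ (e := e ⊔ x) (he.trans le_sup_left)).le_map_sum hw hw1
    (p := y) hy
  rw [hx] at this
  simpa [smul_eq_mul] using this

/-- Jensen's inequality, in a form that includes null sets. -/
lemma rpow_norm_setAverage_le {E : Type*} [NormedAddCommGroup E] [NormedSpace ℝ E] (hr : 1 ≤ r)
    {f : X → E} {Q : Set X} (hQ : μ Q ≠ ∞) (hf : IntegrableOn f Q μ)
    (hfr : IntegrableOn (fun x => ‖f x‖ ^ r) Q μ) :
    μ.real Q * ‖⨍ x in Q, f x ∂μ‖ ^ r ≤ ∫ x in Q, ‖f x‖ ^ r ∂μ := by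
  by_cases h0 : μ Q = 0
  · simp [Measure.real, h0, Measure.restrict_eq_zero.2 h0]
  have hpos : 0 < μ.real Q := ENNReal.toReal_pos h0 hQ
  have h1 : ‖⨍ x in Q, f x ∂μ‖ ≤ ⨍ x in Q, ‖f x‖ ∂μ := by
    rw [setAverage_eq, setAverage_eq, norm_smul, smul_eq_mul, Real.norm_of_nonneg (by positivity)]
    gcongr
    exact norm_integral_le_integral_norm _
  have h2 := (convexOn_rpow hr).map_set_average_le
    (continuousOn_id.rpow_const fun _ _ => Or.inr (by linarith)) isClosed_Ici h0 hQ
    (Filter.Eventually.of_forall fun x => norm_nonneg (f x)) hf.norm hfr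
  calc μ.real Q * ‖⨍ x in Q, f x ∂μ‖ ^ r ≤ μ.real Q * (⨍ x in Q, ‖f x‖ ∂μ) ^ r := by
        gcongr
    _ ≤ μ.real Q * ⨍ x in Q, ‖f x‖ ^ r ∂μ := by gcongr
    _ = _ := by
      rw [setAverage_eq, smul_eq_mul, ← mul_assoc, mul_inv_cancel₀ hpos.ne', one_mul]

/-- The Bellman inequality along a laminar family, by induction on the number of members. The
maximal members strictly inside `F` may have arbitrary relative measures; this is where concavity
of the Bellman function replaces equal branching. -/
theorem IsLaminar.integral_supFrom_le (hD : IsLaminar μ D) (h : TreeMaximalBound ι E r κ)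
    (hr : 1 ≤ r) (hκ : 0 ≤ κ) {σ : ι → Bool} {φ : ι ≃ ι} (hσ : ∀ b, σ (φ b) = !σ b) {f : X → E}
    (hf0 : 0 ≤ f) (n : ℕ) : ∀ F ∈ D, (below D F).card = n → IntegrableOn f F μ →
      IntegrableOn (fun x => ‖f x‖ ^ r) F μ → ∀ e : E, 0 ≤ e →
      ∫ x in F, ‖supFrom e {Q ∈ below D F | x ∈ Q} fun Q => ⨍ y in Q, f y ∂μ‖ ^ r ∂μ
        ≤ μ.real F * bellman ι r (2 ^ r * κ) (⨍ y in F, f y ∂μ) e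
          + 2 ^ r * κ * ∫ x in F, ‖f x‖ ^ r ∂μ := by
  induction n using Nat.strong_induction_on with
  | _ n ih =>
  intro F hF hn hfi hfr e he
  have hr0 : 0 ≤ r := by linarith
  have hFt := hD.measure_ne_top F hF
  by_cases h0 : μ F = 0
  · simp [Measure.restrict_eq_zero.2 h0, Measure.real, h0]
  have hpos : 0 < μ.real F := ENNReal.toReal_pos h0 hFt
  set a : Set X → E := fun Q => ⨍ y in Q, f y ∂μ
  have ha : ∀ Q, 0 ≤ a Q := setAverage_nonneg hf0
  set V := bellman ι r (2 ^ r * κ) (E := E)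
  set S := (below D F).erase F
  have hSD : S ⊆ D := (Finset.erase_subset _ _).trans below_subset
  have hS : IsLaminar μ S := hD.subset hSD
  set Ch := maxMembers S
  have hChS : Ch ⊆ S := maxMembers_subset
  set m := F \ unionOf Ch
  have hChm : MeasurableSet (unionOf Ch) := (hS.subset hChS).measurableSet_unionOf
  have hm : MeasurableSet m := (hD.measurableSet F hF).diff hChm
  have hChF : ∀ P ∈ Ch, P ∈ D ∧ P ⊂ F := by
    intro P hP
    obtain ⟨hne, hb⟩ := Finset.mem_erase.1 (hChS hP)
    exact ⟨(mem_below.1 hb).1, (mem_below.1 hb).2.ssubset_of_ne hne⟩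
  -- The blocks: the maximal proper subcubes of `F` and the rest of `F`.
  set W := insert m Ch
  have hWF : ∀ P ∈ W, P ⊆ F := by
    intro P hP
    rcases Finset.mem_insert.1 hP with rfl | hP
    · exact Set.sdiff_subset
    · exact (hChF P hP).2.1
  have hWm : ∀ P ∈ W, MeasurableSet P := by
    intro P hP
    rcases Finset.mem_insert.1 hP with rfl | hP
    · exact hm
    · exact hD.measurableSet P (hChF P hP).1
  have hWt : ∀ P ∈ W, μ P ≠ ∞ := fun P hP =>
    ((measure_mono (hWF P hP)).trans_lt hFt.lt_top).ne
  have hWd : Set.PairwiseDisjoint (↑W : Set (Set X)) id := by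
    rw [Finset.coe_insert]
    refine hS.pairwiseDisjoint_maxMembers.insert fun P hP _ => ?_
    refine Set.disjoint_left.2 fun x hx hxP => hx.2 (mem_unionOf.2 ⟨P, hP, hxP⟩)
  have hWU : ⋃ P ∈ W, id P = F := by
    ext x
    simp only [Set.mem_iUnion, id]
    constructor
    · rintro ⟨P, hP, hx⟩
      exact hWF P hP hx
    · intro hx
      by_cases hxU : x ∈ unionOf Ch
      · obtain ⟨P, hP, hxP⟩ := mem_unionOf.1 hxU
        exact ⟨P, Finset.mem_insert_of_mem hP, hxP⟩
      · exact ⟨m, Finset.mem_insert_self _ _, hx, hxU⟩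
  have hsplitf : ∫ x in F, f x ∂μ = ∑ P ∈ W, ∫ x in P, f x ∂μ := by
    conv_lhs => rw [← hWU]
    exact integral_biUnion_finset W hWm hWd fun P hP => hfi.mono_set (hWF P hP)
  have hsplit : ∀ g : X → ℝ, IntegrableOn g F μ →
      ∫ x in F, g x ∂μ = ∑ P ∈ W, ∫ x in P, g x ∂μ := by
    intro g hg
    conv_lhs => rw [← hWU]
    exact integral_biUnion_finset W hWm hWd fun P hP => hg.mono_set (hWF P hP)
  set M : X → ℝ := fun x => ‖supFrom e {Q ∈ below D F | x ∈ Q} a‖ ^ r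
  have hMint : IntegrableOn M F μ := by
    obtain ⟨s, hs⟩ := (hD.subset (below_subset (F := F))).exists_simpleFunc
      fun S => ‖supFrom e S a‖ ^ r
    have : M = s := funext fun x => (hs x).symm
    rw [this]
    have : IsFiniteMeasure (μ.restrict F) := ⟨by simpa using hFt.lt_top⟩
    exact s.integrable_of_isFiniteMeasure
  have hblock : ∀ P ∈ W, ∫ x in P, M x ∂μ
      ≤ μ.real P * V (a P) (e ⊔ a F) + 2 ^ r * κ * ∫ x in P, ‖f x‖ ^ r ∂μ := by
    intro P hP
    have he' : 0 ≤ e ⊔ a F := he.trans le_sup_left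
    have hFb : F ∈ below D F := mem_below.2 ⟨hF, subset_rfl⟩
    rcases Finset.mem_insert.1 hP with rfl | hPC
    -- Outside the smaller members only `F` contributes, and constant step functions suffice.
    · have hMm : ∀ x ∈ m, M x = ‖e ⊔ a F‖ ^ r := by
        intro x hx
        have : ({Q ∈ below D F | x ∈ Q} : Finset (Set X)) = {F} := by
          ext Q
          simp only [Finset.mem_filter, Finset.mem_singleton]
          constructor
          · rintro ⟨hQ, hxQ⟩
            by_contra hne
            refine hx.2 ?_
            rw [unionOf_maxMembers]
            exact mem_unionOf.2 ⟨Q, Finset.mem_erase.2 ⟨hne, hQ⟩, hxQ⟩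
          · rintro rfl
            exact ⟨hFb, hx.1⟩
        simp only [M, this, supFrom, Finset.fold_singleton]
        rw [sup_comm]
      rw [setIntegral_congr_fun hm hMm, setIntegral_const, smul_eq_mul]
      have h1 := rpow_norm_setAverage_le hr (hWt m hP) (hfi.mono_set (hWF m hP))
        (hfr.mono_set (hWF m hP))
      have h2 := h.leaf_le_bellman hr0 (ha m) he'
      have h3 : ‖e ⊔ a F‖ ^ r ≤ ‖e ⊔ a F ⊔ a m‖ ^ r :=
        Real.rpow_le_rpow (norm_nonneg _) (norm_le_norm_of_nonneg_of_le he' le_sup_left) hr0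
      have h4 : μ.real m * ‖e ⊔ a F‖ ^ r
          ≤ μ.real m * (V (a m) (e ⊔ a F) + 2 ^ r * κ * ‖a m‖ ^ r) := by
        gcongr
        linarith
      have h5 : 2 ^ r * κ * (μ.real m * ‖a m‖ ^ r) ≤ 2 ^ r * κ * ∫ x in m, ‖f x‖ ^ r ∂μ := by
        gcongr
      linarith
    · obtain ⟨hPD, hPF⟩ := hChF P hPC
      have hlt : (below D P).card < n := by
        rw [← hn]
        refine Finset.card_lt_card ⟨fun Q hQ => mem_below.2
          ⟨(mem_below.1 hQ).1, (mem_below.1 hQ).2.trans hPF.1⟩, fun hsub => ?_⟩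
        exact hPF.2 (mem_below.1 (hsub hFb)).2
      have hi := ih _ hlt P hPD rfl (hfi.mono_set hPF.1) (hfr.mono_set hPF.1) (e ⊔ a F) he'
      refine le_trans (setIntegral_mono_on (hMint.mono_set hPF.1) ?_
        (hD.measurableSet P hPD) fun x hx => ?_) hi
      · obtain ⟨s, hs⟩ := (hD.subset (below_subset (F := P))).exists_simpleFunc
          fun S => ‖supFrom (e ⊔ a F) S a‖ ^ r
        have : (fun x => ‖supFrom (e ⊔ a F) {Q ∈ below D P | x ∈ Q} a‖ ^ r) = s :=
          funext fun x => (hs x).symm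
        rw [this]
        have : IsFiniteMeasure (μ.restrict P) := ⟨by simpa using (hWt P hP).lt_top⟩
        exact s.integrable_of_isFiniteMeasure
      · refine Real.rpow_le_rpow (norm_nonneg _) ?_ hr0
        refine norm_le_norm_of_nonneg_of_le (he.trans (le_supFrom_self _ _ _)) ?_
        refine supFrom_le (le_sup_left.trans (le_supFrom_self _ _ _)) fun Q hQ => ?_
        obtain ⟨hQb, hxQ⟩ := Finset.mem_filter.1 hQ
        by_cases hQF : Q = F
        · rw [hQF]
          exact le_sup_right.trans (le_supFrom_self _ _ _)
        · refine le_supFrom (Finset.mem_filter.2 ⟨mem_below.2 ⟨(mem_below.1 hQb).1, ?_⟩, hxQ⟩)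
          have hQS : Q ∈ S := Finset.mem_erase.2 ⟨hQF, hQb⟩
          rcases hD.nested_of_mem (hSD hQS) hPD hxQ hx with hQP | hQP
          · exact hQP
          · exact ((Finset.mem_filter.1 hPC).2 Q hQS hQP).subset
  have hw1 : ∑ P ∈ W, μ.real P / μ.real F = 1 := by
    have h1 : ∑ P ∈ W, μ.real P = μ.real F := by
      have := hsplit (fun _ => (1 : ℝ)) (integrableOn_const hFt)
      simpa using this.symm
    rw [← Finset.sum_div, h1, div_self hpos.ne']
  have hx : ∑ P ∈ W, (μ.real P / μ.real F) • a P = a F := by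
    have h1 : ∀ P ∈ W, (μ.real P / μ.real F) • a P = (μ.real F)⁻¹ • ∫ x in P, f x ∂μ := by
      intro P hP
      rw [← measure_smul_setAverage f (hWt P hP), smul_smul, div_eq_inv_mul]
    rw [Finset.sum_congr rfl h1, ← Finset.smul_sum, ← hsplitf]
    exact (setAverage_eq _ _ _).symm
  have hV := h.sum_bellman_le hr0 hκ hσ W (w := fun P => μ.real P / μ.real F) (y := a)
    (fun P _ => by positivity) hw1 (fun P _ => ha P) he hx
  have hV' : ∑ P ∈ W, μ.real P * V (a P) (e ⊔ a F) ≤ μ.real F * V (a F) e := by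
    calc ∑ P ∈ W, μ.real P * V (a P) (e ⊔ a F)
        = μ.real F * ∑ P ∈ W, μ.real P / μ.real F * V (a P) (e ⊔ a F) := by
          rw [Finset.mul_sum]
          refine Finset.sum_congr rfl fun P _ => ?_
          field_simp
      _ ≤ _ := by gcongr
  calc ∫ x in F, M x ∂μ = ∑ P ∈ W, ∫ x in P, M x ∂μ := hsplit M hMint
    _ ≤ ∑ P ∈ W, (μ.real P * V (a P) (e ⊔ a F) + 2 ^ r * κ * ∫ x in P, ‖f x‖ ^ r ∂μ) :=
        Finset.sum_le_sum hblock
    _ = ∑ P ∈ W, μ.real P * V (a P) (e ⊔ a F) + 2 ^ r * κ * ∫ x in F, ‖f x‖ ^ r ∂μ := by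
        rw [Finset.sum_add_distrib, ← Finset.mul_sum, ← hsplit _ hfr]
    _ ≤ _ := by gcongr

/-- Transference: the lattice maximal inequality for trees with equal branching gives the one for
an arbitrary laminar family and an arbitrary measure. -/
theorem IsLaminar.eLpNorm_latMax_le (hD : IsLaminar μ D) {A : ℝ≥0} {r : ℝ} (hr : 1 < r)
    (h : TreeMaximalBound ι E r (A ^ r)) {σ : ι → Bool} {φ : ι ≃ ι} (hσ : ∀ b, σ (φ b) = !σ b)
    {F : Set X} (hF : F ∈ D) (hDF : ∀ Q ∈ D, Q ⊆ F) {f : X → E} (hf0 : 0 ≤ f)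
    (hf : MemLp f (ENNReal.ofReal r) (μ.restrict F)) :
    eLpNorm (latMax μ D f) (ENNReal.ofReal r) (μ.restrict F)
      ≤ (2 * A : ℝ≥0) * eLpNorm f (ENNReal.ofReal r) (μ.restrict F) := by
  have hr0 : 0 < r := by linarith
  have hp0 : ENNReal.ofReal r ≠ 0 := (ENNReal.ofReal_pos.2 hr0).ne'
  have : IsFiniteMeasure (μ.restrict F) := ⟨by simpa using (hD.measure_ne_top F hF).lt_top⟩
  have hfi : IntegrableOn f F μ := hf.integrable (by simpa using hr.le)
  have hfr : IntegrableOn (fun x => ‖f x‖ ^ r) F μ := by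
    have := hf.integrable_norm_rpow hp0 ENNReal.ofReal_ne_top
    rwa [ENNReal.toReal_ofReal hr0.le] at this
  have hbD : below D F = D := Finset.filter_true_of_mem hDF
  have hκ : (0 : ℝ) ≤ (A : ℝ) ^ r := by positivity
  have hmain := hD.integral_supFrom_le h hr.le hκ hσ hf0 _ F hF rfl hfi hfr 0 le_rfl
  rw [hbD] at hmain
  have hz := h.bellman_zero_le hr0.le hκ (setAverage_nonneg (μ := μ) hf0 F)
  have hle : ∫ x in F, ‖latMax μ D f x‖ ^ r ∂μ ≤ (2 * A) ^ r * ∫ x in F, ‖f x‖ ^ r ∂μ := by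
    rw [Real.mul_rpow (by norm_num) A.coe_nonneg]
    refine hmain.trans (add_le_of_nonpos_left ?_)
    exact mul_nonpos_of_nonneg_of_nonpos measureReal_nonneg hz
  obtain ⟨s, hs⟩ := hD.exists_simpleFunc fun S => supFrom 0 S fun Q => ⨍ y in Q, f y ∂μ
  have hs' : latMax μ D f = s := funext fun x => (hs x).symm
  have hM : MemLp (latMax μ D f) (ENNReal.ofReal r) (μ.restrict F) := by
    rw [hs']
    exact s.memLp_of_isFiniteMeasure _ _
  rw [hM.eLpNorm_eq_integral_rpow_norm hp0 ENNReal.ofReal_ne_top,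
    hf.eLpNorm_eq_integral_rpow_norm hp0 ENNReal.ofReal_ne_top, ENNReal.toReal_ofReal hr0.le,
    ← ENNReal.ofReal_coe_nnreal, ← ENNReal.ofReal_mul (by positivity)]
  refine ENNReal.ofReal_le_ofReal ?_
  have hI : 0 ≤ ∫ x in F, ‖f x‖ ^ r ∂μ := integral_nonneg fun x => by positivity
  calc (∫ x in F, ‖latMax μ D f x‖ ^ r ∂μ) ^ r⁻¹
      ≤ ((2 * A) ^ r * ∫ x in F, ‖f x‖ ^ r ∂μ) ^ r⁻¹ :=
        Real.rpow_le_rpow (integral_nonneg fun x => by positivity) hle (by positivity)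
    _ = _ := by
        rw [Real.mul_rpow (by positivity) hI, ← Real.rpow_mul (by positivity),
          mul_inv_cancel₀ hr0.ne', Real.rpow_one]
        push_cast
        rfl

end Transference

/-! ### Geometry of dyadic cubes -/

section Dyadic

namespace DyadicCube

variable {d : ℕ}

/-- In terms of integer parts, which turns the nesting of cubes into integer division. -/
lemma mem_toSet_iff {Q : DyadicCube d} {x : EuclideanSpace ℝ (Fin d)} :
    x ∈ Q.toSet ↔ ∀ i, ⌊(2 : ℝ) ^ Q.scale * x i⌋ = Q.pos i := by
  have h2 : (0 : ℝ) < 2 ^ Q.scale := by positivity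
  refine forall_congr' fun i => ?_
  rw [Int.floor_eq_iff, zpow_neg, inv_mul_le_iff₀ h2, ← div_eq_inv_mul, lt_div_iff₀ h2,
    mul_comm (x i)]

lemma floor_eq_ediv {k k' : ℤ} {n : ℕ} (h : k' = k + n) (y : ℝ) :
    ⌊(2 : ℝ) ^ k * y⌋ = ⌊(2 : ℝ) ^ k' * y⌋ / ((2 ^ n : ℕ) : ℤ) := by
  rw [← Int.floor_div_natCast, h, zpow_add₀ (by norm_num), zpow_natCast]
  congr 1
  push_cast
  field_simp

lemma subset_of_mem {Q R : DyadicCube d} (h : R.scale ≤ Q.scale) {x : EuclideanSpace ℝ (Fin d)}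
    (hQ : x ∈ Q.toSet) (hR : x ∈ R.toSet) : Q.toSet ⊆ R.toSet := by
  intro y hy
  rw [mem_toSet_iff] at *
  obtain ⟨n, hn⟩ := Int.le.dest h
  intro i
  rw [floor_eq_ediv hn.symm, hy i, ← hQ i, ← floor_eq_ediv hn.symm, hR i]

lemma nested (Q R : DyadicCube d) :
    Q.toSet ⊆ R.toSet ∨ R.toSet ⊆ Q.toSet ∨ Disjoint Q.toSet R.toSet := by
  by_cases hd : Disjoint Q.toSet R.toSet
  · exact Or.inr (Or.inr hd)
  obtain ⟨x, hQ, hR⟩ := Set.not_disjoint_iff.1 hd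
  rcases le_total R.scale Q.scale with h | h
  · exact Or.inl (subset_of_mem h hQ hR)
  · exact Or.inr (Or.inl (subset_of_mem h hR hQ))

lemma nonempty_toSet (Q : DyadicCube d) : Q.toSet.Nonempty := by
  refine ⟨WithLp.toLp 2 fun i => (2 : ℝ) ^ (-Q.scale) * Q.pos i, fun i => ⟨le_rfl, ?_⟩⟩
  have : (0 : ℝ) < 2 ^ (-Q.scale) := by positivity
  exact mul_lt_mul_of_pos_left (lt_add_one _) this

lemma toSet_eq_preimage (Q : DyadicCube d) :
    Q.toSet = (WithLp.ofLp : EuclideanSpace ℝ (Fin d) → Fin d → ℝ) ⁻¹'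
      Set.univ.pi fun i => Set.Ico ((2 : ℝ) ^ (-Q.scale) * (Q.pos i : ℝ))
        ((2 : ℝ) ^ (-Q.scale) * ((Q.pos i : ℝ) + 1)) := by
  ext x
  simp [toSet]

lemma measurableSet_toSet (Q : DyadicCube d) : MeasurableSet Q.toSet := by
  rw [toSet_eq_preimage]
  exact (PiLp.volume_preserving_ofLp (Fin d)).measurable
    (MeasurableSet.univ_pi fun i => measurableSet_Ico)

lemma volume_toSet (Q : DyadicCube d) :
    volume Q.toSet = ENNReal.ofReal ((2 : ℝ) ^ (-Q.scale)) ^ d := by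
  rw [toSet_eq_preimage, (PiLp.volume_preserving_ofLp (Fin d)).measure_preimage
    (MeasurableSet.univ_pi fun i => measurableSet_Ico).nullMeasurableSet, volume_pi_pi]
  simp only [Real.volume_Ico]
  rw [Finset.prod_congr rfl (g := fun _ => ENNReal.ofReal ((2 : ℝ) ^ (-Q.scale)))]
  · simp
  · intro i _
    congr 1
    ring

lemma volume_toSet_ne_zero (Q : DyadicCube d) : volume Q.toSet ≠ 0 := by
  rw [volume_toSet]
  exact pow_ne_zero _ (ENNReal.ofReal_pos.2 (by positivity)).ne'

lemma volume_toSet_ne_top (Q : DyadicCube d) : volume Q.toSet ≠ ∞ := by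
  rw [volume_toSet]
  exact ENNReal.pow_ne_top ENNReal.ofReal_ne_top

/-- For `d = 0` all cubes are the one-point space, so that positive dimension is needed. -/
lemma scale_le_of_subset (hd : 0 < d) {Q R : DyadicCube d} (h : Q.toSet ⊆ R.toSet) :
    R.scale ≤ Q.scale := by
  have h1 := measure_mono (μ := volume) h
  rw [volume_toSet, volume_toSet, ENNReal.pow_le_pow_left_iff hd.ne',
    ENNReal.ofReal_le_ofReal_iff (by positivity), zpow_le_zpow_iff_right₀ (by norm_num)] at h1
  omega

lemma toSet_injective (hd : 0 < d) :
    Function.Injective (toSet : DyadicCube d → Set (EuclideanSpace ℝ (Fin d))) := by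
  intro Q R h
  have hs : Q.scale = R.scale :=
    le_antisymm (scale_le_of_subset hd h.symm.subset) (scale_le_of_subset hd h.subset)
  obtain ⟨x, hx⟩ := Q.nonempty_toSet
  have hxR : x ∈ R.toSet := h ▸ hx
  rw [mem_toSet_iff] at hx hxR
  have hp : Q.pos = R.pos := funext fun i => by rw [← hx i, ← hxR i, hs]
  cases Q; cases R
  simp_all

/-- The dyadic children of a cube. -/
def child (Q : DyadicCube d) (b : Fin d → Bool) : DyadicCube d where
  scale := Q.scale + 1
  pos i := 2 * Q.pos i + if b i then 1 else 0

lemma child_subset (Q : DyadicCube d) (b : Fin d → Bool) : (Q.child b).toSet ⊆ Q.toSet := by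
  intro x hx
  rw [mem_toSet_iff] at *
  intro i
  have h1 : ⌊(2 : ℝ) ^ (Q.scale + 1) * x i⌋ = 2 * Q.pos i + if b i then 1 else 0 := hx i
  rw [floor_eq_ediv (k' := Q.scale + 1) (n := 1) (by simp), h1]
  split_ifs
  · simp; omega
  · simp

lemma iUnion_child (Q : DyadicCube d) : ⋃ b, (Q.child b).toSet = Q.toSet := by
  refine Set.Subset.antisymm (Set.iUnion_subset Q.child_subset) fun x hx => ?_
  refine Set.mem_iUnion.2 ⟨fun i => decide (⌊(2 : ℝ) ^ (Q.scale + 1) * x i⌋ % 2 = 1), ?_⟩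
  rw [mem_toSet_iff] at *
  intro i
  have h1 := hx i
  rw [floor_eq_ediv (k' := Q.scale + 1) (n := 1) (by simp)] at h1
  simp only [child, decide_eq_true_eq]
  push_cast at h1
  split_ifs <;> omega

lemma pairwise_disjoint_child (Q : DyadicCube d) :
    Pairwise (Function.onFun Disjoint fun b => (Q.child b).toSet) := by
  intro b b' hne
  refine Set.disjoint_left.2 fun x hx hx' => hne (funext fun i => ?_)
  rw [mem_toSet_iff] at hx hx'
  have h : 2 * Q.pos i + (if b i then 1 else 0) = 2 * Q.pos i + if b' i then 1 else 0 :=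
    (hx i).symm.trans (hx' i)
  cases hb : b i <;> cases hb' : b' i <;> simp [hb, hb'] at h ⊢

lemma volume_child (Q : DyadicCube d) (b : Fin d → Bool) :
    volume Q.toSet = Fintype.card (Fin d → Bool) * volume (Q.child b).toSet := by
  rw [volume_toSet, volume_toSet, child]
  simp only [Fintype.card_pi, Fintype.card_bool, Finset.prod_const, Finset.card_univ,
    Fintype.card_fin]
  rw [Nat.cast_pow, ← mul_pow, Nat.cast_ofNat]
  congr 1
  rw [show (2 : ℝ≥0∞) = ENNReal.ofReal 2 by simp, ← ENNReal.ofReal_mul (by norm_num)]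
  congr 1
  rw [neg_add, zpow_add₀ (by norm_num), zpow_neg_one]
  ring

lemma isBounded_toSet (Q : DyadicCube d) : Bornology.IsBounded Q.toSet := by
  have h : Bornology.IsBounded (Set.univ.pi fun i : Fin d =>
      Set.Icc ((2 : ℝ) ^ (-Q.scale) * (Q.pos i : ℝ))
        ((2 : ℝ) ^ (-Q.scale) * ((Q.pos i : ℝ) + 1))) :=
    Bornology.IsBounded.pi fun i => Metric.isBounded_Icc _ _
  refine ((PiLp.antilipschitzWith_ofLp 2 fun _ : Fin d => ℝ).isBounded_preimage h).subset ?_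
  rw [toSet_eq_preimage]
  exact Set.preimage_mono (Set.pi_mono fun i _ => Set.Ico_subset_Icc_self)

lemma measure_toSet_ne_top (μ : Measure (EuclideanSpace ℝ (Fin d))) [IsLocallyFiniteMeasure μ]
    (Q : DyadicCube d) : μ Q.toSet ≠ ∞ :=
  Q.isBounded_toSet.measure_lt_top.ne

open Classical in
lemma isLaminar_image (μ : Measure (EuclideanSpace ℝ (Fin d))) [IsLocallyFiniteMeasure μ]
    (D : Finset (DyadicCube d)) : IsLaminar μ (D.image toSet) := by
  refine ⟨?_, ?_, ?_, ?_⟩ <;> simp only [Finset.forall_mem_image]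
  · exact fun Q _ => Q.nonempty_toSet
  · exact fun Q _ => Q.measurableSet_toSet
  · exact fun Q _ => Q.measure_toSet_ne_top μ
  · exact fun Q _ R _ => Q.nested R

open Classical in
/-- The subcubes of `Q` down to `n` generations. -/
noncomputable def descendants (Q : DyadicCube d) : ℕ → Finset (DyadicCube d)
  | 0 => {Q}
  | n + 1 => insert Q (Finset.univ.biUnion fun b => (Q.child b).descendants n)
termination_by n => n

open Classical in
lemma mem_descendants (hd : 0 < d) {Q P : DyadicCube d} {n : ℕ} :
    P ∈ Q.descendants n ↔ P.toSet ⊆ Q.toSet ∧ P.scale ≤ Q.scale + n := by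
  induction n generalizing Q with
  | zero =>
    rw [descendants, Finset.mem_singleton]
    constructor
    · rintro rfl
      simp
    · rintro ⟨h1, h2⟩
      have h3 := scale_le_of_subset hd h1
      obtain ⟨x, hx⟩ := P.nonempty_toSet
      refine toSet_injective hd (Set.Subset.antisymm h1 (subset_of_mem ?_ (h1 hx) hx))
      simpa using h2
  | succ n ih =>
    rw [descendants, Finset.mem_insert, Finset.mem_biUnion]
    constructor
    · rintro (rfl | ⟨b, -, h⟩)
      · exact ⟨subset_rfl, by omega⟩
      · obtain ⟨h1, h2⟩ := ih.1 h
        refine ⟨h1.trans (Q.child_subset b), ?_⟩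
        simp only [child] at h2
        push_cast
        omega
    · rintro ⟨h1, h2⟩
      have h3 := scale_le_of_subset hd h1
      obtain ⟨x, hx⟩ := P.nonempty_toSet
      rcases h3.eq_or_lt with h | h
      · exact Or.inl (toSet_injective hd
          (Set.Subset.antisymm h1 (subset_of_mem h.symm.le (h1 hx) hx)))
      · have hxQ := h1 hx
        rw [← iUnion_child] at hxQ
        obtain ⟨b, hb⟩ := Set.mem_iUnion.1 hxQ
        refine Or.inr ⟨b, Finset.mem_univ _, ih.2 ⟨subset_of_mem ?_ hx hb, ?_⟩⟩
        · simpa [child] using h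
        · simp only [child]
          push_cast at h2
          omega

lemma measure_ball_two_pow_mul_le {μ : Measure (EuclideanSpace ℝ (Fin d))} {C : ℝ≥0}
    (hμ : IsDoublingWith μ C) (x : EuclideanSpace ℝ (Fin d)) {s : ℝ} (hs : 0 < s) (n : ℕ) :
    μ (Metric.ball x (2 ^ n * s)) ≤ C ^ n * μ (Metric.ball x s) := by
  induction n with
  | zero => simp
  | succ n ih =>
    calc μ (Metric.ball x (2 ^ (n + 1) * s)) = μ (Metric.ball x (2 * (2 ^ n * s))) := by
          congr 2; ring
      _ ≤ C * μ (Metric.ball x (2 ^ n * s)) := hμ x _ (by positivity)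
      _ ≤ C * (C ^ n * μ (Metric.ball x s)) := by gcongr
      _ = _ := by ring

/-- A child contains the ball of half its side length around its centre, and its parent is contained
in the ball `2 ^ (d + 3)` times as large. -/
lemma measure_le_measure_child {μ : Measure (EuclideanSpace ℝ (Fin d))} {C : ℝ≥0}
    (hμ : IsDoublingWith μ C) (Q : DyadicCube d) (b : Fin d → Bool) :
    μ Q.toSet ≤ C ^ (d + 3) * μ (Q.child b).toSet := by
  set s : ℝ := 2 ^ (-(Q.scale + 1)) with hs
  have hs0 : 0 < s := by positivity
  have hs2 : (2 : ℝ) ^ (-Q.scale) = 2 * s := by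
    rw [hs, neg_add, zpow_add₀ (by norm_num), zpow_neg_one]; ring
  set P := Q.child b
  have hPs : (2 : ℝ) ^ (-P.scale) = s := rfl
  let z : EuclideanSpace ℝ (Fin d) := WithLp.toLp 2 fun i => s * ((P.pos i : ℝ) + 1 / 2)
  have hz : ∀ i, z i = s * ((P.pos i : ℝ) + 1 / 2) := fun i => rfl
  have hsmall : Metric.ball z (s / 2) ⊆ P.toSet := by
    intro x hx i
    have h1 : |x i - z i| < s / 2 := by
      refine lt_of_le_of_lt ?_ (Metric.mem_ball.1 hx)
      rw [dist_eq_norm, ← Real.norm_eq_abs]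
      exact PiLp.norm_apply_le (x - z) i
    rw [hz, abs_lt] at h1
    rw [hPs]
    constructor <;> linarith [h1.1, h1.2]
  have hlarge : Q.toSet ⊆ Metric.ball z (2 ^ (d + 3) * (s / 2)) := by
    intro x hx
    have h1 : ∀ i, |x i - z i| ≤ 2 * s := by
      intro i
      have hb : (P.pos i : ℝ) = 2 * (Q.pos i : ℝ) + if b i then 1 else 0 := by
        simp only [P, child]
        push_cast
        rfl
      have h2 := hx i
      rw [hs2] at h2
      rw [hz, hb, abs_le]
      split_ifs <;> constructor <;> nlinarith [h2.1, h2.2]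
    rw [Metric.mem_ball, EuclideanSpace.dist_eq, Real.sqrt_lt' (by positivity)]
    have h2 : ∑ i, dist (x i) (z i) ^ 2 ≤ ∑ _i : Fin d, (2 * s) ^ 2 := by
      refine Finset.sum_le_sum fun i _ => ?_
      rw [Real.dist_eq]
      exact pow_le_pow_left₀ (abs_nonneg _) (h1 i) 2
    refine h2.trans_lt ?_
    rw [Finset.sum_const, Finset.card_univ, Fintype.card_fin, nsmul_eq_mul]
    have hd2 : (d : ℝ) < 2 ^ d := by exact_mod_cast Nat.lt_two_pow_self
    have hd1 : (1 : ℝ) ≤ 2 ^ d := one_le_pow₀ (by norm_num)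
    have e1 : ((2 : ℝ) ^ (d + 3) * (s / 2)) ^ 2 = 16 * (2 ^ d * 2 ^ d) * s ^ 2 := by ring
    rw [e1]
    have hs4 : 0 < s ^ 2 := by positivity
    nlinarith [mul_le_mul_of_nonneg_left hd1 (by positivity : (0 : ℝ) ≤ 2 ^ d)]
  calc μ Q.toSet ≤ μ (Metric.ball z (2 ^ (d + 3) * (s / 2))) := measure_mono hlarge
    _ ≤ C ^ (d + 3) * μ (Metric.ball z (s / 2)) :=
        measure_ball_two_pow_mul_le hμ z (by positivity) _
    _ ≤ _ := by gcongr

end DyadicCube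

end Dyadic

/-! ### Step functions encoded by trees -/

section Realization

open scoped Classical

variable {d : ℕ} {E : Type*}

namespace AvgTree

/-- The cubes on which the step function encoded by a tree on `Q` is averaged: `Q` itself and the
cubes of all subtrees. -/
noncomputable def cubes : AvgTree (Fin d → Bool) E → DyadicCube d → Finset (DyadicCube d)
  | leaf _, Q => {Q}
  | node c, Q => insert Q (Finset.univ.biUnion fun b => (c b).cubes (Q.child b))

lemma self_mem_cubes (t : AvgTree (Fin d → Bool) E) (Q : DyadicCube d) : Q ∈ t.cubes Q := by
  cases t <;> simp [cubes]

variable [NormedAddCommGroup E]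

/-- The step function on the cube `Q` encoded by a tree. -/
noncomputable def realize : AvgTree (Fin d → Bool) E → DyadicCube d → EuclideanSpace ℝ (Fin d) → E
  | leaf v, Q => Q.toSet.indicator fun _ => v
  | node c, Q => fun x => ∑ b, (c b).realize (Q.child b) x

lemma realize_of_notMem (t : AvgTree (Fin d → Bool) E) {Q : DyadicCube d}
    {x : EuclideanSpace ℝ (Fin d)} (hx : x ∉ Q.toSet) : t.realize Q x = 0 := by
  induction t generalizing Q with
  | leaf v => simp [realize, hx]
  | node c ih =>
    rw [realize]
    exact Finset.sum_eq_zero fun b _ => ih b fun h => hx (Q.child_subset b h)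

lemma realize_node_eqOn (c : (Fin d → Bool) → AvgTree (Fin d → Bool) E) (Q : DyadicCube d)
    (b : Fin d → Bool) :
    Set.EqOn ((node c).realize Q) ((c b).realize (Q.child b)) (Q.child b).toSet := by
  intro x hx
  rw [realize]
  refine Finset.sum_eq_single_of_mem b (Finset.mem_univ _) fun b' _ hne => ?_
  exact realize_of_notMem _ fun h => Set.disjoint_left.1 (Q.pairwise_disjoint_child hne) h hx

lemma stronglyMeasurable_realize (t : AvgTree (Fin d → Bool) E) (Q : DyadicCube d) :
    StronglyMeasurable (t.realize Q) := by
  induction t generalizing Q with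
  | leaf v => exact stronglyMeasurable_const.indicator Q.measurableSet_toSet
  | node c ih =>
    simp only [realize]
    exact Finset.stronglyMeasurable_fun_sum _ fun b _ => ih b _

lemma integrable_realize (t : AvgTree (Fin d → Bool) E) (Q : DyadicCube d) :
    Integrable (t.realize Q) volume := by
  induction t generalizing Q with
  | leaf v =>
    exact (integrable_indicator_iff Q.measurableSet_toSet).2
      (integrableOn_const Q.volume_toSet_ne_top)
  | node c ih =>
    simp only [realize]
    exact integrable_finsetSum _ fun b _ => ih b _

lemma lintegral_toSet_eq_sum_child (Q : DyadicCube d) (u : EuclideanSpace ℝ (Fin d) → ℝ≥0∞) :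
    ∫⁻ x in Q.toSet, u x = ∑ b, ∫⁻ x in (Q.child b).toSet, u x := by
  rw [← Q.iUnion_child, lintegral_iUnion (fun b => (Q.child b).measurableSet_toSet)
    Q.pairwise_disjoint_child, tsum_fintype]

/-- Averages over `Q` of sums over the children, in `ℝ≥0∞`. -/
lemma ofReal_card_inv_mul_sum_mul_volume (Q : DyadicCube d) {a : (Fin d → Bool) → ℝ}
    (ha : ∀ b, 0 ≤ a b) :
    ENNReal.ofReal ((Fintype.card (Fin d → Bool) : ℝ)⁻¹ * ∑ b, a b) * volume Q.toSet
      = ∑ b, ENNReal.ofReal (a b) * volume (Q.child b).toSet := by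
  have hc : (0 : ℝ) < Fintype.card (Fin d → Bool) := by exact_mod_cast Fintype.card_pos
  have hv : ∀ b, volume (Q.child b).toSet
      = ENNReal.ofReal (Fintype.card (Fin d → Bool) : ℝ)⁻¹ * volume Q.toSet := by
    intro b
    rw [Q.volume_child b, ← mul_assoc, ENNReal.ofReal_inv_of_pos hc, ENNReal.ofReal_natCast,
      ENNReal.inv_mul_cancel (by exact_mod_cast hc.ne') (by simp), one_mul]
  simp only [hv]
  rw [← Finset.sum_mul, ← ENNReal.ofReal_sum_of_nonneg fun b _ => ha b, mul_comm (_⁻¹),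
    ENNReal.ofReal_mul (Finset.sum_nonneg fun b _ => ha b), mul_assoc]

lemma lintegral_enorm_rpow_realize {r : ℝ} (hr : 0 < r) (t : AvgTree (Fin d → Bool) E)
    (Q : DyadicCube d) :
    ∫⁻ x in Q.toSet, ‖t.realize Q x‖ₑ ^ r = ENNReal.ofReal (t.moment r) * volume Q.toSet := by
  induction t generalizing Q with
  | leaf v =>
    rw [setLIntegral_congr_fun (g := fun _ => ‖v‖ₑ ^ r) Q.measurableSet_toSet
      fun x hx => by simp [realize, hx], setLIntegral_const, moment,
      ← ENNReal.ofReal_rpow_of_nonneg (norm_nonneg _) hr.le, ofReal_norm]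
  | node c ih =>
    rw [lintegral_toSet_eq_sum_child, moment,
      ofReal_card_inv_mul_sum_mul_volume Q fun b => (c b).moment_nonneg r]
    refine Finset.sum_congr rfl fun b _ => ?_
    rw [← ih b]
    refine setLIntegral_congr_fun (Q.child b).measurableSet_toSet fun x hx => ?_
    rw [realize_node_eqOn c Q b hx]

lemma realize_nonneg [Lattice E] [IsOrderedAddMonoid E] {t : AvgTree (Fin d → Bool) E}
    (ht : t.Nonneg) (Q : DyadicCube d) :
    0 ≤ t.realize Q := by
  induction t generalizing Q with
  | leaf v => exact fun x => Set.indicator_nonneg (fun _ _ => ht) x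
  | node c ih => exact fun x => Finset.sum_nonneg fun b _ => ih b (ht b) _ x

lemma maxMoment_nonneg {ι : Type*} [Fintype ι] [NormedSpace ℝ E] [Lattice E] (r : ℝ)
    (t : AvgTree ι E) (e : E) :
    0 ≤ t.maxMoment r e := by
  induction t generalizing e with
  | leaf v => exact Real.rpow_nonneg (norm_nonneg _) _
  | node c ih => exact mul_nonneg (by positivity) (Finset.sum_nonneg fun b _ => ih b _)

variable [NormedSpace ℝ E] [CompleteSpace E]

lemma integral_realize (t : AvgTree (Fin d → Bool) E) (Q : DyadicCube d) :
    ∫ x in Q.toSet, t.realize Q x = (volume.real Q.toSet) • t.mean := by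
  induction t generalizing Q with
  | leaf v =>
    rw [setIntegral_congr_fun (g := fun _ => v) Q.measurableSet_toSet
      fun x hx => by simp [realize, hx], setIntegral_const, mean]
  | node c ih =>
    conv_lhs => rw [← Q.iUnion_child]
    rw [integral_iUnion_fintype (fun b => (Q.child b).measurableSet_toSet)
      Q.pairwise_disjoint_child fun b => ((node c).integrable_realize Q).integrableOn, mean,
      smul_smul, Finset.smul_sum]
    refine Finset.sum_congr rfl fun b _ => ?_
    rw [setIntegral_congr_fun (Q.child b).measurableSet_toSet (realize_node_eqOn c Q b), ih b]
    congr 1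
    rw [Measure.real, Measure.real, Q.volume_child b, ENNReal.toReal_mul, ENNReal.toReal_natCast]
    have hc : (Fintype.card (Fin d → Bool) : ℝ) ≠ 0 := by exact_mod_cast Fintype.card_ne_zero
    field_simp

variable [Lattice E] [HasSolidNorm E] [IsOrderedAddMonoid E]

/-- The quantity `maxMoment` bounds from below the moment of any function that dominates all
averages of the encoded step function. -/
lemma maxMoment_mul_volume_le {r : ℝ} (hr : 0 < r) (t : AvgTree (Fin d → Bool) E)
    (Q : DyadicCube d) {f g : EuclideanSpace ℝ (Fin d) → E} {e : E}
    (hf : Set.EqOn f (t.realize Q) Q.toSet) (he : 0 ≤ e) (heg : ∀ x ∈ Q.toSet, e ≤ g x)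
    (hg : ∀ P ∈ t.cubes Q, ∀ x ∈ P.toSet, ⨍ y in P.toSet, f y ≤ g x) :
    ENNReal.ofReal (t.maxMoment r e) * volume Q.toSet ≤ ∫⁻ x in Q.toSet, ‖g x‖ₑ ^ r := by
  have hmean : ⨍ y in Q.toSet, f y = t.mean := by
    rw [setAverage_eq, setIntegral_congr_fun Q.measurableSet_toSet hf, integral_realize,
      smul_smul, inv_mul_cancel₀ ((measureReal_ne_zero_iff Q.volume_toSet_ne_top).2
        Q.volume_toSet_ne_zero), one_smul]
  have hsup : ∀ x ∈ Q.toSet, e ⊔ t.mean ≤ g x := fun x hx =>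
    sup_le (heg x hx) (hmean ▸ hg Q (t.self_mem_cubes Q) x hx)
  induction t generalizing Q e with
  | leaf v =>
    rw [← setLIntegral_const]
    refine setLIntegral_mono' Q.measurableSet_toSet fun x hx => ?_
    rw [maxMoment, ← ENNReal.ofReal_rpow_of_nonneg (norm_nonneg _) hr.le, ofReal_norm]
    gcongr
    exact enorm_le_enorm_of_nonneg_of_le (he.trans le_sup_left) (hsup x hx)
  | node c ih =>
    rw [maxMoment_node, lintegral_toSet_eq_sum_child,
      ofReal_card_inv_mul_sum_mul_volume Q fun b => (c b).maxMoment_nonneg r _]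
    refine Finset.sum_le_sum fun b _ => ?_
    have hfb : Set.EqOn f ((c b).realize (Q.child b)) (Q.child b).toSet :=
      (hf.mono (Q.child_subset b)).trans (realize_node_eqOn c Q b)
    have hgb : ∀ P ∈ (c b).cubes (Q.child b), ∀ x ∈ P.toSet, ⨍ y in P.toSet, f y ≤ g x :=
      fun P hP => hg P (Finset.mem_insert_of_mem (Finset.mem_biUnion.2 ⟨b, Finset.mem_univ _, hP⟩))
    have hmb : ⨍ y in (Q.child b).toSet, f y = (c b).mean := by
      rw [setAverage_eq, setIntegral_congr_fun (Q.child b).measurableSet_toSet hfb,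
        integral_realize, smul_smul, inv_mul_cancel₀ ((measureReal_ne_zero_iff
          (Q.child b).volume_toSet_ne_top).2 (Q.child b).volume_toSet_ne_zero), one_smul]
    have heb : ∀ x ∈ (Q.child b).toSet, e ⊔ (node c).mean ≤ g x := fun x hx =>
      hsup x (Q.child_subset b hx)
    exact ih b (Q.child b) hfb (he.trans le_sup_left) heb hgb hmb fun x hx =>
      sup_le (heb x hx) (hmb ▸ hgb _ ((c b).self_mem_cubes _) x hx)

end AvgTree

variable [NormedAddCommGroup E] [NormedSpace ℝ E] [CompleteSpace E] [Lattice E] [HasSolidNorm E]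
  [IsOrderedAddMonoid E] [IsOrderedModule ℝ E]

/-- The Hardy--Littlewood property, applied to the step functions encoded by trees. -/
theorem HardyLittlewoodBound.treeMaximalBound {r : ℝ} (hr : 1 < r) {A : ℝ≥0}
    (h : HardyLittlewoodBound d E r A) : TreeMaximalBound (Fin d → Bool) E r (A ^ r) := by
  intro t ht
  have hr0 : 0 < r := by linarith
  have hp0 : ENNReal.ofReal r ≠ 0 := (ENNReal.ofReal_pos.2 hr0).ne'
  let Q : DyadicCube d := ⟨0, 0⟩
  set f := t.realize Q with hf
  have hQ0 := Q.volume_toSet_ne_zero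
  have hQt := Q.volume_toSet_ne_top
  have hDne : (t.cubes Q).Nonempty := ⟨Q, t.self_mem_cubes Q⟩
  have hff : ∫⁻ x, ‖f x‖ₑ ^ r = ENNReal.ofReal (t.moment r) * volume Q.toSet := by
    rw [← t.lintegral_enorm_rpow_realize hr0 Q, ← lintegral_indicator Q.measurableSet_toSet]
    refine lintegral_congr fun x => ?_
    by_cases hx : x ∈ Q.toSet
    · simp [hx, hf]
    · simp [hx, hf, t.realize_of_notMem hx, hr0]
  have hnorm : ∀ k : EuclideanSpace ℝ (Fin d) → E,
      eLpNorm k (ENNReal.ofReal r) volume ^ r = ∫⁻ x, ‖k x‖ₑ ^ r := by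
    intro k
    rw [eLpNorm_eq_lintegral_rpow_enorm_toReal hp0 ENNReal.ofReal_ne_top,
      ENNReal.toReal_ofReal hr0.le, ← ENNReal.rpow_mul, one_div_mul_cancel hr0.ne',
      ENNReal.rpow_one]
  have hfmem : MemLp f (ENNReal.ofReal r) volume := by
    refine ⟨(t.stronglyMeasurable_realize Q).aestronglyMeasurable, ?_⟩
    have : eLpNorm f (ENNReal.ofReal r) volume ^ r < ∞ := by
      rw [hnorm, hff]
      exact ENNReal.mul_lt_top ENNReal.ofReal_lt_top hQt.lt_top
    exact (ENNReal.rpow_lt_top_iff_of_pos hr0).1 this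
  set g := latticeMaximal (t.cubes Q) hDne f
  have hg : ∀ P ∈ t.cubes Q, ∀ x ∈ P.toSet, ⨍ y in P.toSet, f y ≤ g x := by
    intro P hP x hx
    have := Finset.le_sup' (fun Q : DyadicCube d =>
      Q.toSet.indicator (fun _ => ⨍ y in Q.toSet, f y) x) hP
    simpa [hx, g, latticeMaximal] using this
  have hg0 : ∀ x ∈ Q.toSet, 0 ≤ g x := fun x hx =>
    (setAverage_nonneg (AvgTree.realize_nonneg ht Q) _).trans (hg Q (t.self_mem_cubes Q) x hx)
  have h1 := t.maxMoment_mul_volume_le hr0 Q (f := f) (fun x _ => rfl) le_rfl hg0 hg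
  have h2 : ENNReal.ofReal (t.maxMoment r 0) * volume Q.toSet
      ≤ ENNReal.ofReal (A ^ r * t.moment r) * volume Q.toSet := by
    calc _ ≤ ∫⁻ x in Q.toSet, ‖g x‖ₑ ^ r := h1
      _ ≤ ∫⁻ x, ‖g x‖ₑ ^ r := setLIntegral_le_lintegral _ _
      _ = eLpNorm g (ENNReal.ofReal r) volume ^ r := (hnorm g).symm
      _ ≤ (A * eLpNorm f (ENNReal.ofReal r) volume) ^ r := by
          gcongr
          exact h _ hDne f hfmem
      _ = A ^ r * (ENNReal.ofReal (t.moment r) * volume Q.toSet) := by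
          rw [ENNReal.mul_rpow_of_nonneg _ _ hr0.le, hnorm, hff]
      _ = _ := by
          rw [ENNReal.ofReal_mul (by positivity),
            ← ENNReal.ofReal_rpow_of_nonneg A.coe_nonneg hr0.le, ENNReal.ofReal_coe_nnreal,
            mul_assoc]
  have h3 := (ENNReal.mul_le_mul_iff_left hQ0 hQt).1 h2
  exact (ENNReal.ofReal_le_ofReal_iff (mul_nonneg (by positivity) (t.moment_nonneg r))).1 h3

end Realization

/-! ### Boundedness of the dyadic operator -/

section Assembly

open scoped Classical

variable {d : ℕ} {E : Type*} [NormedAddCommGroup E] [NormedSpace ℝ E]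
  {μ : Measure (EuclideanSpace ℝ (Fin d))} {D : Finset (DyadicCube d)}
  {lam : DyadicCube d → E →ₗ[ℝ] E}

/-- The coefficient operators indexed by the point sets of the cubes, and zero for other sets. -/
noncomputable def setLam (lam : DyadicCube d → E →ₗ[ℝ] E) :
    Set (EuclideanSpace ℝ (Fin d)) → E →ₗ[ℝ] E :=
  Function.extend DyadicCube.toSet lam 0

lemma setLam_toSet (hd : 0 < d) (Q : DyadicCube d) : setLam lam Q.toSet = lam Q :=
  (DyadicCube.toSet_injective hd).extend_apply _ _ _

lemma dyadicOp_eq_stepSum (hd : 0 < d) (f : EuclideanSpace ℝ (Fin d) → E) :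
    dyadicOp μ D lam f = stepSum (D.image DyadicCube.toSet) (coeff μ (setLam lam) f) := by
  funext x
  rw [dyadicOp, stepSum, Finset.sum_image fun Q _ R _ h => DyadicCube.toSet_injective hd h]
  simp only [coeff, setLam_toSet hd]

lemma dyadicOpLoc_eq_stepSum (hd : 0 < d) (R : DyadicCube d) (f : EuclideanSpace ℝ (Fin d) → E) :
    dyadicOpLoc μ D lam R f
      = stepSum (below (D.image DyadicCube.toSet) R.toSet) (coeff μ (setLam lam) f) := by
  rw [dyadicOpLoc, dyadicOp_eq_stepSum hd, below, Finset.filter_image]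

lemma abs_map_le_map_of_abs_le [Lattice E] [IsOrderedAddMonoid E] {L : E →ₗ[ℝ] E}
    (hL : ∀ e, 0 ≤ e → 0 ≤ L e) {a b : E} (h : |a| ≤ b) : |L a| ≤ L b := by
  refine abs_le'.2 ⟨LinearMap.mono_of_nonneg hL ((le_abs_self a).trans h), ?_⟩
  rw [← map_neg]
  exact LinearMap.mono_of_nonneg hL ((neg_le_abs a).trans h)

variable [Lattice E] [HasSolidNorm E] [IsOrderedAddMonoid E] [IsOrderedModule ℝ E]

/-- By positivity the operator is dominated by its values on nonnegative functions. -/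
lemma norm_dyadicOp_le (hlam : PositiveCoefficients D lam) {f : EuclideanSpace ℝ (Fin d) → E}
    (hf : ∀ Q ∈ D, IntegrableOn f Q.toSet μ) (x : EuclideanSpace ℝ (Fin d)) :
    ‖dyadicOp μ D lam f x‖ ≤ ‖dyadicOp μ D lam (fun y => |f y|) x‖ := by
  have key : ∀ Q ∈ D, |Q.toSet.indicator (fun _ => lam Q (∫ y in Q.toSet, f y ∂μ)) x|
      ≤ Q.toSet.indicator (fun _ => lam Q (∫ y in Q.toSet, |f y| ∂μ)) x := by
    intro Q hQ
    by_cases hx : x ∈ Q.toSet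
    · simp only [hx, Set.indicator_of_mem]
      refine abs_map_le_map_of_abs_le (hlam Q hQ) ?_
      have habs : IntegrableOn (fun y => |f y|) Q.toSet μ :=
        (hf Q hQ).norm.mono' ((hf Q hQ).1.sup (hf Q hQ).1.neg)
          (Filter.Eventually.of_forall fun y => by rw [norm_abs_eq_norm])
      rw [abs_le', ← integral_neg]
      exact ⟨integral_mono (hf Q hQ) habs fun y => le_abs_self _,
        integral_mono (hf Q hQ).neg habs fun y => neg_le_abs _⟩
    · simp [hx]
  refine norm_le_norm_of_abs_le_abs (le_trans ?_ (le_abs_self _))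
  refine abs_le'.2 ⟨Finset.sum_le_sum fun Q hQ => (le_abs_self _).trans (key Q hQ), ?_⟩
  rw [dyadicOp, ← Finset.sum_neg_distrib]
  exact Finset.sum_le_sum fun Q hQ => (neg_le_abs _).trans (key Q hQ)

variable [IsLocallyFiniteMeasure μ]

/-- It suffices to dominate nonnegative functions, as `|f|` has the same norm as `f`. -/
theorem dyadicOpBounded_of_hasDominatingFunction (hd : 0 < d) {p p' : ℝ}
    (hp : p.HolderConjugate p') (hlam : PositiveCoefficients D lam) {b : ℝ≥0}
    (H : ∀ f : EuclideanSpace ℝ (Fin d) → E, 0 ≤ f →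
      (∀ Q : DyadicCube d, IntegrableOn f Q.toSet μ) → ∀ R ∈ D,
      ∫⁻ x in R.toSet, ‖f x‖ₑ ∂μ ≠ 0 →
      HasDominatingFunction μ (D.image DyadicCube.toSet) (setLam lam) f b R.toSet) :
    DyadicOpBounded μ D lam p (8 * b * p'.toNNReal * p.toNNReal) := by
  intro f hf
  have hint : ∀ g : EuclideanSpace ℝ (Fin d) → E, MemLp g (ENNReal.ofReal p) μ →
      ∀ Q : DyadicCube d, IntegrableOn g Q.toSet μ := by
    intro g hg Q
    have : IsFiniteMeasure (μ.restrict Q.toSet) :=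
      ⟨by simpa using (Q.measure_toSet_ne_top μ).lt_top⟩
    exact (hg.restrict _).integrable (by simpa using hp.lt.le)
  have hfa : MemLp (fun y => |f y|) (ENNReal.ofReal p) μ := by
    refine hf.norm.of_le (hf.1.sup hf.1.neg)
      (Filter.Eventually.of_forall fun y => ?_)
    rw [norm_abs_eq_norm, norm_norm]
  have hbound : eLpNorm (dyadicOp μ D lam f) (ENNReal.ofReal p) μ
      ≤ ((8 * b * p'.toNNReal * p.toNNReal : ℝ≥0) : ℝ≥0∞) * eLpNorm f (ENNReal.ofReal p) μ := by
    calc eLpNorm (dyadicOp μ D lam f) (ENNReal.ofReal p) μ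
        ≤ eLpNorm (dyadicOp μ D lam fun y => |f y|) (ENNReal.ofReal p) μ :=
          eLpNorm_mono fun x => norm_dyadicOp_le hlam (fun Q _ => hint f hf Q) x
      _ ≤ 8 * b * ENNReal.ofReal p' * ENNReal.ofReal p
            * eLpNorm (fun y => |f y|) (ENNReal.ofReal p) μ := by
          rw [dyadicOp_eq_stepSum hd]
          refine (DyadicCube.isLaminar_image μ D).eLpNorm_stepSum_le hp ?_ hfa.1
            (fun y => abs_nonneg _) ?_ ?_
          · rw [Finset.forall_mem_image]
            intro Q hQ
            rw [setLam_toSet hd]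
            exact hlam Q hQ
          · rw [Finset.forall_mem_image]
            exact fun Q _ => hint _ hfa Q
          · rw [Finset.forall_mem_image]
            exact fun R hR => H _ (fun y => abs_nonneg _) (hint _ hfa) R hR
      _ = _ := by
          rw [eLpNorm_congr_norm_ae (g := f)
            (Filter.Eventually.of_forall fun y => norm_abs_eq_norm _)]
          push_cast
          rfl
  refine ⟨⟨?_, hbound.trans_lt (ENNReal.mul_lt_top ENNReal.coe_lt_top hf.2)⟩, hbound⟩
  obtain ⟨s, hs⟩ := (DyadicCube.isLaminar_image μ D).exists_simpleFunc_stepSum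
    (coeff μ (setLam lam) f)
  rw [dyadicOp_eq_stepSum hd, ← hs]
  exact s.stronglyMeasurable.aestronglyMeasurable

variable [CompleteSpace E]

/-- Doubling makes the children of a cube comparable with it. The constant is enlarged to `C + 1` to
make it at least `1`. -/
lemma EndpointLinftyTesting.hasDominatingFunction_of_isDoublingWith (hd : 0 < d) {B C : ℝ≥0}
    (hμ : IsDoublingWith μ C) (htest : EndpointLinftyTesting μ D lam B)
    {f : EuclideanSpace ℝ (Fin d) → E} (hf0 : 0 ≤ f)
    (hfi : ∀ Q : DyadicCube d, IntegrableOn f Q.toSet μ) {R : DyadicCube d} (hR : R ∈ D)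
    (hu0 : ∫⁻ x in R.toSet, ‖f x‖ₑ ∂μ ≠ 0) :
    HasDominatingFunction μ (D.image DyadicCube.toSet) (setLam lam) f
      (8 * (C + 1) ^ (d + 3) * B) R.toSet := by
  -- All subcubes of `R` down to the finest scale occurring in `D`.
  let n := D.sup fun Q => (Q.scale - R.scale).toNat
  have hmem : ∀ Q ∈ R.descendants n, Q.toSet ⊆ R.toSet ∧ Q.scale ≤ R.scale + n :=
    fun Q hQ => (DyadicCube.mem_descendants hd).1 hQ
  refine (DyadicCube.isLaminar_image μ D).hasDominatingFunction_of_comparable hf0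
    (DyadicCube.isLaminar_image μ (R.descendants n)) ?_ ?_ (Finset.mem_image_of_mem _ hR) hu0
    ?_ ?_ ?_
  · rw [Finset.forall_mem_image]
    exact fun Q _ => hfi Q
  · exact one_le_pow₀ (by simp)
  · intro S hS
    obtain ⟨hS, hSR⟩ := mem_below.1 hS
    obtain ⟨Q, hQ, rfl⟩ := Finset.mem_image.1 hS
    refine Finset.mem_image_of_mem _ ((DyadicCube.mem_descendants hd).2 ⟨hSR, ?_⟩)
    have : (Q.scale - R.scale).toNat ≤ n :=
      Finset.le_sup (f := fun Q : DyadicCube d => (Q.scale - R.scale).toNat) hQ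
    omega
  · rw [Finset.forall_mem_image]
    intro Q hQ
    obtain ⟨hQR, hQn⟩ := hmem Q hQ
    have hstrict : ∀ P : DyadicCube d, P.toSet ⊂ Q.toSet → Q.scale < P.scale := by
      intro P hP
      by_contra hle
      obtain ⟨x, hx⟩ := P.nonempty_toSet
      exact hP.2 (DyadicCube.subset_of_mem (not_lt.1 hle) (hP.1 hx) hx)
    rcases hQn.eq_or_lt with h | h
    · refine Or.inl ?_
      rw [Finset.forall_mem_image]
      intro P hP hPQ
      have h1 := (hmem P hP).2
      have h2 := hstrict P hPQ
      omega
    · refine Or.inr fun x hx => ?_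
      rw [← Q.iUnion_child] at hx
      obtain ⟨b, hb⟩ := Set.mem_iUnion.1 hx
      refine ⟨(Q.child b).toSet, Finset.mem_image_of_mem _ ((DyadicCube.mem_descendants hd).2
        ⟨(Q.child_subset b).trans hQR, ?_⟩), hb, ⟨Q.child_subset b, fun hsub => ?_⟩, ?_, ?_⟩
      · simp only [DyadicCube.child]
        omega
      · have := DyadicCube.scale_le_of_subset hd hsub
        simp [DyadicCube.child] at this
      · refine (DyadicCube.measure_le_measure_child hμ Q b).trans ?_
        gcongr
        push_cast
        gcongr
        exact le_self_add
      · rw [Finset.forall_mem_image]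
        intro P _ hPQ hPb
        obtain ⟨y, hyP, hyb⟩ := Set.not_disjoint_iff.1 hPb
        exact DyadicCube.subset_of_mem (hstrict P hPQ) hyP hyb
  · intro h hh
    rw [← dyadicOpLoc_eq_stepSum hd]
    exact htest R hR h hh

/-- In positive dimension the children of a cube split into two halves exchanged by flipping the
first bit, so that two trees can be concatenated. -/
lemma exists_bit_flip (hd : 0 < d) : ∃ (σ : (Fin d → Bool) → Bool)
    (φ : (Fin d → Bool) ≃ (Fin d → Bool)), ∀ b, σ (φ b) = !σ b := by
  refine ⟨fun b => b ⟨0, hd⟩, Equiv.piCongrRight fun _ => Equiv.boolNot, fun b => ?_⟩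
  simp

lemma EndpointLinftyTesting.hasDominatingFunction_of_hardyLittlewoodBound (hd : 0 < d) {A B : ℝ≥0}
    {r : ℝ} (hr : 1 < r) (hHL : HardyLittlewoodBound d E r A)
    (htest : EndpointLinftyTesting μ D lam B)
    {f : EuclideanSpace ℝ (Fin d) → E} (hf0 : 0 ≤ f)
    (hfi : ∀ Q : DyadicCube d, IntegrableOn f Q.toSet μ) {R : DyadicCube d} (hR : R ∈ D)
    (hu0 : ∫⁻ x in R.toSet, ‖f x‖ₑ ∂μ ≠ 0) :
    HasDominatingFunction μ (D.image DyadicCube.toSet) (setLam lam) f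
      (64 * (2 * A + 1) * ⌈r⌉₊.factorial * B) R.toSet := by
  obtain ⟨σ, φ, hσ⟩ := exists_bit_flip hd
  have hD := DyadicCube.isLaminar_image μ D
  refine hD.hasDominatingFunction_of_latMax hf0 ?_ hr (Finset.mem_image_of_mem _ hR) hu0 ?_ ?_
  · rw [Finset.forall_mem_image]
    exact fun Q _ => hfi Q
  · exact fun T hT hRT hTR h hh0 hh =>
      (hD.subset hT).eLpNorm_latMax_le hr (hHL.treeMaximalBound hr) hσ hRT hTR hh0 hh
  · intro h hh
    rw [← dyadicOpLoc_eq_stepSum hd]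
    exact htest R hR h hh

lemma EndpointLtTesting.hasDominatingFunction (hd : 0 < d) {B : ℝ≥0} {t : ℝ} (ht : 1 < t)
    (htest : EndpointLtTesting μ D lam t B) {f : EuclideanSpace ℝ (Fin d) → E} (hf0 : 0 ≤ f)
    (hfi : ∀ Q : DyadicCube d, IntegrableOn f Q.toSet μ) {R : DyadicCube d} (hR : R ∈ D)
    (hu0 : ∫⁻ x in R.toSet, ‖f x‖ₑ ∂μ ≠ 0) :
    HasDominatingFunction μ (D.image DyadicCube.toSet) (setLam lam) f
      (8 * ⌈t⌉₊.factorial * B) R.toSet := by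
  refine (DyadicCube.isLaminar_image μ D).hasDominatingFunction_of_Lt hf0 ?_ ht
    (Finset.mem_image_of_mem _ hR) hu0 fun h hh => ?_
  · rw [Finset.forall_mem_image]
    exact fun Q _ => hfi Q
  · rw [← dyadicOpLoc_eq_stepSum hd]
    exact htest R hR h hh

end Assembly

/-- Boundedness is uniform: the constant `K` does not depend on the collection `𝒟` and the
coefficients `λ_Q`. In (i) it depends only on `p`, `d` and the exponent `r ∈ (1,∞)` and constant `A`
of the Hardy--Littlewood property of `E`; in (ii) only on `p`, `d` and the doubling constant of `μ`;
in (iii) only on `p` and `t`. -/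
theorem mainTheorem3 (p : ℝ) (hp : 1 < p) :
    -- (i) `L^∞` testing and the Hardy--Littlewood property of `E`
    (∀ (d : ℕ), 0 < d → ∀ (r : ℝ), 1 < r → ∀ (A : ℝ≥0), ∃ K : ℝ≥0,
      ∀ (E : Type u) [NormedAddCommGroup E] [NormedSpace ℝ E] [CompleteSpace E] [Lattice E]
        [HasSolidNorm E] [IsOrderedAddMonoid E] [IsOrderedModule ℝ E]
        (μ : Measure (EuclideanSpace ℝ (Fin d))) [IsLocallyFiniteMeasure μ]
        (D : Finset (DyadicCube d)) (lam : DyadicCube d → E →ₗ[ℝ] E) (B : ℝ≥0),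
        HardyLittlewoodBound d E r A →
        PositiveCoefficients D lam →
        EndpointLinftyTesting μ D lam B →
        DyadicOpBounded μ D lam p (K * B)) ∧
    -- (ii) `L^∞` testing and doubling of `μ`
    (∀ (d : ℕ), 0 < d → ∀ (C : ℝ≥0), ∃ K : ℝ≥0,
      ∀ (E : Type u) [NormedAddCommGroup E] [NormedSpace ℝ E] [CompleteSpace E] [Lattice E]
        [HasSolidNorm E] [IsOrderedAddMonoid E] [IsOrderedModule ℝ E]
        (μ : Measure (EuclideanSpace ℝ (Fin d))) [IsLocallyFiniteMeasure μ]
        (D : Finset (DyadicCube d)) (lam : DyadicCube d → E →ₗ[ℝ] E) (B : ℝ≥0),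
        IsDoublingWith μ C →
        PositiveCoefficients D lam →
        EndpointLinftyTesting μ D lam B →
        DyadicOpBounded μ D lam p (K * B)) ∧
    -- (iii) `L^t` testing for some `t ∈ (p,∞)`
    (∀ (t : ℝ), p < t → ∃ K : ℝ≥0,
      ∀ (d : ℕ), 0 < d →
      ∀ (E : Type u) [NormedAddCommGroup E] [NormedSpace ℝ E] [CompleteSpace E] [Lattice E]
        [HasSolidNorm E] [IsOrderedAddMonoid E] [IsOrderedModule ℝ E]
        (μ : Measure (EuclideanSpace ℝ (Fin d))) [IsLocallyFiniteMeasure μ]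
        (D : Finset (DyadicCube d)) (lam : DyadicCube d → E →ₗ[ℝ] E) (B : ℝ≥0),
        PositiveCoefficients D lam →
        EndpointLtTesting μ D lam t B →
        DyadicOpBounded μ D lam p (K * B)) := by
  have hpp := Real.HolderConjugate.conjExponent hp
  refine ⟨fun d hd r hr A => ⟨8 * (64 * (2 * A + 1) * ⌈r⌉₊.factorial)
      * p.conjExponent.toNNReal * p.toNNReal, ?_⟩,
    fun d hd C => ⟨8 * (8 * (C + 1) ^ (d + 3)) * p.conjExponent.toNNReal * p.toNNReal, ?_⟩,
    fun t ht => ⟨8 * (8 * ⌈t⌉₊.factorial) * p.conjExponent.toNNReal * p.toNNReal, ?_⟩⟩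
  · intro E _ _ _ _ _ _ _ μ _ D lam B hHL hlam htest
    have := dyadicOpBounded_of_hasDominatingFunction hd hpp hlam fun f hf0 hfi R hR hu0 =>
      htest.hasDominatingFunction_of_hardyLittlewoodBound hd hr hHL hf0 hfi hR hu0
    convert this using 1
    ring
  · intro E _ _ _ _ _ _ _ μ _ D lam B hμ hlam htest
    have := dyadicOpBounded_of_hasDominatingFunction hd hpp hlam fun f hf0 hfi R hR hu0 =>
      htest.hasDominatingFunction_of_isDoublingWith hd hμ hf0 hfi hR hu0
    convert this using 1
    ring
  · intro d hd E _ _ _ _ _ _ _ μ _ D lam B hlam htest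
    have := dyadicOpBounded_of_hasDominatingFunction hd hpp hlam fun f hf0 hfi R hR hu0 =>
      htest.hasDominatingFunction hd (hp.trans ht) hf0 hfi hR hu0
    convert this using 1
    ring
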